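/- **Theorem 1.1.** Notation: $q=e^{2\pi i\tau}$ for $\tau\in\mathbb{H}$, $q^x=e^{2\pi i\tau x}$, $\zeta_N=e^{2\pi i/N}$; $\delta_{\mathcal S}$ is $1$ if $\mathcal S$ holds and $0$ otherwise; $((x))=x-\lfloor x\rfloor-\frac12$ for $x\in\mathbb{R}\setminus\mathbb{Z}$ and $((x))=0$ for $x\in\mathbb{Z}$; $\psi(x)=\Gamma'(x)/\Gamma(x)$ is the digamma function; $\mathrm{Log}$ is the principal branch of the logarithm; $\mathrm{PV}$ denotes the Cauchy principal value. For $R\in\mathbb{N}$, $r\in\{1,\dots,R\}$, $\boldsymbol\alpha=(\alpha_1,\alpha_2)\in\mathbb{Z}^2$, $\varrho\in\mathbb{Q}$ and $\tau\in\mathbb{H}$ put $$F_{R,r}(\tau)=\sum_{\substack{m\ge1\\ m\equiv r\ (\mathrm{mod}\ R)}}\frac{q^m}{1-q^m},\qquad f_{R,\boldsymbol\alpha}(\tau)=\frac14\sum_{\substack{\boldsymbol n\in\mathbb{Z}^2+\boldsymbol\alpha/R\\ n_1,n_2\ne0}}\bigl(\mathrm{sgn}(n_1)+\mathrm{sgn}(n_2)\bigr)q^{Rn_1n_2},$$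 $$\mathcal{I}_{R,\boldsymbol\alpha,\varrho}(\tau)=\frac1{2\pi i}\sum_{\substack{\boldsymbol n\in\mathbb{Z}^2+\boldsymbol\alpha/R\\ n_1,n_2\ne0}}\frac{e^{2\pi iR\varrho n_1n_2}}{Rn_1n_2}\,\mathrm{PV}\!\int_0^\infty\frac{x\,e^{2\pi i(\tau-\varrho)x}}{x-Rn_1n_2}\,dx .$$ Let $R\in\mathbb{N}$, $r\in\{1,\dots,R\}$, and let $h,k$ be integers with $0\le h<k$ and $\gcd(h,k)=1$. Let $h'\in\mathbb{Z}$ be such that $0\le h'<k$ and $hh'\equiv-1\pmod k$. Define $$A_{R,r,h,k}=-\frac{k}{2\pi R}\sum_{\ell=0}^{k-1}\left(\pi i\left(\!\left(\tfrac{h(R\ell+r)}{k}\right)\!\right)+\frac{\delta_{k\nmid(R\ell+r)}}2\log\!\left(4\sin^2\!\left(\tfrac{\pi h(R\ell+r)}{k}\right)\right)+\delta_{k\mid(R\ell+r)}\left(\log\!\left(\tfrac{2\pi R}{k}\right)+\psi\!\left(\tfrac{R\ell+r}{Rk}\right)\right)\right),$$ $$B_{R,r,h,k}=\frac12\sum_{\ell=0}^{k-1}\left(\frac{R\ell+r}{Rk}-\frac12\right)\left(1-i\,\delta_{k\nmid(R\ell+r)}\cot\!\left(\tfrac{\pi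 h(R\ell+r)}{k}\right)\right),\qquad C_{R,r,k}=\frac{k^2\,\delta_{\gcd(R,k)\mid r}}{2\pi\,\mathrm{lcm}(R,k)},$$ $$\psi_{R,r,h,k}(\boldsymbol\alpha)=\frac{\zeta_{Rk}^{-h'\alpha_1\alpha_2}}{Rk}\sum_{\nu_1,\nu_2\ (\mathrm{mod}\ k)}e^{\frac{2\pi i}{k}\left(Rh\nu_1\left(\nu_2+\frac rR\right)-\alpha_2\nu_1-\alpha_1\left(\nu_2+\frac rR\right)\right)} .$$ (In $A$ and $B$, a term multiplied by $\delta_{\mathcal S}$ is omitted when $\mathcal S$ fails.) Then, for every $z\in\mathbb{C}$ with $\mathrm{Re}(z)>0$, the series defining $F_{R,r}$ at $\frac hk+\frac{iz}{k^2}$, and the series and principal values defining $f_{R,\boldsymbol\alpha}$ and $\mathcal I_{R,\boldsymbol\alpha,h'/k}$ at $\frac{h'}k+\frac iz$, converge (the series absolutely), and $$F_{R,r}\!\left(\frac hk+\frac{iz}{k^2}\right)=-C_{R,r,k}\frac{\mathrm{Log}(z)}{z}+\frac{A_{R,r,h,k}}{z}+B_{R,r,h,k}+\frac{ik}{z}\sum_{\alpha_1,\alpha_2\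 (\mathrm{mod}\ R)}\psi_{R,r,h,k}(\boldsymbol\alpha)\left(f_{R,\boldsymbol\alpha}\!\left(\frac{h'}k+\frac iz\right)+\mathcal I_{R,\boldsymbol\alpha,\frac{h'}k}\!\left(\frac{h'}k+\frac iz\right)\right).$$ -/

import Mathlib

noncomputable section

namespace Eisenstein

/-- The summand `q^m / (1 - q^m)`, with `q = e^{2πiτ}`, of the weight one Eisenstein series. -/
def FTerm (τ : ℂ) (m : ℕ) : ℂ :=
  Complex.exp (2 * Real.pi * Complex.I * τ) ^ m /
    (1 - Complex.exp (2 * Real.pi * Complex.I * τ) ^ m)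

/-- The index set `{m ≥ 1 : m ≡ r (mod R)}`. -/
def progression (R r : ℕ) : Set ℕ := {m | 1 ≤ m ∧ m ≡ r [MOD R]}

/-- `F_{R,r}(τ) = ∑_{m ≥ 1, m ≡ r (mod R)} q^m / (1 - q^m)`. -/
def F (R r : ℕ) (τ : ℂ) : ℂ := ∑' m : progression R r, FTerm τ m

/-- For `j ∈ ℤ` and `a ∈ ℤ`, the point `j + a / R` of `ℤ + a / R`. -/
def coset (R : ℕ) (a j : ℤ) : ℝ := (j : ℝ) + (a : ℝ) / (R : ℝ)

/-- Parametrizes the vectors `(n₁, n₂) ∈ ℤ² + α / R` with `n₁, n₂ ≠ 0`, by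
`(n₁, n₂) = (m₁ + α₁ / R, m₂ + α₂ / R)`. -/
def latticeIndex (R : ℕ) (α : ℤ × ℤ) : Set (ℤ × ℤ) :=
  {m | coset R α.1 m.1 ≠ 0 ∧ coset R α.2 m.2 ≠ 0}

/-- The real number `R n₁ n₂`, where `n = m + α / R`. -/
def quadForm (R : ℕ) (α m : ℤ × ℤ) : ℝ := (R : ℝ) * coset R α.1 m.1 * coset R α.2 m.2

/-- The summand `(sgn n₁ + sgn n₂) q^{R n₁ n₂}`, `n = m + α / R`, with `q^x = e^{2πiτx}`. -/
def fTerm (R : ℕ) (α : ℤ × ℤ) (τ : ℂ) (m : ℤ × ℤ) : ℂ :=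
  ((Real.sign (coset R α.1 m.1) + Real.sign (coset R α.2 m.2) : ℝ) : ℂ) *
    Complex.exp (2 * Real.pi * Complex.I * τ * (quadForm R α m : ℂ))

/-- The indefinite theta function
`f_{R,α}(τ) = 1/4 ∑_{n ∈ ℤ² + α/R, n₁, n₂ ≠ 0} (sgn n₁ + sgn n₂) q^{R n₁ n₂}`. -/
def f (R : ℕ) (α : ℤ × ℤ) (τ : ℂ) : ℂ :=
  (1 / 4 : ℂ) * ∑' m : latticeIndex R α, fTerm R α τ m

/-- The half line `(0, ∞)` with the symmetric interval `(a - ε, a + ε)` removed. -/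
def pvDomain (a ε : ℝ) : Set ℝ := {x | 0 < x ∧ ε ≤ |x - a|}

/-- The truncated integral of `g` over `(0, ∞)` without `(a - ε, a + ε)`. -/
def pvTruncated (g : ℝ → ℂ) (a ε : ℝ) : ℂ := ∫ x in pvDomain a ε, g x

/-- The Cauchy principal value `PV ∫_0^∞ g(x) dx` exists, for `g` with its only singularity
at the point `a`. -/
def PVExists (g : ℝ → ℂ) (a : ℝ) : Prop :=
  (∀ ε : ℝ, 0 < ε → MeasureTheory.IntegrableOn g (pvDomain a ε)) ∧
    ∃ L : ℂ, Filter.Tendsto (pvTruncated g a) (nhdsWithin 0 (Set.Ioi 0)) (nhds L)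

/-- The Cauchy principal value `PV ∫_0^∞ g(x) dx`, for `g` with its only singularity at `a`. -/
def pvIntegral (g : ℝ → ℂ) (a : ℝ) : ℂ :=
  Filter.limUnder (nhdsWithin (0 : ℝ) (Set.Ioi 0)) (pvTruncated g a)

/-- The integrand `x e^{2πi(τ - ϱ)x} / (x - a)`. -/
def mordellIntegrand (ϱ : ℚ) (τ : ℂ) (a x : ℝ) : ℂ :=
  (x : ℂ) * Complex.exp (2 * Real.pi * Complex.I * (τ - (ϱ : ℂ)) * (x : ℂ)) /
    ((x : ℂ) - (a : ℂ))

/-- The summand of the Mordell-type function: with `a = R n₁ n₂`, `n = m + α / R`, it is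
`e^{2πiϱa} / a · PV ∫_0^∞ x e^{2πi(τ - ϱ)x} / (x - a) dx`. -/
def mordellTerm (R : ℕ) (α : ℤ × ℤ) (ϱ : ℚ) (τ : ℂ) (m : ℤ × ℤ) : ℂ :=
  Complex.exp (2 * Real.pi * Complex.I * (ϱ : ℂ) * (quadForm R α m : ℂ)) /
      (quadForm R α m : ℂ) *
    pvIntegral (mordellIntegrand ϱ τ (quadForm R α m)) (quadForm R α m)

/-- The Mordell-type function `𝓘_{R,α,ϱ}(τ)`. -/
def mordell (R : ℕ) (α : ℤ × ℤ) (ϱ : ℚ) (τ : ℂ) : ℂ :=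
  1 / (2 * Real.pi * Complex.I) * ∑' m : latticeIndex R α, mordellTerm R α ϱ τ m

/-- The sawtooth function: `x - ⌊x⌋ - 1/2` for `x ∉ ℤ`, and `0` for `x ∈ ℤ`. -/
def sawtooth (x : ℝ) : ℝ := if Int.fract x = 0 then 0 else x - (⌊x⌋ : ℝ) - 1 / 2

/-- The constant `A_{R,r,h,k}`. -/
def constA (R r h k : ℕ) : ℂ :=
  -((k : ℂ) / (2 * Real.pi * R)) * ∑ l ∈ Finset.range k,
    (Real.pi * Complex.I * (sawtooth ((h : ℝ) * ((R : ℝ) * l + r) / k) : ℂ)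
      + (if k ∣ R * l + r then 0 else
          ((1 / 2 * Real.log (4 * Real.sin (Real.pi * h * ((R : ℝ) * l + r) / k) ^ 2) : ℝ) : ℂ))
      + (if k ∣ R * l + r then
          ((Real.log (2 * Real.pi * R / k) : ℝ) : ℂ)
            + Complex.digamma (((R : ℂ) * l + r) / ((R : ℂ) * k))
          else 0))

/-- The constant `B_{R,r,h,k}`. -/
def constB (R r h k : ℕ) : ℂ :=
  1 / 2 * ∑ l ∈ Finset.range k,
    (((R : ℂ) * l + r) / ((R : ℂ) * k) - 1 / 2) *
      (1 - Complex.I * (if k ∣ R * l + r then 0 else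
        ((Real.cot (Real.pi * h * ((R : ℝ) * l + r) / k) : ℝ) : ℂ)))

/-- The constant `C_{R,r,k} = k² δ_{gcd(R,k) ∣ r} / (2π lcm(R,k))`. -/
def constC (R r k : ℕ) : ℂ :=
  (k : ℂ) ^ 2 * (if Nat.gcd R k ∣ r then 1 else 0) / (2 * Real.pi * (Nat.lcm R k : ℂ))

/-- The Weil multiplier `ψ_{R,r,h,k}(α)`; `h'` is the integer with `0 ≤ h' < k` and
`h h' ≡ -1 (mod k)`, which `h` and `k` determine. -/
def weilMultiplier (R r h k : ℕ) (h' : ℤ) (α : ℤ × ℤ) : ℂ :=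
  Complex.exp (2 * Real.pi * Complex.I / ((R : ℂ) * k) * (-(h' : ℂ) * α.1 * α.2)) /
      ((R : ℂ) * k) *
    ∑ ν₁ ∈ Finset.range k, ∑ ν₂ ∈ Finset.range k,
      Complex.exp (2 * Real.pi * Complex.I / (k : ℂ) *
        ((R : ℂ) * h * ν₁ * ((ν₂ : ℂ) + (r : ℂ) / R) - (α.2 : ℂ) * ν₁
          - (α.1 : ℂ) * ((ν₂ : ℂ) + (r : ℂ) / R)))

end Eisenstein

end

noncomputable section

namespace Eisenstein

open MeasureTheory Filter Topology Set

/-! Writing m = R(l + kj) + r with 0 ≤ l < k splits F into k sums over j ≥ 0 of the kernel E/(1 -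
E), E = e^{2πiθ - vt}, taken at v = a + j, where θ = h(Rl + r)/k, t = 2πRz/k and a = (Rl + r)/(Rk)
lies in (0, 1] (`F_eq_sum_lambertSum`). In v the kernel has simple poles at 2πi(θ + n)/t, and by the
Lipschitz formula its derivative is -1/t times the sum of (v + (θ + n)ξ)⁻² with ξ = -2πi/t. When θ
is an integer, that is when k divides Rl + r, one pole sits at v = 0; it is split off and accounts
for the digamma values and for Log z.

The sum over j, corrected by the digamma function, is a function of a on [0, 1] whose derivative is
a periodization. After subtraction of the multiple of a - 1/2 that matches its end values it is
expanded in a Fourier series (`hasSum_fourier_of_hasDerivAt_tsum`). The mean value yields A and the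
logarithm, the jump yields B, and the coefficient at a nonzero frequency unfolds to a Fourier
integral over (0, ∞), computed pole by pole (`hasSum_oscInt`). This is `lambertSum_eq`: a double
series over frequencies N and poles y = θ + n of values of `oscSide` at 2πNy/t.

With y = N₂/k this argument is N₁N₂/(Rz). Turning the contour would change `oscSide` into a Laplace
integral: a principal value and, when N₁N₂ > 0 puts the pole on the ray, half a residue ±πi
e^{-2πN₁N₂/(Rz)}. No contour is moved here: both sides satisfy the same first-order linear
differential equation in w, and the free constant is found from behaviour at infinity
(`oscSide_neg`) or at the origin (`oscSide_pos`). By `pv_laplace` and `fTerm_add_mordellTerm` the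
principal values are the terms of 𝓘 and the half residues those of f.

Summation over l weights the lattice point (N₁, N₂) by a sum over the l with h(Rl + r) ≡ N₂ mod k.
Orthogonality of characters and hh' ≡ -1 identify this weight with ψ(α) e^{2πih'Rn₁n₂/k}, up to the
factor R (`weilMultiplier_mul_exp`). -/

/-! ### Oscillatory integrals against `(s + X)⁻²` -/

/-- Points off the negative real axis keep a distance from it that grows linearly. -/
lemma exists_le_norm_add {X : ℂ} (hX : X ∈ Complex.slitPlane) :
    ∃ κ : ℝ, 0 < κ ∧ κ ≤ 1 ∧ ∀ s : ℝ, 0 ≤ s → κ * (s + ‖X‖) ≤ ‖(s : ℂ) + X‖ := by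
  have hX0 : 0 < ‖X‖ := norm_pos_iff.2 (Complex.slitPlane_ne_zero hX)
  have hre : -‖X‖ < X.re := by
    rcases lt_or_eq_of_le (neg_le_of_abs_le (Complex.abs_re_le_norm X)) with h | h
    · exact h
    · exfalso
      have h1 : X.im = 0 := by
        have := Complex.sq_norm_sub_sq_re X
        rw [← h] at this
        nlinarith
      rcases hX with h2 | h2
      · linarith
      · exact h2 h1
  set c := X.re / ‖X‖ with hc
  have hc1 : -1 < c := by rw [hc, lt_div_iff₀ hX0]; linarith
  have hc2 : c ≤ 1 := by rw [hc, div_le_one hX0]; exact Complex.re_le_norm X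
  have hcX : X.re = c * ‖X‖ := by rw [hc]; field_simp
  -- As c is the cosine of the argument of X, the constant is the cosine of half that argument: ‖s +
  -- X‖² - (1 + c)/2 · (s + ‖X‖)² = (1 - c)/2 · (s - ‖X‖)².
  refine ⟨Real.sqrt ((1 + c) / 2), Real.sqrt_pos.2 (by linarith),
    Real.sqrt_le_one.2 (by linarith), fun s hs => ?_⟩
  have h2 : ‖(s : ℂ) + X‖ ^ 2 = s ^ 2 + 2 * s * X.re + ‖X‖ ^ 2 := by
    rw [Complex.sq_norm, Complex.sq_norm, Complex.normSq_apply, Complex.normSq_apply]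
    simp; ring
  refine (sq_le_sq₀ (mul_nonneg (Real.sqrt_nonneg _) (by positivity)) (norm_nonneg _)).1 ?_
  rw [mul_pow, Real.sq_sqrt (by linarith), h2, hcX]
  nlinarith [mul_nonneg (sub_nonneg.2 hc2) (sq_nonneg (s - ‖X‖))]

lemma integrableOn_one_div_add_pow {r : ℝ} (hr : 0 < r) {n : ℕ} (hn : 2 ≤ n) :
    IntegrableOn (fun s : ℝ => 1 / (s + r) ^ n) (Ioi 0) := by
  have h : ∀ x ∈ Ici (0 : ℝ), HasDerivAt (fun s : ℝ => -(1 / (n - 1 : ℝ)) * (1 / (s + r) ^ (n - 1)))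
      (1 / (x + r) ^ n) x := by
    intro x hx
    have hx' : 0 < x + r := by have : (0 : ℝ) ≤ x := hx; linarith
    obtain ⟨m, rfl⟩ : ∃ m, n = m + 2 := ⟨n - 2, by omega⟩
    have h1 : HasDerivAt (fun s : ℝ => (s + r) ^ (m + 1)) (((m + 1 : ℕ) : ℝ) * (x + r) ^ m * 1) x :=
      ((hasDerivAt_id x).add_const r).pow (m + 1)
    have h2 := ((hasDerivAt_const x (1 : ℝ)).div h1 (by positivity)).const_mul
      (-(1 / ((m + 2 : ℕ) - 1 : ℝ)))
    refine h2.congr_deriv ?_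
    have : ((m : ℝ) + 1) ≠ 0 := by positivity
    have h3 : ((m + 2 : ℕ) : ℝ) - 1 = m + 1 := by push_cast; ring
    rw [h3]
    push_cast
    field_simp
    ring
  refine integrableOn_Ioi_deriv_of_nonneg' h (l := -(1 / (n - 1 : ℝ)) * 0) (fun x hx => ?_) ?_
  · have : (0 : ℝ) < x := hx
    positivity
  · refine Tendsto.const_mul _ ?_
    refine tendsto_const_nhds.div_atTop ?_
    refine (tendsto_pow_atTop (by omega)).comp (tendsto_atTop_add_const_right _ _ tendsto_id)

lemma integral_one_div_add_pow_three {r : ℝ} (hr : 0 < r) :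
    ∫ s in Ioi (0 : ℝ), 1 / (s + r) ^ 3 = 1 / (2 * r ^ 2) := by
  have h : ∀ x ∈ Ici (0 : ℝ), HasDerivAt (fun s : ℝ => -(1 / 2) * (1 / (s + r) ^ 2))
      (1 / (x + r) ^ 3) x := by
    intro x hx
    have hx' : 0 < x + r := by have : (0 : ℝ) ≤ x := hx; linarith
    have h1 : HasDerivAt (fun s : ℝ => (s + r) ^ 2) ((2 : ℕ) * (x + r) ^ 1 * 1) x :=
      ((hasDerivAt_id x).add_const r).pow 2
    refine (((hasDerivAt_const x (1 : ℝ)).div h1 (by positivity)).const_mul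
      (-(1 / 2))).congr_deriv ?_
    push_cast
    field_simp
    ring
  rw [integral_Ioi_of_hasDerivAt_of_tendsto' h (integrableOn_one_div_add_pow hr (by norm_num))
    (m := -(1 / 2) * 0)]
  · simp; ring
  · refine Tendsto.const_mul _ (tendsto_const_nhds.div_atTop ?_)
    exact (tendsto_pow_atTop (by omega)).comp (tendsto_atTop_add_const_right _ _ tendsto_id)

/-- The oscillating factor `e^{2πiσs}`. -/
def osc (σ s : ℝ) : ℂ := Complex.exp (2 * Real.pi * Complex.I * σ * s)

lemma norm_osc (σ s : ℝ) : ‖osc σ s‖ = 1 := by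
  rw [osc, show 2 * (Real.pi : ℂ) * Complex.I * σ * s = ((2 * Real.pi * σ * s : ℝ) : ℂ) * Complex.I by
    push_cast; ring]
  exact Complex.norm_exp_ofReal_mul_I _

lemma continuous_osc (σ : ℝ) : Continuous (osc σ) := by
  unfold osc
  fun_prop

lemma hasDerivAt_osc (σ s : ℝ) :
    HasDerivAt (osc σ) (2 * Real.pi * Complex.I * σ * osc σ s) s := by
  have h : HasDerivAt (fun s : ℝ => 2 * (Real.pi : ℂ) * Complex.I * σ * s)
      (2 * (Real.pi : ℂ) * Complex.I * σ * 1) s := (hasDerivAt_id s).ofReal_comp.const_mul _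
  refine h.cexp.congr_deriv ?_
  rw [osc]; ring

lemma slit_add_ne_zero {X : ℂ} (hX : X ∈ Complex.slitPlane) {s : ℝ} (hs : 0 ≤ s) :
    (s : ℂ) + X ≠ 0 := by
  obtain ⟨κ, hκ, -, h⟩ := exists_le_norm_add hX
  have h0 : 0 < ‖X‖ := norm_pos_iff.2 (Complex.slitPlane_ne_zero hX)
  exact norm_pos_iff.1 (lt_of_lt_of_le (by positivity) (h s hs))

lemma continuousOn_osc_div {X : ℂ} (hX : X ∈ Complex.slitPlane) (σ : ℝ) (n : ℕ) :
    ContinuousOn (fun s : ℝ => osc σ s / ((s : ℂ) + X) ^ n) (Ici 0) := by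
  refine (continuous_osc σ).continuousOn.div (by fun_prop) fun s hs => ?_
  exact pow_ne_zero _ (slit_add_ne_zero hX hs)

lemma norm_osc_div_le {X : ℂ} {κ : ℝ} (hκ : 0 < κ) (hX0 : 0 < ‖X‖)
    (h : ∀ s : ℝ, 0 ≤ s → κ * (s + ‖X‖) ≤ ‖(s : ℂ) + X‖) (σ : ℝ) (n : ℕ) {s : ℝ} (hs : 0 ≤ s) :
    ‖osc σ s / ((s : ℂ) + X) ^ n‖ ≤ 1 / κ ^ n * (1 / (s + ‖X‖) ^ n) := by
  rw [norm_div, norm_osc, norm_pow, one_div_mul_one_div, ← mul_pow]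
  have := h s hs
  gcongr

lemma integrableOn_osc_div {X : ℂ} (hX : X ∈ Complex.slitPlane) (σ : ℝ) {n : ℕ} (hn : 2 ≤ n) :
    IntegrableOn (fun s : ℝ => osc σ s / ((s : ℂ) + X) ^ n) (Ioi 0) := by
  obtain ⟨κ, hκ, -, h⟩ := exists_le_norm_add hX
  have h0 : 0 < ‖X‖ := norm_pos_iff.2 (Complex.slitPlane_ne_zero hX)
  refine Integrable.mono' ((integrableOn_one_div_add_pow h0 hn).const_mul (1 / κ ^ n))
    (((continuousOn_osc_div hX σ n).mono Ioi_subset_Ici_self).aestronglyMeasurable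
      measurableSet_Ioi) ?_
  refine (ae_restrict_iff' measurableSet_Ioi).2 (Eventually.of_forall fun s hs => ?_)
  exact norm_osc_div_le hκ h0 h σ n (le_of_lt hs)

/-- The integral `∫_0^∞ e^{2πiσs} (s + X)⁻² ds`. -/
def oscInt (σ : ℝ) (X : ℂ) : ℂ := ∫ s in Ioi (0 : ℝ), osc σ s / ((s : ℂ) + X) ^ 2

/-- Integrate the derivative of e^{2πiσs}(s + X)⁻² over the half line. The relation is used both to
estimate `oscInt` and to differentiate it in X, since that derivative is -2 times the cubic
integral. -/
lemma integral_osc_div_cube {X : ℂ} (hX : X ∈ Complex.slitPlane) (σ : ℝ) :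
    2 * ∫ s in Ioi (0 : ℝ), osc σ s / ((s : ℂ) + X) ^ 3
      = 1 / X ^ 2 + 2 * Real.pi * Complex.I * σ * oscInt σ X := by
  have hd : ∀ s ∈ Ici (0 : ℝ), HasDerivAt (fun s : ℝ => osc σ s / ((s : ℂ) + X) ^ 2)
      (2 * Real.pi * Complex.I * σ * (osc σ s / ((s : ℂ) + X) ^ 2)
        - 2 * (osc σ s / ((s : ℂ) + X) ^ 3)) s := by
    intro s hs
    have hne := slit_add_ne_zero hX hs
    have h1 : HasDerivAt (fun s : ℝ => ((s : ℂ) + X) ^ 2) ((2 : ℕ) * ((s : ℂ) + X) ^ 1 * 1) s :=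
      ((hasDerivAt_id s).ofReal_comp.add_const X).pow 2
    refine ((hasDerivAt_osc σ s).div h1 (pow_ne_zero _ hne)).congr_deriv ?_
    push_cast
    field_simp
  have i2 := (integrableOn_osc_div hX σ (le_refl 2)).const_mul (2 * Real.pi * Complex.I * σ)
  have i3 := (integrableOn_osc_div hX σ (show 2 ≤ 3 by norm_num)).const_mul 2
  obtain ⟨κ, hκ, -, h⟩ := exists_le_norm_add hX
  have h0 : 0 < ‖X‖ := norm_pos_iff.2 (Complex.slitPlane_ne_zero hX)
  have key := integral_Ioi_of_hasDerivAt_of_tendsto' hd (i2.sub i3) (m := 0) ?_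
  · rw [integral_sub i2 i3, integral_const_mul, integral_const_mul] at key
    have : osc σ 0 = 1 := by simp [osc]
    rw [this] at key
    simp only [Complex.ofReal_zero, zero_add, zero_sub] at key
    rw [oscInt]
    linear_combination -key
  · rw [tendsto_zero_iff_norm_tendsto_zero]
    have lim : Tendsto (fun s : ℝ => 1 / κ ^ 2 * (1 / (s + ‖X‖) ^ 2)) atTop (𝓝 (1 / κ ^ 2 * 0)) := by
      refine Tendsto.const_mul _ (tendsto_const_nhds.div_atTop ?_)
      exact (tendsto_pow_atTop (by omega)).comp (tendsto_atTop_add_const_right _ _ tendsto_id)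
    rw [mul_zero] at lim
    refine squeeze_zero' (Eventually.of_forall fun s => norm_nonneg _) ?_ lim
    filter_upwards [eventually_ge_atTop 0] with s hs
    exact norm_osc_div_le hκ h0 h σ 2 hs

lemma norm_integral_osc_div_cube_le {X : ℂ} {κ : ℝ} (hκ : 0 < κ) (hX0 : 0 < ‖X‖)
    (h : ∀ s : ℝ, 0 ≤ s → κ * (s + ‖X‖) ≤ ‖(s : ℂ) + X‖) (σ : ℝ) :
    ‖∫ s in Ioi (0 : ℝ), osc σ s / ((s : ℂ) + X) ^ 3‖ ≤ 1 / (2 * κ ^ 3 * ‖X‖ ^ 2) := by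
  refine (norm_integral_le_of_norm_le ((integrableOn_one_div_add_pow hX0
    (show 2 ≤ 3 by norm_num)).const_mul (1 / κ ^ 3)) ?_).trans (le_of_eq ?_)
  · refine (ae_restrict_iff' measurableSet_Ioi).2 (Eventually.of_forall fun s hs => ?_)
    exact norm_osc_div_le hκ hX0 h σ 3 (le_of_lt hs)
  · rw [integral_const_mul, integral_one_div_add_pow_three hX0]
    field_simp

/-- An absolute estimate of the integrand gives only ‖X‖⁻¹. Trading the square for the cube by
integration by parts gains one power, and this quadratic decay makes the later double series over
frequencies and poles converge absolutely. -/
lemma norm_oscInt_le {X : ℂ} (hX : X ∈ Complex.slitPlane) {κ : ℝ} (hκ : 0 < κ)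
    (h : ∀ s : ℝ, 0 ≤ s → κ * (s + ‖X‖) ≤ ‖(s : ℂ) + X‖) {σ : ℝ} (hσ : σ ^ 2 = 1) :
    ‖oscInt σ X‖ ≤ (1 / (2 * Real.pi)) * (1 + 1 / κ ^ 3) / ‖X‖ ^ 2 := by
  have hX0 : 0 < ‖X‖ := norm_pos_iff.2 (Complex.slitPlane_ne_zero hX)
  have h1 := integral_osc_div_cube hX σ
  have h2 := norm_integral_osc_div_cube_le hκ hX0 h σ
  set K := ∫ s in Ioi (0 : ℝ), osc σ s / ((s : ℂ) + X) ^ 3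
  have h3 : ‖2 * Real.pi * Complex.I * σ * oscInt σ X‖ ≤ 2 * ‖K‖ + 1 / ‖X‖ ^ 2 := by
    have : 2 * Real.pi * Complex.I * σ * oscInt σ X = 2 * K - 1 / X ^ 2 := by
      rw [h1]; ring
    rw [this]
    refine (norm_sub_le _ _).trans ?_
    simp
  have hs : |σ| = 1 := by
    rw [← sq_abs] at hσ
    exact (pow_eq_one_iff_of_nonneg (abs_nonneg _) two_ne_zero).1 hσ
  have h4 : ‖2 * Real.pi * Complex.I * σ * oscInt σ X‖ = 2 * Real.pi * ‖oscInt σ X‖ := by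
    simp [hs, abs_of_pos Real.pi_pos]
  rw [h4] at h3
  have h5 : 2 * Real.pi * ‖oscInt σ X‖ ≤ (1 + 1 / κ ^ 3) / ‖X‖ ^ 2 := by
    refine h3.trans ((add_le_add_left (mul_le_mul_of_nonneg_left h2 zero_le_two) _).trans
      (le_of_eq ?_))
    field_simp
    ring
  have hp := Real.pi_pos
  rw [mul_div_assoc, one_div_mul_eq_div, le_div_iff₀ (by positivity)]
  linarith

lemma hasDerivAt_oscInt {X : ℂ} (hX : X ∈ Complex.slitPlane) (σ : ℝ) :
    HasDerivAt (oscInt σ) (-(1 / X ^ 2 + 2 * Real.pi * Complex.I * σ * oscInt σ X)) X := by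
  obtain ⟨κ, hκ, -, h⟩ := exists_le_norm_add hX
  have h0 : 0 < ‖X‖ := norm_pos_iff.2 (Complex.slitPlane_ne_zero hX)
  -- Moving X by less than κ‖X‖/2 keeps the lower bound for ‖s + X‖ with κ/2 in place of κ, which
  -- gives one majorant for the whole neighbourhood.
  have hnb : Complex.slitPlane ∩ Metric.ball X (κ * ‖X‖ / 2) ∈ 𝓝 X :=
    inter_mem (Complex.isOpen_slitPlane.mem_nhds hX) (Metric.ball_mem_nhds _ (by positivity))
  have key := hasDerivAt_integral_of_dominated_loc_of_deriv_le (μ := volume.restrict (Ioi (0 : ℝ)))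
    (F := fun (Y : ℂ) (s : ℝ) => osc σ s / ((s : ℂ) + Y) ^ 2)
    (F' := fun (Y : ℂ) (s : ℝ) => -2 * (osc σ s / ((s : ℂ) + Y) ^ 3))
    (bound := fun s => 2 * (1 / (κ / 2) ^ 3 * (1 / (s + ‖X‖) ^ 3))) hnb ?_
    (integrableOn_osc_div hX σ le_rfl) ?_ ?_ ?_ ?_
  · have h2 := key.2
    rw [integral_const_mul] at h2
    rw [← integral_osc_div_cube hX]
    exact h2.congr_deriv (by ring)
  · filter_upwards [hnb] with Y hY
    exact ((continuousOn_osc_div hY.1 σ 2).mono Ioi_subset_Ici_self).aestronglyMeasurable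
      measurableSet_Ioi
  · exact ((((continuousOn_osc_div hX σ 3).mono Ioi_subset_Ici_self).aestronglyMeasurable
      measurableSet_Ioi).const_mul _)
  · refine (ae_restrict_iff' measurableSet_Ioi).2 (Eventually.of_forall fun s hs Y hY => ?_)
    have hs' : 0 ≤ s := le_of_lt hs
    have hY2 : ‖Y - X‖ < κ * ‖X‖ / 2 := by simpa [dist_eq_norm] using hY.2
    have h3 : κ / 2 * (s + ‖X‖) ≤ ‖(s : ℂ) + Y‖ := by
      have e : ‖(s : ℂ) + X‖ ≤ ‖(s : ℂ) + Y‖ + ‖Y - X‖ := by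
        have := norm_sub_le ((s : ℂ) + Y) (Y - X)
        simpa [show (s : ℂ) + Y - (Y - X) = s + X by ring] using this
      have := h s hs'
      nlinarith [mul_nonneg hκ.le hs']
    rw [norm_mul, norm_div, norm_osc, norm_pow, norm_neg, Complex.norm_ofNat]
    refine mul_le_mul_of_nonneg_left ?_ zero_le_two
    rw [one_div_mul_one_div, ← mul_pow]
    gcongr
  · exact (((integrableOn_one_div_add_pow h0 (by norm_num)).const_mul _).const_mul _)
  · refine (ae_restrict_iff' measurableSet_Ioi).2 (Eventually.of_forall fun s hs Y hY => ?_)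
    have hne := slit_add_ne_zero hY.1 (le_of_lt hs)
    have h1 : HasDerivAt (fun Y : ℂ => ((s : ℂ) + Y) ^ 2) ((2 : ℕ) * ((s : ℂ) + Y) ^ 1 * 1) Y :=
      ((hasDerivAt_id Y).const_add (s : ℂ)).pow 2
    refine ((hasDerivAt_const Y (osc σ s)).div h1 (pow_ne_zero _ hne)).congr_deriv ?_
    push_cast
    field_simp
    ring

/-! ### Laplace integrals with denominators `1 + u` and `u² - 1` -/

lemma norm_exp_sub_exp_le {a b : ℂ} (ha : a.re ≤ 0) (hb : b.re ≤ 0) :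
    ‖Complex.exp a - Complex.exp b‖ ≤ ‖a - b‖ := by
  have h := Convex.norm_image_sub_le_of_norm_deriv_le (𝕜 := ℂ) (f := Complex.exp) (C := 1)
    (s := {z : ℂ | z.re ≤ 0}) (x := b) (y := a) (fun x _ => Complex.differentiableAt_exp)
    (fun x hx => ?_) (convex_halfSpace_re_le 0) hb ha
  · simpa using h
  · rw [Complex.deriv_exp, Complex.norm_exp]
    exact Real.exp_le_one_iff.2 hx

lemma integrableOn_exp_neg_mul {w : ℂ} (hw : 0 < w.re) :
    IntegrableOn (fun u : ℝ => Complex.exp (-w * u)) (Ioi 0) :=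
  integrableOn_exp_mul_complex_Ioi (by simpa using hw) 0

lemma integral_exp_neg_mul {w : ℂ} (hw : 0 < w.re) :
    ∫ u in Ioi (0 : ℝ), Complex.exp (-w * u) = 1 / w := by
  rw [integral_exp_mul_complex_Ioi (by simpa using hw)]
  simp

lemma norm_exp_neg_mul (w : ℂ) (u : ℝ) : ‖Complex.exp (-w * u)‖ = Real.exp (-(w.re * u)) := by
  rw [Complex.norm_exp]; simp

/-- The Laplace transform `∫_0^∞ e^{-wu} (1 + u)⁻¹ du`. -/
def expInt (w : ℂ) : ℂ := ∫ u in Ioi (0 : ℝ), Complex.exp (-w * u) / (1 + u)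

lemma continuousOn_exp_div_one_add (w : ℂ) :
    ContinuousOn (fun u : ℝ => Complex.exp (-w * u) / (1 + u)) (Ioi 0) := by
  refine ContinuousOn.div (by fun_prop) (by fun_prop) fun u hu => ?_
  have : (0 : ℝ) < u := hu
  exact_mod_cast (by positivity : (1 + u) ≠ 0)

lemma norm_exp_div_one_add_le (w : ℂ) {u : ℝ} (hu : 0 < u) :
    ‖Complex.exp (-w * u) / (1 + u)‖ ≤ ‖Complex.exp (-w * u)‖ := by
  rw [norm_div]
  refine div_le_self (norm_nonneg _) ?_
  rw [show (1 : ℂ) + u = ((1 + u : ℝ) : ℂ) by push_cast; ring, Complex.norm_of_nonneg (by positivity)]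
  linarith

lemma integrableOn_exp_div_one_add {w : ℂ} (hw : 0 < w.re) :
    IntegrableOn (fun u : ℝ => Complex.exp (-w * u) / (1 + u)) (Ioi 0) := by
  refine Integrable.mono (integrableOn_exp_neg_mul hw)
    ((continuousOn_exp_div_one_add w).aestronglyMeasurable measurableSet_Ioi) ?_
  exact (ae_restrict_iff' measurableSet_Ioi).2
    (Eventually.of_forall fun u hu => norm_exp_div_one_add_le w hu)

lemma norm_expInt_le {w : ℝ} (hw : 0 < w) : ‖expInt w‖ ≤ 1 / w := by
  have hw' : 0 < (w : ℂ).re := by simpa using hw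
  refine (norm_integral_le_of_norm_le (integrableOn_exp_neg_mul hw').norm
    ((ae_restrict_iff' measurableSet_Ioi).2
    (Eventually.of_forall fun u hu => norm_exp_div_one_add_le w hu))).trans (le_of_eq ?_)
  have := integral_exp_mul_Ioi (a := -w) (by linarith) 0
  simp only [norm_exp_neg_mul, Complex.ofReal_re]
  rw [show (fun u : ℝ => Real.exp (-(w * u))) = fun u => Real.exp (-w * u) by ext; ring_nf, this]
  simp

/-- Since -u/(1 + u) = 1/(1 + u) - 1, differentiation under the integral closes up to a first-order
equation. -/
lemma hasDerivAt_expInt {w : ℂ} (hw : 0 < w.re) :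
    HasDerivAt expInt (expInt w - 1 / w) w := by
  have hnb : {v : ℂ | w.re / 2 < v.re} ∈ 𝓝 w :=
    (isOpen_lt continuous_const Complex.continuous_re).mem_nhds (by simp; linarith)
  have hw2 : 0 < ((w.re / 2 : ℝ) : ℂ).re := by simp; linarith
  have hF' : ∀ v : ℂ, ∀ u ∈ Ioi (0 : ℝ), (-u : ℂ) * (Complex.exp (-v * u) / (1 + u))
      = Complex.exp (-v * u) / (1 + u) - Complex.exp (-v * u) := by
    intro v u hu
    have : (0 : ℝ) < u := hu
    have : (1 + u : ℂ) ≠ 0 := by exact_mod_cast (by positivity : (1 + u) ≠ 0)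
    field_simp
    ring
  have key := hasDerivAt_integral_of_dominated_loc_of_deriv_le (μ := volume.restrict (Ioi (0 : ℝ)))
    (F := fun (v : ℂ) (u : ℝ) => Complex.exp (-v * u) / (1 + u))
    (F' := fun (v : ℂ) (u : ℝ) => (-u : ℂ) * (Complex.exp (-v * u) / (1 + u)))
    (bound := fun u => ‖Complex.exp (-((w.re / 2 : ℝ) : ℂ) * u)‖) hnb
    (Eventually.of_forall fun v =>
      (continuousOn_exp_div_one_add v).aestronglyMeasurable measurableSet_Ioi)
    (integrableOn_exp_div_one_add hw) ?_ ?_ (integrableOn_exp_neg_mul hw2).norm ?_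
  · refine key.2.congr_deriv ?_
    rw [setIntegral_congr_fun measurableSet_Ioi (hF' w),
      integral_sub (integrableOn_exp_div_one_add hw) (integrableOn_exp_neg_mul hw),
      integral_exp_neg_mul hw]
    rfl
  · exact (Continuous.aestronglyMeasurable (by fun_prop)).mul
      ((continuousOn_exp_div_one_add w).aestronglyMeasurable measurableSet_Ioi)
  · refine (ae_restrict_iff' measurableSet_Ioi).2 (Eventually.of_forall fun u hu v hv => ?_)
    have hu' : (0 : ℝ) < u := hu
    have hv' : w.re / 2 < v.re := hv
    rw [norm_mul, norm_div, norm_exp_neg_mul, norm_exp_neg_mul, norm_neg,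
      show (1 : ℂ) + u = ((1 + u : ℝ) : ℂ) by push_cast; ring,
      Complex.norm_of_nonneg (by positivity), Complex.norm_of_nonneg (by positivity),
      Complex.ofReal_re, ← mul_div_assoc, div_le_iff₀ (by positivity), mul_comm]
    have : Real.exp (-(v.re * u)) ≤ Real.exp (-(w.re / 2 * u)) := by
      apply Real.exp_le_exp.2; nlinarith
    gcongr
    linarith
  · refine Eventually.of_forall fun u v _ => ?_
    have h1 : HasDerivAt (fun v : ℂ => -v * (u : ℂ)) (-1 * (u : ℂ)) v :=
      (hasDerivAt_neg v).mul_const _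
    refine (h1.cexp.div_const _).congr_deriv ?_
    ring

/-- The regularized principal value `∫_0^∞ 2 (e^{-wu} - e^{-w}) (u² - 1)⁻¹ du`. -/
def pvCore (w : ℂ) : ℂ :=
  ∫ u in Ioi (0 : ℝ), 2 * (Complex.exp (-w * u) - Complex.exp (-w)) / ((u : ℂ) ^ 2 - 1)

lemma norm_sq_sub_one {u : ℝ} (hu : 0 < u) :
    ‖(u : ℂ) ^ 2 - 1‖ = |u - 1| * (u + 1) := by
  rw [show (u : ℂ) ^ 2 - 1 = (((u - 1) * (u + 1) : ℝ) : ℂ) by push_cast; ring, Complex.norm_real,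
    Real.norm_eq_abs, abs_mul, abs_of_pos (by linarith : 0 < u + 1)]

/-- Common majorant for integrands over u² - 1. Up to u = 2 the Lipschitz bound cancels the zero at
u = 1, and 1 + u² ≤ 5; beyond it boundedness of the numerator suffices, as 1 + u² ≤ 2(u² - 1). -/
lemma div_sq_sub_one_le {u C D : ℝ} {x : ℂ} (hu : 0 < u) (hu1 : u ≠ 1) (hC : 0 ≤ C)
    (hD : 0 ≤ D) (h1 : ‖x‖ ≤ C * |u - 1|) (h2 : 2 < u → ‖x‖ ≤ D) :
    ‖x / ((u : ℂ) ^ 2 - 1)‖ ≤ (5 * C + 2 * D) * (1 + u ^ 2)⁻¹ := by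
  have hp : 0 < |u - 1| := abs_pos.2 (sub_ne_zero.2 hu1)
  rw [norm_div, norm_sq_sub_one hu, div_le_iff₀ (by positivity), mul_assoc,
    ← div_eq_inv_mul]
  by_cases h : 2 < u
  · have h3 : 1 ≤ 2 * (|u - 1| * (u + 1) / (1 + u ^ 2)) := by
      rw [abs_of_pos (by linarith), ← mul_div_assoc, le_div_iff₀ (by positivity)]
      nlinarith
    have h4 := h2 h
    have h5 : D * 1 ≤ D * (2 * (|u - 1| * (u + 1) / (1 + u ^ 2))) :=
      mul_le_mul_of_nonneg_left h3 hD
    have h6 : 0 ≤ C * (|u - 1| * (u + 1) / (1 + u ^ 2)) := by positivity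
    linarith
  · have h3 : |u - 1| ≤ 5 * (|u - 1| * (u + 1) / (1 + u ^ 2)) := by
      rw [← mul_div_assoc, le_div_iff₀ (by positivity)]
      have : u ^ 2 ≤ 4 := by nlinarith
      nlinarith
    have h5 : C * |u - 1| ≤ C * (5 * (|u - 1| * (u + 1) / (1 + u ^ 2))) :=
      mul_le_mul_of_nonneg_left h3 hC
    have h6 : 0 ≤ D * (|u - 1| * (u + 1) / (1 + u ^ 2)) := by positivity
    linarith

lemma norm_exp_neg_mul_sub_le {w : ℂ} (hw : 0 ≤ w.re) {u : ℝ} (hu : 0 < u) :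
    ‖Complex.exp (-w * u) - Complex.exp (-w)‖ ≤ ‖w‖ * |u - 1| := by
  refine (norm_exp_sub_exp_le ?_ ?_).trans (le_of_eq ?_)
  · simp; positivity
  · simpa using hw
  · rw [show -w * (u : ℂ) - -w = -w * ((u - 1 : ℝ) : ℂ) by push_cast; ring, norm_mul, norm_neg,
      Complex.norm_real, Real.norm_eq_abs]

lemma norm_exp_neg_mul_le_one {w : ℂ} (hw : 0 ≤ w.re) {u : ℝ} (hu : 0 ≤ u) :
    ‖Complex.exp (-w * u)‖ ≤ 1 := by
  rw [norm_exp_neg_mul]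
  exact Real.exp_le_one_iff.2 (by simp; positivity)

lemma norm_pvCore_integrand_le {w : ℂ} (hw : 0 ≤ w.re) {u : ℝ} (hu : 0 < u) (hu1 : u ≠ 1) :
    ‖2 * (Complex.exp (-w * u) - Complex.exp (-w)) / ((u : ℂ) ^ 2 - 1)‖
      ≤ (5 * (2 * ‖w‖) + 2 * 4) * (1 + u ^ 2)⁻¹ := by
  refine div_sq_sub_one_le hu hu1 (by positivity) (by positivity) ?_ fun _ => ?_
  · rw [norm_mul, Complex.norm_ofNat, mul_assoc]
    exact mul_le_mul_of_nonneg_left (norm_exp_neg_mul_sub_le hw hu) zero_le_two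
  · rw [norm_mul, Complex.norm_ofNat]
    have h1 := norm_exp_neg_mul_le_one hw hu.le
    have h2 := norm_exp_neg_mul_le_one hw zero_le_one
    have h3 := norm_sub_le (Complex.exp (-w * u)) (Complex.exp (-w))
    simp only [Complex.ofReal_one, mul_one] at h2
    linarith

lemma ae_pos_ne (a : ℝ) : ∀ᵐ u ∂(volume.restrict (Ioi (0 : ℝ))), 0 < u ∧ u ≠ a := by
  refine ((ae_restrict_iff' measurableSet_Ioi).2 (Eventually.of_forall fun u hu => hu)).and ?_
  refine ae_restrict_of_ae ?_
  exact (measure_eq_zero_iff_ae_notMem.1 (measure_singleton a)).mono fun u hu => by simpa using hu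

lemma measurable_pvCore_integrand (w : ℂ) : Measurable fun u : ℝ =>
    2 * (Complex.exp (-w * u) - Complex.exp (-w)) / ((u : ℂ) ^ 2 - 1) := by
  fun_prop

lemma integrableOn_pvCore {w : ℂ} (hw : 0 ≤ w.re) :
    IntegrableOn (fun u : ℝ =>
      2 * (Complex.exp (-w * u) - Complex.exp (-w)) / ((u : ℂ) ^ 2 - 1)) (Ioi 0) := by
  refine Integrable.mono' (integrable_inv_one_add_sq.integrableOn.const_mul
    (5 * (2 * ‖w‖) + 2 * 4)) (measurable_pvCore_integrand w).aestronglyMeasurable ?_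
  filter_upwards [ae_pos_ne 1] with u hu
  exact norm_pvCore_integrand_le hw hu.1 hu.2

lemma mul_exp_neg_le {δ u : ℝ} (hδ : 0 < δ) : u * Real.exp (-(δ * u)) ≤ 1 / δ := by
  have h := Real.add_one_le_exp (δ * u)
  rw [Real.exp_neg, ← div_eq_mul_inv, div_le_div_iff₀ (Real.exp_pos _) hδ]
  linarith

/-- Writing u = 1 + (u - 1) in the differentiated numerator reproduces the integrand of `pvCore` and
cancels the factor u - 1 in the rest, leaving e^{-wu}/(1 + u). -/
lemma hasDerivAt_pvCore {w : ℂ} (hw : 0 < w.re) :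
    HasDerivAt pvCore (-pvCore w - 2 * expInt w) w := by
  have hnb : {v : ℂ | w.re / 2 < v.re} ∩ Metric.ball w 1 ∈ 𝓝 w :=
    inter_mem ((isOpen_lt continuous_const Complex.continuous_re).mem_nhds (by simp; linarith))
      (Metric.ball_mem_nhds _ one_pos)
  have key := hasDerivAt_integral_of_dominated_loc_of_deriv_le (μ := volume.restrict (Ioi (0 : ℝ)))
    (F := fun (v : ℂ) (u : ℝ) =>
      2 * (Complex.exp (-v * u) - Complex.exp (-v)) / ((u : ℂ) ^ 2 - 1))
    (F' := fun (v : ℂ) (u : ℝ) =>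
      2 * (-u * Complex.exp (-v * u) + Complex.exp (-v)) / ((u : ℂ) ^ 2 - 1))
    (bound := fun u => (5 * (2 * (1 + (‖w‖ + 1))) + 2 * (2 * (1 / (w.re / 2) + 1))) * (1 + u ^ 2)⁻¹)
    hnb (Eventually.of_forall fun v => (measurable_pvCore_integrand v).aestronglyMeasurable)
    (integrableOn_pvCore hw.le) (Measurable.aestronglyMeasurable (by fun_prop)) ?_
    (integrable_inv_one_add_sq.integrableOn.const_mul _) ?_
  · refine key.2.congr_deriv ?_
    rw [pvCore, expInt, ← integral_neg, ← integral_const_mul]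
    refine Eq.trans (integral_congr_ae ?_) (integral_sub
      (integrableOn_pvCore hw.le).neg ((integrableOn_exp_div_one_add hw).const_mul 2))
    filter_upwards [ae_pos_ne 1] with u hu
    have h1 : (u : ℂ) - 1 ≠ 0 := by
      rw [sub_ne_zero]; exact_mod_cast hu.2
    have h2 : (1 + u : ℂ) ≠ 0 := by exact_mod_cast (by linarith [hu.1] : (1 + u) ≠ 0)
    have h3 : (u : ℂ) ^ 2 - 1 ≠ 0 := by
      rw [show (u : ℂ) ^ 2 - 1 = (u - 1) * (1 + u) by ring]; exact mul_ne_zero h1 h2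
    field_simp
    ring
  · filter_upwards [ae_pos_ne 1] with u hu v hv
    have hv1 : w.re / 2 < v.re := hv.1
    have hv0 : 0 ≤ v.re := by linarith
    have hv2 : ‖v‖ ≤ ‖w‖ + 1 := by
      have : ‖v - w‖ < 1 := by simpa [dist_eq_norm] using hv.2
      have := norm_le_norm_add_norm_sub' v w
      linarith
    refine div_sq_sub_one_le hu.1 hu.2 (by positivity) (by positivity) ?_ fun _ => ?_
    · rw [norm_mul, Complex.norm_ofNat, mul_assoc]
      refine mul_le_mul_of_nonneg_left ?_ zero_le_two
      rw [show -(u : ℂ) * Complex.exp (-v * u) + Complex.exp (-v) =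
        -(((u - 1 : ℝ) : ℂ) * Complex.exp (-v * u)
          + (Complex.exp (-v * u) - Complex.exp (-v))) by push_cast; ring, norm_neg]
      refine (norm_add_le _ _).trans ?_
      have h1 := norm_exp_neg_mul_sub_le hv0 hu.1
      have h2 := norm_exp_neg_mul_le_one hv0 hu.1.le
      rw [norm_mul, Complex.norm_real, Real.norm_eq_abs]
      have h3 : |u - 1| * ‖Complex.exp (-v * u)‖ ≤ |u - 1| * 1 :=
        mul_le_mul_of_nonneg_left h2 (abs_nonneg _)
      have h4 : ‖v‖ * |u - 1| ≤ (‖w‖ + 1) * |u - 1| :=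
        mul_le_mul_of_nonneg_right hv2 (abs_nonneg _)
      linarith
    · rw [norm_mul, Complex.norm_ofNat]
      refine mul_le_mul_of_nonneg_left ?_ zero_le_two
      refine (norm_add_le _ _).trans ?_
      have h2 := norm_exp_neg_mul_le_one hv0 zero_le_one
      simp only [Complex.ofReal_one, mul_one] at h2
      refine add_le_add ?_ h2
      rw [norm_mul, norm_neg, Complex.norm_of_nonneg hu.1.le, norm_exp_neg_mul]
      refine le_trans (mul_le_mul_of_nonneg_left ?_ hu.1.le)
        (mul_exp_neg_le (δ := w.re / 2) (u := u) (by positivity))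
      apply Real.exp_le_exp.2
      nlinarith [hu.1]
  · refine Eventually.of_forall fun u v _ => ?_
    have h1 : HasDerivAt (fun v : ℂ => -v * (u : ℂ)) (-1 * (u : ℂ)) v :=
      (hasDerivAt_neg v).mul_const _
    refine (((h1.cexp.sub (hasDerivAt_neg v).cexp).const_mul 2).div_const _).congr_deriv ?_
    ring

/-- The boundary value at the origin that fixes the constant of integration in `oscSide_pos`. -/
lemma tendsto_pvCore_zero : Tendsto (fun w : ℝ => pvCore w) (𝓝[>] 0) (𝓝 0) := by
  have h := tendsto_integral_filter_of_dominated_convergence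
    (μ := volume.restrict (Ioi (0 : ℝ))) (l := 𝓝[>] (0 : ℝ))
    (F := fun (w : ℝ) (u : ℝ) =>
      2 * (Complex.exp (-(w : ℂ) * u) - Complex.exp (-(w : ℂ))) / ((u : ℂ) ^ 2 - 1))
    (f := fun _ => 0) (fun u => (5 * (2 * 1) + 2 * 4) * (1 + u ^ 2)⁻¹)
    (Eventually.of_forall fun v => (measurable_pvCore_integrand v).aestronglyMeasurable) ?_
    (integrable_inv_one_add_sq.integrableOn.const_mul _) ?_
  · simpa [pvCore] using h
  · filter_upwards [Ioc_mem_nhdsGT (show (0 : ℝ) < 1 from one_pos)] with w hw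
    filter_upwards [ae_pos_ne 1] with u hu
    refine (norm_pvCore_integrand_le (by simpa using hw.1.le) hu.1 hu.2).trans ?_
    rw [Complex.norm_of_nonneg hw.1.le]
    have := hw.2
    gcongr
  · refine Eventually.of_forall fun u => ?_
    have : Continuous fun w : ℝ =>
        2 * (Complex.exp (-(w : ℂ) * u) - Complex.exp (-(w : ℂ))) / ((u : ℂ) ^ 2 - 1) := by
      fun_prop
    have h := (this.tendsto 0).mono_left (nhdsWithin_le_nhds (s := Ioi 0))
    simpa using h

/-! ### Evaluation of the oscillatory integrals -/

/-- The function `±(2πi)⁻¹ ∫_0^∞ e^{±2πis} (s ∓ iw)⁻² ds`, with sign `σ = ±1`. -/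
def oscSide (σ : ℝ) (w : ℂ) : ℂ := σ / (2 * Real.pi * Complex.I) * oscInt σ (-Complex.I * σ * w)

lemma neg_I_mul_mem_slitPlane {σ : ℝ} (hσ : σ ≠ 0) {w : ℂ} (hw : w.re ≠ 0) :
    -Complex.I * σ * w ∈ Complex.slitPlane := by
  refine Or.inr ?_
  simpa using ⟨hσ, hw⟩

/-- Because σ² = 1, the square (-iσw)² is -w² for both signs, so both choices of σ obey one and the
same equation, on either half plane. -/
lemma hasDerivAt_oscSide {σ : ℝ} (hσ : σ ^ 2 = 1) {w : ℂ} (hw : w.re ≠ 0) :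
    HasDerivAt (oscSide σ) (-1 / (2 * Real.pi * w ^ 2) - 2 * Real.pi * oscSide σ w) w := by
  have hσ0 : σ ≠ 0 := by rintro rfl; norm_num at hσ
  have hw0 : w ≠ 0 := by rintro rfl; simp at hw
  have hσc : (σ : ℂ) ^ 2 = 1 := by exact_mod_cast hσ
  have h1 : HasDerivAt (fun w : ℂ => -Complex.I * σ * w) (-Complex.I * σ * 1) w :=
    (hasDerivAt_id w).const_mul _
  have h2 := ((hasDerivAt_oscInt (neg_I_mul_mem_slitPlane hσ0 hw) σ).comp w h1).const_mul
    (σ / (2 * Real.pi * Complex.I))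
  refine h2.congr_deriv ?_
  have hpi : (Real.pi : ℂ) ≠ 0 := by exact_mod_cast Real.pi_ne_zero
  have hσ0' : (σ : ℂ) ≠ 0 := by exact_mod_cast hσ0
  rw [oscSide]
  set J := oscInt σ (-Complex.I * σ * w)
  have hsq : (-Complex.I * σ * w) ^ 2 = -w ^ 2 := by
    rw [mul_pow, mul_pow, hσc, neg_sq, Complex.I_sq]; ring
  rw [hsq]
  have hI := Complex.I_sq
  field_simp
  linear_combination (-Complex.I + 2 * σ * Real.pi * w ^ 2 * J * Complex.I ^ 2) * hσc
    + 2 * σ * Real.pi * w ^ 2 * J * hI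

/-- The integrating factor e^{-cw} makes the derivative vanish, and a half plane is connected.
Applied to differences of two solutions of an inhomogeneous equation. -/
lemma exists_const_of_hasDerivAt_halfPlane {D : ℂ → ℂ} {c : ℂ}
    (hD : ∀ w : ℂ, 0 < w.re → HasDerivAt D (c * D w) w) :
    ∃ C : ℂ, ∀ w : ℂ, 0 < w.re → D w = C * Complex.exp (c * w) := by
  have ho : IsOpen {w : ℂ | 0 < w.re} := isOpen_lt continuous_const Complex.continuous_re
  have hd : ∀ w ∈ {w : ℂ | 0 < w.re}, HasDerivAt (fun w => D w * Complex.exp (-c * w)) 0 w := by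
    intro w hw
    have h1 : HasDerivAt (fun w : ℂ => -c * w) (-c * 1) w := (hasDerivAt_id w).const_mul _
    refine ((hD w hw).mul h1.cexp).congr_deriv ?_
    ring
  obtain ⟨C, hC⟩ := ho.exists_is_const_of_deriv_eq_zero (convex_halfSpace_re_gt 0).isPreconnected
    (fun w hw => (hd w hw).differentiableAt.differentiableWithinAt)
    (fun w hw => (hd w hw).deriv)
  refine ⟨C, fun w hw => ?_⟩
  rw [← hC w hw, mul_assoc, ← Complex.exp_add]
  simp

/-- At this point |s + X|² = s² + x² ≥ 1 + s², whence a bound independent of x. -/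
lemma norm_oscInt_I_mul_le {σ : ℝ} (hσ : σ ^ 2 = 1) {x : ℝ} (hx : 1 ≤ x) :
    ‖oscInt σ (-Complex.I * σ * (-x))‖ ≤ ∫ s : ℝ in Ioi 0, (1 + s ^ 2)⁻¹ := by
  have hσc : (σ : ℂ) ^ 2 = 1 := by exact_mod_cast hσ
  refine norm_integral_le_of_norm_le integrable_inv_one_add_sq.integrableOn
    (Eventually.of_forall fun s => ?_)
  rw [norm_div, norm_osc, norm_pow, Complex.sq_norm, Complex.normSq_apply, one_div]
  refine inv_anti₀ (by positivity) ?_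
  have h1 : σ * x * (σ * x) = x ^ 2 := by linear_combination x ^ 2 * hσ
  simp [h1]
  nlinarith

/-- Both sides solve the same equation, so they differ by C e^{2πw}. Both stay bounded as w tends to
infinity along the reals, which forces C = 0. -/
lemma oscSide_neg {σ : ℝ} (hσ : σ ^ 2 = 1) {w : ℂ} (hw : 0 < w.re) :
    oscSide σ (-w) = expInt (2 * Real.pi * w) - 1 / (2 * Real.pi * w) := by
  have hpi : (Real.pi : ℂ) ≠ 0 := by exact_mod_cast Real.pi_ne_zero
  have hre : ∀ {w : ℂ}, 0 < w.re → 0 < (2 * Real.pi * w).re := by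
    intro w hw
    rw [show (2 * Real.pi * w : ℂ) = ((2 * Real.pi : ℝ) : ℂ) * w by push_cast; ring,
      Complex.re_ofReal_mul]
    have := Real.pi_pos
    positivity
  obtain ⟨C, hC⟩ := exists_const_of_hasDerivAt_halfPlane (c := 2 * Real.pi)
    (D := fun w => oscSide σ (-w) - (expInt (2 * Real.pi * w) - 1 / (2 * Real.pi * w))) (by
    intro w hw
    have hw0 : w ≠ 0 := by rintro rfl; simp at hw
    have h1 := (hasDerivAt_oscSide hσ (w := -w) (by simpa using hw.ne')).comp w (hasDerivAt_neg w)
    have h0 : HasDerivAt (fun w : ℂ => 2 * Real.pi * w) (2 * Real.pi * 1) w :=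
      (hasDerivAt_id w).const_mul _
    have h2 := (hasDerivAt_expInt (hre hw)).comp w h0
    have h3 := (hasDerivAt_const w (1 : ℂ)).div h0 (by simp [hw0, Real.pi_ne_zero])
    refine (h1.sub (h2.sub h3)).congr_deriv ?_
    field_simp
    ring)
  suffices hC0 : C = 0 by
    have := hC w hw
    rw [hC0, zero_mul] at this
    exact sub_eq_zero.1 this
  set K := ∫ s : ℝ in Ioi 0, (1 + s ^ 2)⁻¹
  have hs : |σ| = 1 := by
    rw [← sq_abs] at hσ
    exact (pow_eq_one_iff_of_nonneg (abs_nonneg _) two_ne_zero).1 hσ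
  have hb : ∀ x : ℝ, 1 ≤ x → ‖C‖ ≤ (1 / (2 * Real.pi) * K + 2) * Real.exp (-(2 * Real.pi * x)) := by
    intro x hx
    have hx0 : (0 : ℝ) < x := by linarith
    have h1 := congrArg norm (hC x (by simpa using hx0))
    have hp := Real.pi_pos
    have hp3 := Real.pi_gt_three
    have h2px : 1 ≤ 2 * Real.pi * x := by nlinarith
    have h2 : ‖oscSide σ (-x)‖ ≤ 1 / (2 * Real.pi) * K := by
      rw [oscSide, norm_mul]
      have : ‖(σ : ℂ) / (2 * Real.pi * Complex.I)‖ = 1 / (2 * Real.pi) := by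
        simp [hs, abs_of_pos hp]
      rw [this]
      have := norm_oscInt_I_mul_le hσ hx
      gcongr
    have e : (2 * Real.pi * (x : ℂ)) = ((2 * Real.pi * x : ℝ) : ℂ) := by push_cast; ring
    have h3 : ‖expInt (2 * Real.pi * x)‖ ≤ 1 := by
      rw [e]
      refine (norm_expInt_le (by positivity)).trans ?_
      rw [div_le_one (by positivity)]; exact h2px
    have h4 : ‖1 / (2 * Real.pi * (x : ℂ))‖ ≤ 1 := by
      rw [e, norm_div, norm_one, Complex.norm_of_nonneg (by positivity),
        div_le_one (by positivity)]
      exact h2px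
    rw [norm_mul, e, Complex.norm_exp_ofReal, ← e] at h1
    have h5 : ‖C‖ * Real.exp (2 * Real.pi * x) ≤ 1 / (2 * Real.pi) * K + 2 := by
      rw [← h1]
      refine (norm_sub_le _ _).trans ?_
      have := norm_sub_le (expInt (2 * Real.pi * x)) (1 / (2 * Real.pi * (x : ℂ)))
      linarith
    rw [Real.exp_neg, ← div_eq_mul_inv, le_div_iff₀ (Real.exp_pos _)]
    exact h5
  have hlim : Tendsto (fun x : ℝ => (1 / (2 * Real.pi) * K + 2) * Real.exp (-(2 * Real.pi * x)))
      atTop (𝓝 ((1 / (2 * Real.pi) * K + 2) * 0)) := by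
    refine Tendsto.const_mul _ (Real.tendsto_exp_neg_atTop_nhds_zero.comp ?_)
    exact tendsto_id.const_mul_atTop (by positivity)
  rw [mul_zero] at hlim
  have := ge_of_tendsto hlim ((eventually_ge_atTop 1).mono hb)
  simpa using this

lemma integral_div_one_add_sq_sq : ∫ s in Ioi (0 : ℝ), s / (1 + s ^ 2) ^ 2 = 1 / 2 := by
  have hd : ∀ x ∈ Ici (0 : ℝ), HasDerivAt (fun s : ℝ => -(1 / 2) * (1 / (1 + s ^ 2)))
      (x / (1 + x ^ 2) ^ 2) x := by
    intro x _
    have h1 : HasDerivAt (fun s : ℝ => 1 + s ^ 2) ((2 : ℕ) * x ^ 1 * 1) x :=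
      ((hasDerivAt_id x).pow 2).const_add 1
    refine (((hasDerivAt_const x (1 : ℝ)).div h1 (by positivity)).const_mul (-(1 / 2))).congr_deriv ?_
    push_cast
    field_simp
    ring
  have hl : Tendsto (fun s : ℝ => -(1 / 2) * (1 / (1 + s ^ 2))) atTop (𝓝 (-(1 / 2) * 0)) := by
    refine Tendsto.const_mul _ (tendsto_const_nhds.div_atTop ?_)
    exact tendsto_atTop_add_const_left _ _ (tendsto_pow_atTop (by norm_num))
  rw [integral_Ioi_of_hasDerivAt_of_nonneg (hd 0 self_mem_Ici).continuousAt.continuousWithinAt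
    (fun x hx => hd x (Ioi_subset_Ici_self hx)) (fun x hx => ?_) hl]
  · norm_num
  · have : (0 : ℝ) < x := hx
    positivity

lemma integral_sq_div_one_add_sq_sq :
    ∫ s in Ioi (0 : ℝ), s ^ 2 / (1 + s ^ 2) ^ 2 = Real.pi / 4 := by
  have hd : ∀ x ∈ Ici (0 : ℝ), HasDerivAt (fun s : ℝ => 1 / 2 * (Real.arctan s - s / (1 + s ^ 2)))
      (x ^ 2 / (1 + x ^ 2) ^ 2) x := by
    intro x _
    have h1 : HasDerivAt (fun s : ℝ => 1 + s ^ 2) ((2 : ℕ) * x ^ 1 * 1) x :=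
      ((hasDerivAt_id x).pow 2).const_add 1
    refine (((Real.hasDerivAt_arctan x).sub
      ((hasDerivAt_id x).div h1 (by positivity))).const_mul (1 / 2)).congr_deriv ?_
    push_cast
    simp only [id]
    field_simp
    ring
  have hl : Tendsto (fun s : ℝ => 1 / 2 * (Real.arctan s - s / (1 + s ^ 2))) atTop
      (𝓝 (1 / 2 * (Real.pi / 2 - 0))) := by
    refine Tendsto.const_mul _ ((Real.tendsto_arctan_atTop.mono_right nhdsWithin_le_nhds).sub ?_)
    have h : Tendsto (fun s : ℝ => s⁻¹) atTop (𝓝 0) := tendsto_inv_atTop_zero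
    refine squeeze_zero' ?_ ?_ h
    · filter_upwards [eventually_gt_atTop 0] with s hs
      positivity
    · filter_upwards [eventually_gt_atTop 0] with s hs
      rw [div_le_iff₀ (by positivity), inv_mul_eq_div, le_div_iff₀ hs]
      nlinarith
  rw [integral_Ioi_of_hasDerivAt_of_nonneg (hd 0 self_mem_Ici).continuousAt.continuousWithinAt
    (fun x hx => hd x (Ioi_subset_Ici_self hx)) (fun x hx => ?_) hl]
  · norm_num; ring
  · positivity

/-- The integral of a nonintegrable function is 0 by convention, so a nonzero value proves
integrability. -/
lemma integrableOn_sq_div_one_add_sq_sq :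
    IntegrableOn (fun s : ℝ => s ^ 2 / (1 + s ^ 2) ^ 2) (Ioi 0) := by
  by_contra h
  have := integral_undef h
  rw [integral_sq_div_one_add_sq_sq] at this
  linarith [Real.pi_pos]

lemma integrableOn_div_one_add_sq_sq :
    IntegrableOn (fun s : ℝ => s / (1 + s ^ 2) ^ 2) (Ioi 0) := by
  by_contra h
  have := integral_undef h
  rw [integral_div_one_add_sq_sq] at this
  norm_num at this

/-- Scaling s by w puts the two double poles at ±i, and their difference is a multiple of s/(1 +
s²)². As this has integral 1/2, the term 1/(πw) is what remains when the oscillating factor is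
replaced by 1; removing it leaves a difference quotient in w. -/
lemma oscSide_sub_oscSide_neg {σ : ℝ} (hσ : σ ^ 2 = 1) {w : ℝ} (hw : 0 < w) :
    oscSide σ w - oscSide σ (-w) - 1 / (Real.pi * w)
      = 2 / Real.pi * ∫ s in Ioi (0 : ℝ), ((osc σ (w * s) - 1) / w) * (s / (1 + s ^ 2) ^ 2 : ℝ) := by
  have hpi : (Real.pi : ℂ) ≠ 0 := by exact_mod_cast Real.pi_ne_zero
  have hσ0 : σ ≠ 0 := by rintro rfl; norm_num at hσ
  have hσc : (σ : ℂ) ^ 2 = 1 := by exact_mod_cast hσ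
  have hwc : (w : ℂ) ≠ 0 := by exact_mod_cast hw.ne'
  have m1 := neg_I_mul_mem_slitPlane hσ0 (w := w) (by simpa using hw.ne')
  have m2 := neg_I_mul_mem_slitPlane hσ0 (w := -w) (by simpa using hw.ne')
  have i1 := integrableOn_osc_div m1 σ le_rfl
  have i2 := integrableOn_osc_div m2 σ le_rfl
  have h1 : oscInt σ (-Complex.I * σ * w) - oscInt σ (-Complex.I * σ * (-w))
      = 4 * Complex.I * σ / w * ∫ s in Ioi (0 : ℝ), osc σ (w * s) * (s / (1 + s ^ 2) ^ 2 : ℝ) := by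
    rw [oscInt, oscInt, ← integral_sub i1 i2]
    have := integral_comp_mul_left_Ioi (fun s : ℝ => osc σ s / ((s : ℂ) + -Complex.I * σ * w) ^ 2
      - osc σ s / ((s : ℂ) + -Complex.I * σ * (-w)) ^ 2) 0 hw
    rw [mul_zero] at this
    rw [← inv_smul_eq_iff₀ (inv_ne_zero hw.ne'), inv_inv] at this
    rw [← this, ← integral_const_mul, Complex.real_smul, ← integral_const_mul]
    refine setIntegral_congr_fun measurableSet_Ioi fun s hs => ?_
    have hs' : (0 : ℝ) < s := hs
    have n0 : (1 + (s : ℂ) ^ 2) ≠ 0 := by exact_mod_cast (by positivity : (1 + s ^ 2) ≠ 0)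
    have n1 := slit_add_ne_zero m1 (mul_pos hw hs').le
    have n2 := slit_add_ne_zero m2 (mul_pos hw hs').le
    have hprod : (((w * s : ℝ) : ℂ) + -Complex.I * σ * w) * (((w * s : ℝ) : ℂ) + -Complex.I * σ * (-w))
        = w ^ 2 * (1 + s ^ 2) := by
      push_cast
      linear_combination (-(w : ℂ) ^ 2 * σ ^ 2) * Complex.I_sq + (w : ℂ) ^ 2 * hσc
    have hdiff : (((w * s : ℝ) : ℂ) + -Complex.I * σ * (-w)) ^ 2
        - (((w * s : ℝ) : ℂ) + -Complex.I * σ * w) ^ 2 = 4 * Complex.I * σ * w ^ 2 * s := by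
      push_cast; ring
    set A := ((w * s : ℝ) : ℂ) + -Complex.I * σ * w
    set B := ((w * s : ℝ) : ℂ) + -Complex.I * σ * (-w)
    have e1 : osc σ (w * s) / A ^ 2 - osc σ (w * s) / B ^ 2
        = osc σ (w * s) * (B ^ 2 - A ^ 2) / (A * B) ^ 2 := by
      field_simp
    rw [e1, hdiff, hprod]
    push_cast
    field_simp
  have i3 : IntegrableOn (fun s : ℝ => osc σ (w * s) * (s / (1 + s ^ 2) ^ 2 : ℝ)) (Ioi 0) := by
    refine integrableOn_div_one_add_sq_sq.ofReal.bdd_mul (c := 1) ?_ ?_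
    · exact ((continuous_osc σ).comp (continuous_const.mul continuous_id)).aestronglyMeasurable
    · exact Eventually.of_forall fun s => (norm_osc _ _).le
  have h2 : ∫ s in Ioi (0 : ℝ), ((osc σ (w * s) - 1) / w) * (s / (1 + s ^ 2) ^ 2 : ℝ)
      = 1 / w * ((∫ s in Ioi (0 : ℝ), osc σ (w * s) * (s / (1 + s ^ 2) ^ 2 : ℝ)) - 1 / 2) := by
    have h3 : ∫ s in Ioi (0 : ℝ), ((s / (1 + s ^ 2) ^ 2 : ℝ) : ℂ) = 1 / 2 := by
      rw [integral_complex_ofReal, integral_div_one_add_sq_sq]; norm_num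
    have i4 : IntegrableOn (fun s : ℝ => ((s / (1 + s ^ 2) ^ 2 : ℝ) : ℂ)) (Ioi 0) :=
      integrableOn_div_one_add_sq_sq.ofReal
    rw [← h3, ← integral_sub i3 i4, ← integral_const_mul]
    refine integral_congr_ae (Eventually.of_forall fun s => ?_)
    ring
  rw [h2]
  have h4 : oscSide σ w - oscSide σ (-w) = σ / (2 * Real.pi * Complex.I) *
      (oscInt σ (-Complex.I * σ * w) - oscInt σ (-Complex.I * σ * (-w))) := by
    rw [oscSide, oscSide]; ring
  rw [h4, h1]
  field_simp
  linear_combination (4 * ∫ s in Ioi (0 : ℝ), osc σ (w * s) * (s / (1 + s ^ 2) ^ 2 : ℝ)) * hσc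

/-- The difference quotient tends to 2πiσs and is bounded by 2πs. Since s²/(1 + s²)² has integral
π/4, the limit is (2/π)(2πiσ)(π/4), the half residue. -/
lemma tendsto_oscSide_sub {σ : ℝ} (hσ : σ ^ 2 = 1) :
    Tendsto (fun w : ℝ => oscSide σ w - oscSide σ (-w) - 1 / (Real.pi * w)) (𝓝[>] 0)
      (𝓝 (σ * Real.pi * Complex.I)) := by
  have hσ1 : |σ| = 1 := by
    rw [← sq_abs] at hσ
    exact (pow_eq_one_iff_of_nonneg (abs_nonneg _) two_ne_zero).1 hσ
  have h := tendsto_integral_filter_of_dominated_convergence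
    (μ := volume.restrict (Ioi (0 : ℝ))) (l := 𝓝[>] (0 : ℝ))
    (F := fun (w : ℝ) (s : ℝ) => ((osc σ (w * s) - 1) / w) * (s / (1 + s ^ 2) ^ 2 : ℝ))
    (f := fun s : ℝ => 2 * Real.pi * Complex.I * σ * (s ^ 2 / (1 + s ^ 2) ^ 2 : ℝ))
    (fun s : ℝ => 2 * Real.pi * (s ^ 2 / (1 + s ^ 2) ^ 2)) ?_ ?_
    (integrableOn_sq_div_one_add_sq_sq.const_mul _) ?_
  · have h3 : ∫ s in Ioi (0 : ℝ), 2 * (Real.pi : ℂ) * Complex.I * σ * (s ^ 2 / (1 + s ^ 2) ^ 2 : ℝ)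
        = 2 * (Real.pi : ℂ) * Complex.I * σ * (Real.pi / 4) := by
      rw [integral_const_mul, integral_complex_ofReal, integral_sq_div_one_add_sq_sq]; norm_num
    rw [h3] at h
    have h4 := h.const_mul (2 / Real.pi : ℂ)
    have hpi : (Real.pi : ℂ) ≠ 0 := by exact_mod_cast Real.pi_ne_zero
    rw [show (2 / Real.pi : ℂ) * (2 * Real.pi * Complex.I * σ * (Real.pi / 4))
      = σ * Real.pi * Complex.I by field_simp; ring] at h4
    refine h4.congr' ?_
    filter_upwards [self_mem_nhdsWithin] with w hw
    exact (oscSide_sub_oscSide_neg hσ hw).symm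
  · refine Eventually.of_forall fun w => Measurable.aestronglyMeasurable ?_
    have := (continuous_osc σ).measurable
    fun_prop
  · filter_upwards [self_mem_nhdsWithin] with w hw
    have hw' : (0 : ℝ) < w := hw
    refine (ae_restrict_iff' measurableSet_Ioi).2 (Eventually.of_forall fun s hs => ?_)
    have hs' : (0 : ℝ) < s := hs
    have h1 : ‖osc σ (w * s) - 1‖ ≤ 2 * Real.pi * (w * s) := by
      have := norm_exp_sub_exp_le (a := 2 * Real.pi * Complex.I * σ * (w * s : ℝ)) (b := 0)
        (by simp) (by simp)
      rw [Complex.exp_zero, sub_zero] at this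
      refine this.trans (le_of_eq ?_)
      simp [abs_of_pos Real.pi_pos, abs_of_pos hw', abs_of_pos hs', hσ1]
    rw [norm_mul, norm_div, Complex.norm_of_nonneg hw'.le, Complex.norm_of_nonneg (by positivity),
      div_mul_eq_mul_div, div_le_iff₀ hw']
    calc ‖osc σ (w * s) - 1‖ * (s / (1 + s ^ 2) ^ 2)
        ≤ 2 * Real.pi * (w * s) * (s / (1 + s ^ 2) ^ 2) := by gcongr
      _ = _ := by ring
  · refine Eventually.of_forall fun s => ?_
    have h1 : HasDerivAt (fun w : ℝ => osc σ (w * s))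
        (s • (2 * Real.pi * Complex.I * σ * osc σ (0 * s))) 0 := by
      have h0 : HasDerivAt (fun w : ℝ => w * s) s 0 := by
        simpa using (hasDerivAt_id (0 : ℝ)).mul_const s
      exact (hasDerivAt_osc σ (0 * s)).scomp (h := fun w : ℝ => w * s) (0 : ℝ) h0
    have h2 := h1.tendsto_slope_zero_right.mul_const ((s / (1 + s ^ 2) ^ 2 : ℝ) : ℂ)
    convert h2 using 2
    · simp [osc, div_eq_inv_mul]
    · simp [osc]; ring

/-- The value of `oscSide` on the right half plane, where the pole lies on the ray. -/
lemma oscSide_pos {σ : ℝ} (hσ : σ ^ 2 = 1) {w : ℂ} (hw : 0 < w.re) :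
    oscSide σ w = 1 / (2 * Real.pi * w) + expInt (2 * Real.pi * w) + pvCore (2 * Real.pi * w)
      + σ * Real.pi * Complex.I * Complex.exp (-(2 * Real.pi * w)) := by
  have hpi : (Real.pi : ℂ) ≠ 0 := by exact_mod_cast Real.pi_ne_zero
  have hre : ∀ {w : ℂ}, 0 < w.re → 0 < (2 * Real.pi * w).re := by
    intro w hw
    rw [show (2 * Real.pi * w : ℂ) = ((2 * Real.pi : ℝ) : ℂ) * w by push_cast; ring,
      Complex.re_ofReal_mul]
    have := Real.pi_pos
    positivity
  obtain ⟨C, hC⟩ := exists_const_of_hasDerivAt_halfPlane (c := -(2 * Real.pi))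
    (D := fun w => oscSide σ w - (1 / (2 * Real.pi * w) + expInt (2 * Real.pi * w)
      + pvCore (2 * Real.pi * w)
      + σ * Real.pi * Complex.I * Complex.exp (-(2 * Real.pi * w)))) (by
    intro w hw
    have hw0 : w ≠ 0 := by rintro rfl; simp at hw
    have h1 := hasDerivAt_oscSide hσ hw.ne'
    have h0 : HasDerivAt (fun w : ℂ => 2 * Real.pi * w) (2 * Real.pi * 1) w :=
      (hasDerivAt_id w).const_mul _
    have h2 := (hasDerivAt_expInt (hre hw)).comp w h0
    have h3 := (hasDerivAt_const w (1 : ℂ)).div h0 (by simp [hw0, Real.pi_ne_zero])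
    have h4 := (hasDerivAt_pvCore (hre hw)).comp w h0
    have h5 := h0.neg.cexp.const_mul (σ * Real.pi * Complex.I)
    refine (h1.sub (((h3.add h2).add h4).add h5)).congr_deriv ?_
    simp only [Pi.neg_apply]
    field_simp
    ring)
  suffices hC0 : C = 0 by
    have := hC w hw
    rw [hC0, zero_mul] at this
    exact sub_eq_zero.1 this
  -- On this side the homogeneous solution e^{-2πw} decays, so growth at infinity says nothing about
  -- C. It is read off as w → 0⁺, after subtracting `oscSide_neg` to cancel `expInt` and the
  -- singular terms.
  have hl1 : Tendsto (fun w : ℝ => C * Complex.exp (-(2 * Real.pi) * w)) (𝓝[>] 0)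
      (𝓝 (C * Complex.exp (-(2 * Real.pi) * (0 : ℝ)))) :=
    ((by fun_prop : Continuous fun w : ℝ => C * Complex.exp (-(2 * Real.pi) * w)).tendsto 0).mono_left
      nhdsWithin_le_nhds
  have hl2 : Tendsto (fun w : ℝ => σ * Real.pi * Complex.I * Complex.exp (-(2 * Real.pi * w))) (𝓝[>] 0)
      (𝓝 (σ * Real.pi * Complex.I * Complex.exp (-(2 * Real.pi * (0 : ℝ))))) :=
    ((by fun_prop : Continuous fun w : ℝ =>
      σ * Real.pi * Complex.I * Complex.exp (-(2 * Real.pi * (w : ℂ)))).tendsto 0).mono_left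
      nhdsWithin_le_nhds
  have hl3 : Tendsto (fun w : ℝ => pvCore ((2 * Real.pi * w : ℝ) : ℂ)) (𝓝[>] 0) (𝓝 0) := by
    refine tendsto_pvCore_zero.comp (tendsto_nhdsWithin_iff.2 ⟨?_, ?_⟩)
    · have := ((by fun_prop : Continuous fun w : ℝ => 2 * Real.pi * w).tendsto 0).mono_left
        (nhdsWithin_le_nhds (s := Ioi 0))
      simpa using this
    · filter_upwards [self_mem_nhdsWithin] with w hw
      have : (0 : ℝ) < w := hw
      have hp := Real.pi_pos
      exact mem_Ioi.2 (by positivity)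
  have hl4 := ((tendsto_oscSide_sub hσ).sub hl3).sub hl2
  have := tendsto_nhds_unique (hl1.congr' ?_) hl4
  · simpa using this
  · filter_upwards [self_mem_nhdsWithin] with w hw
    have hw' : (0 : ℝ) < w := hw
    have hwc : (w : ℂ) ≠ 0 := by exact_mod_cast hw'.ne'
    rw [← hC w (by simpa using hw'), oscSide_neg hσ (w := w) (by simpa using hw')]
    push_cast
    field_simp
    ring

/-! ### Principal values -/

lemma measurableSet_pvDomain (a ε : ℝ) : MeasurableSet (pvDomain a ε) :=
  (measurableSet_lt measurable_const measurable_id).inter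
    (measurableSet_le measurable_const (by fun_prop : Measurable fun x : ℝ => |x - a|))

lemma pvDomain_subset (a ε : ℝ) : pvDomain a ε ⊆ Ioi 0 := fun _ hx => hx.1

lemma tendsto_pvTruncated_of_integrableOn {K : ℝ → ℂ} (hK : IntegrableOn K (Ioi 0)) (a : ℝ) :
    Tendsto (pvTruncated K a) (𝓝[>] 0) (𝓝 (∫ x in Ioi 0, K x)) := by
  have h : ∀ ε, pvTruncated K a ε = ∫ x in Ioi (0 : ℝ), (pvDomain a ε).indicator K x := by
    intro ε
    rw [pvTruncated, setIntegral_indicator (measurableSet_pvDomain a ε),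
      inter_eq_self_of_subset_right (pvDomain_subset a ε)]
  rw [funext h]
  refine tendsto_integral_filter_of_dominated_convergence (fun x => ‖K x‖)
    (Eventually.of_forall fun ε => hK.aestronglyMeasurable.indicator (measurableSet_pvDomain a ε))
    (Eventually.of_forall fun ε => Eventually.of_forall fun x => norm_indicator_le_norm_self _ _)
    hK.norm ?_
  filter_upwards [ae_pos_ne a] with x hx
  refine tendsto_const_nhds.congr' ?_
  have : 0 < |x - a| := abs_pos.2 (sub_ne_zero.2 hx.2)
  filter_upwards [Ioc_mem_nhdsGT this] with ε hε
  rw [indicator_of_mem (show x ∈ pvDomain a ε from ⟨hx.1, hε.2⟩)]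

lemma pvDomain_eq {a ε : ℝ} (hε : 0 < ε) (hεa : ε < a) :
    pvDomain a ε = Ioc 0 (a - ε) ∪ Ici (a + ε) := by
  ext x
  simp only [pvDomain, mem_ofPred_eq, mem_union, mem_Ioc, mem_Ici, le_abs]
  constructor
  · rintro ⟨h1, h2 | h2⟩
    · right; linarith
    · left; exact ⟨h1, by linarith⟩
  · rintro (⟨h1, h2⟩ | h)
    · exact ⟨h1, Or.inr (by linarith)⟩
    · exact ⟨by linarith, Or.inl (by linarith)⟩

lemma hasDerivAt_log_sub_log {a x : ℝ} (h1 : x - a ≠ 0) (h2 : x + a ≠ 0) :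
    HasDerivAt (fun x => Real.log (x - a) - Real.log (x + a)) (2 * a / (x ^ 2 - a ^ 2)) x := by
  refine ((((hasDerivAt_id x).sub_const a).log h1).sub
    (((hasDerivAt_id x).add_const a).log h2)).congr_deriv ?_
  have h3 : x ^ 2 - a ^ 2 ≠ 0 := by
    rw [show x ^ 2 - a ^ 2 = (x - a) * (x + a) by ring]; exact mul_ne_zero h1 h2
  simp only [id]
  field_simp
  ring

lemma tendsto_log_sub_log_atTop (a : ℝ) :
    Tendsto (fun x : ℝ => Real.log (x - a) - Real.log (x + a)) atTop (𝓝 0) := by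
  have h1 : Tendsto (fun x : ℝ => (x - a) / (x + a)) atTop (𝓝 1) := by
    have h2 : Tendsto (fun x : ℝ => 1 - 2 * a / (x + a)) atTop (𝓝 (1 - 0)) :=
      tendsto_const_nhds.sub (tendsto_const_nhds.div_atTop
        (tendsto_atTop_add_const_right _ _ tendsto_id))
    rw [sub_zero] at h2
    refine h2.congr' ?_
    filter_upwards [eventually_gt_atTop (-a)] with x hx
    have : x + a ≠ 0 := by linarith
    field_simp
    ring
  have h3 := h1.log one_ne_zero
  rw [Real.log_one] at h3
  refine h3.congr' ?_
  filter_upwards [eventually_gt_atTop (-a), eventually_gt_atTop a] with x hx hx'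
  exact Real.log_div (by linarith) (by linarith)

/-- `Real.log` is the logarithm of the absolute value, so one primitive serves on both sides of the
pole and the two terms log ε cancel. What is left tends to 0 with ε: this kernel has principal value
zero, so the numerator may be regularized at the pole for free. -/
lemma pv_one_div_sq_sub_sq {a ε : ℝ} (hε : 0 < ε) (hεa : ε < a) :
    IntegrableOn (fun x : ℝ => 2 * a / (x ^ 2 - a ^ 2)) (pvDomain a ε) ∧
      ∫ x in pvDomain a ε, 2 * a / (x ^ 2 - a ^ 2)
        = Real.log (2 * a + ε) - Real.log (2 * a - ε) := by
  have ha : 0 < a := hε.trans hεa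
  have hd : ∀ x ∈ Ici (a + ε), HasDerivAt (fun x => Real.log (x - a) - Real.log (x + a))
      (2 * a / (x ^ 2 - a ^ 2)) x := by
    intro x hx
    have : a + ε ≤ x := hx
    exact hasDerivAt_log_sub_log (by linarith) (by linarith)
  have hn : ∀ x ∈ Ioi (a + ε), 0 ≤ 2 * a / (x ^ 2 - a ^ 2) := by
    intro x hx
    have : a + ε < x := hx
    have : 0 < x ^ 2 - a ^ 2 := by nlinarith
    positivity
  have i2 := integrableOn_Ioi_deriv_of_nonneg' hd hn (tendsto_log_sub_log_atTop a)
  have e2 := integral_Ioi_of_hasDerivAt_of_nonneg' hd hn (tendsto_log_sub_log_atTop a)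
  have hd1 : ∀ x ∈ uIcc 0 (a - ε), HasDerivAt (fun x => Real.log (x - a) - Real.log (x + a))
      (2 * a / (x ^ 2 - a ^ 2)) x := by
    intro x hx
    rw [uIcc_of_le (by linarith)] at hx
    exact hasDerivAt_log_sub_log (by linarith [hx.2]) (by linarith [hx.1])
  have c1 : ContinuousOn (fun x : ℝ => 2 * a / (x ^ 2 - a ^ 2)) (uIcc 0 (a - ε)) := by
    refine continuousOn_const.div (by fun_prop) fun x hx => ?_
    rw [uIcc_of_le (by linarith)] at hx
    have h1 : x - a ≠ 0 := by linarith [hx.2]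
    have h2 : x + a ≠ 0 := by linarith [hx.1]
    rw [show x ^ 2 - a ^ 2 = (x - a) * (x + a) by ring]; exact mul_ne_zero h1 h2
  have e1 := intervalIntegral.integral_eq_sub_of_hasDerivAt hd1 c1.intervalIntegrable
  have i1 := (intervalIntegrable_iff_integrableOn_Ioc_of_le (by linarith)).1
    (c1.intervalIntegrable (μ := volume))
  rw [intervalIntegral.integral_of_le (by linarith)] at e1
  have i2' := (integrableOn_Ici_iff_integrableOn_Ioi (by simp)).2 i2
  rw [pvDomain_eq hε hεa]
  refine ⟨i1.union i2', ?_⟩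
  rw [setIntegral_union _ measurableSet_Ici i1 i2', integral_Ici_eq_integral_Ioi, e1, e2]
  · rw [show a - ε - a = -ε by ring, Real.log_neg_eq_log, zero_sub, Real.log_neg_eq_log, zero_add,
      show a - ε + a = 2 * a - ε by ring, show a + ε - a = ε by ring,
      show a + ε + a = 2 * a + ε by ring]
    ring
  · rw [Set.disjoint_left]
    intro x hx hx'
    have := hx.2
    have : a + ε ≤ x := hx'
    linarith

lemma pvDomain_anti (a : ℝ) {ε₁ ε₂ : ℝ} (h : ε₁ ≤ ε₂) : pvDomain a ε₂ ⊆ pvDomain a ε₁ :=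
  fun _ hx => ⟨hx.1, h.trans hx.2⟩

/-- The function `x e^{-κx} / (x - a)`. -/
def laplaceIntegrand (κ : ℂ) (a x : ℝ) : ℂ :=
  (x : ℂ) * Complex.exp (-κ * x) / ((x : ℂ) - a)

lemma pvIntegral_eq {g : ℝ → ℂ} {a : ℝ} {L : ℂ} (h : Tendsto (pvTruncated g a) (𝓝[>] 0) (𝓝 L)) :
    pvIntegral g a = L := h.limUnder_eq

/-- The pole is off the half line, so the principal value is an ordinary integral; x = -au turns
x/(x - a) into 1 - 1/(1 + u). -/
lemma pv_laplace_of_neg {κ : ℂ} (hκ : 0 < κ.re) {a : ℝ} (ha : a < 0) :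
    PVExists (laplaceIntegrand κ a) a ∧
      1 / (a : ℂ) * pvIntegral (laplaceIntegrand κ a) a = expInt (-(κ * a)) - 1 / (-(κ * a)) := by
  have hb : 0 < -a := by linarith
  have hre : 0 < (-(κ * a)).re := by simp; nlinarith
  have e : EqOn (fun x : ℝ => laplaceIntegrand κ a (-a * x))
      (fun u : ℝ => Complex.exp (-(-(κ * a)) * u) - Complex.exp (-(-(κ * a)) * u) / (1 + u))
      (Ioi 0) := by
    intro u hu
    have hu' : (0 : ℝ) < u := hu
    have h1 : (1 + u : ℂ) ≠ 0 := by exact_mod_cast (by positivity : (1 + u) ≠ 0)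
    have h2 : (a : ℂ) ≠ 0 := by exact_mod_cast ha.ne
    have h3 : (((-a * u : ℝ) : ℂ) - a) = -a * (1 + u) := by push_cast; ring
    simp only [laplaceIntegrand]
    rw [h3, show -κ * ((-a * u : ℝ) : ℂ) = -(-(κ * a)) * u by push_cast; ring]
    push_cast
    field_simp
    ring
  have i0 := (integrableOn_exp_neg_mul hre).sub (integrableOn_exp_div_one_add hre)
  have i1 : IntegrableOn (laplaceIntegrand κ a) (Ioi 0) := by
    have := (integrableOn_Ioi_comp_mul_left_iff (laplaceIntegrand κ a) 0 hb).1
      (i0.congr_fun e.symm measurableSet_Ioi)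
    simpa using this
  have ht := tendsto_pvTruncated_of_integrableOn i1 a
  refine ⟨⟨fun ε _ => i1.mono_set (pvDomain_subset a ε), _, ht⟩, ?_⟩
  rw [pvIntegral_eq ht]
  have h4 := integral_comp_mul_left_Ioi (laplaceIntegrand κ a) 0 hb
  rw [setIntegral_congr_fun measurableSet_Ioi e, mul_zero,
    integral_sub (integrableOn_exp_neg_mul hre) (integrableOn_exp_div_one_add hre),
    integral_exp_neg_mul hre, Complex.real_smul] at h4
  change _ - expInt _ = _ at h4
  have h2 : (a : ℂ) ≠ 0 := by exact_mod_cast ha.ne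
  push_cast at h4
  rw [show (∫ x in Ioi (0 : ℝ), laplaceIntegrand κ a x)
    = -a * (1 / (-(κ * a)) - expInt (-(κ * a))) by rw [h4]; field_simp]
  field_simp
  ring

/-- Use x/(x - a) = 1 + a/(x + a) + 2a²/(x² - a²) and subtract the value e^{-κa} in the last term.
The result `K` is integrable, and the subtracted part contributes nothing in the limit by
`pv_one_div_sq_sub_sq`. -/
lemma pv_laplace_of_pos {κ : ℂ} (hκ : 0 < κ.re) {a : ℝ} (ha : 0 < a) :
    PVExists (laplaceIntegrand κ a) a ∧
      1 / (a : ℂ) * pvIntegral (laplaceIntegrand κ a) a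
        = 1 / (κ * a) + expInt (κ * a) + pvCore (κ * a) := by
  have hre : 0 < (κ * a).re := by simp; positivity
  have hac : (a : ℂ) ≠ 0 := by exact_mod_cast ha.ne'
  set K : ℝ → ℂ := fun x => Complex.exp (-κ * x) + a * (Complex.exp (-κ * x) / (x + a))
    + 2 * a ^ 2 * (Complex.exp (-κ * x) - Complex.exp (-κ * a)) / ((x : ℂ) ^ 2 - a ^ 2) with hKdef
  have e : EqOn (fun u : ℝ => K (a * u))
      (fun u : ℝ => (Complex.exp (-(κ * a) * u) + Complex.exp (-(κ * a) * u) / (1 + u))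
        + 2 * (Complex.exp (-(κ * a) * u) - Complex.exp (-(κ * a))) / ((u : ℂ) ^ 2 - 1))
      (Ioi 0) := by
    intro u hu
    have hu' : (0 : ℝ) < u := hu
    have h1 : (1 + u : ℂ) ≠ 0 := by exact_mod_cast (by positivity : (1 + u) ≠ 0)
    simp only [hKdef]
    rw [show -κ * ((a * u : ℝ) : ℂ) = -(κ * a) * u by push_cast; ring,
      show ((a * u : ℝ) : ℂ) + a = a * (1 + u) by push_cast; ring,
      show ((a * u : ℝ) : ℂ) ^ 2 - a ^ 2 = a ^ 2 * (u ^ 2 - 1) by push_cast; ring,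
      show -κ * (a : ℂ) = -(κ * a) by ring]
    congr 1
    · field_simp
    · rw [show 2 * (a : ℂ) ^ 2 * (Complex.exp (-(κ * a) * u) - Complex.exp (-(κ * a)))
        = a ^ 2 * (2 * (Complex.exp (-(κ * a) * u) - Complex.exp (-(κ * a)))) by ring,
        mul_div_mul_left _ _ (pow_ne_zero 2 hac)]
  have j1 := integrableOn_exp_neg_mul hre
  have j2 := integrableOn_exp_div_one_add hre
  have j3 := integrableOn_pvCore hre.le
  have iK : IntegrableOn K (Ioi 0) := by
    have := (integrableOn_Ioi_comp_mul_left_iff K 0 ha).1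
      (((j1.add j2).add j3).congr_fun e.symm measurableSet_Ioi)
    simpa using this
  have hKint : ∫ x in Ioi (0 : ℝ), K x = a * (1 / (κ * a) + expInt (κ * a) + pvCore (κ * a)) := by
    have h4 := integral_comp_mul_left_Ioi K 0 ha
    have h5 : ∫ u in Ioi (0 : ℝ), K (a * u) = 1 / (κ * a) + expInt (κ * a) + pvCore (κ * a) := by
      rw [setIntegral_congr_fun measurableSet_Ioi e]
      refine (integral_add (j1.add j2) j3).trans ?_
      refine congrArg₂ _ ((integral_add j1 j2).trans ?_) rfl
      rw [integral_exp_neg_mul hre]; rfl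
    rw [h5, mul_zero, Complex.real_smul] at h4
    rw [h4]
    push_cast
    field_simp
  have hdec : ∀ ε : ℝ, 0 < ε → EqOn (fun x : ℝ => K x + a * Complex.exp (-κ * a) *
      ((2 * a / (x ^ 2 - a ^ 2) : ℝ) : ℂ)) (laplaceIntegrand κ a) (pvDomain a ε) := by
    intro ε hε x hx
    have hx0 : 0 < x := hx.1
    have hxa : x - a ≠ 0 := fun h => by
      have := hx.2
      rw [h, abs_zero] at this
      linarith
    have h1 : (x : ℂ) - a ≠ 0 := by exact_mod_cast hxa
    have h2 : (x : ℂ) + a ≠ 0 := by exact_mod_cast (by positivity : x + a ≠ 0)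
    have h3 : (x : ℂ) ^ 2 - a ^ 2 = (x - a) * (x + a) := by ring
    simp only [hKdef, laplaceIntegrand]
    push_cast
    rw [h3]
    field_simp
    ring
  have hint : ∀ ε : ℝ, 0 < ε → ε < a → IntegrableOn (laplaceIntegrand κ a) (pvDomain a ε) ∧
      pvTruncated (laplaceIntegrand κ a) a ε = pvTruncated K a ε
        + a * Complex.exp (-κ * a) * ((Real.log (2 * a + ε) - Real.log (2 * a - ε) : ℝ) : ℂ) := by
    intro ε hε hεa
    obtain ⟨h1, h2⟩ := pv_one_div_sq_sub_sq hε hεa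
    have iK' := iK.mono_set (pvDomain_subset a ε)
    have h1' : IntegrableOn (fun x : ℝ => ((2 * a / (x ^ 2 - a ^ 2) : ℝ) : ℂ)) (pvDomain a ε) :=
      h1.ofReal
    have h3 := h1'.const_mul (a * Complex.exp (-κ * a))
    refine ⟨(iK'.add h3).congr_fun (hdec ε hε) (measurableSet_pvDomain a ε), ?_⟩
    rw [pvTruncated, ← setIntegral_congr_fun (measurableSet_pvDomain a ε) (hdec ε hε),
      integral_add iK' h3, integral_const_mul, integral_complex_ofReal, h2]
    rfl
  have hlim : Tendsto (fun ε : ℝ => a * Complex.exp (-κ * a) *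
      ((Real.log (2 * a + ε) - Real.log (2 * a - ε) : ℝ) : ℂ)) (𝓝[>] 0) (𝓝 0) := by
    have h1 : ContinuousAt (fun ε : ℝ => Real.log (2 * a + ε) - Real.log (2 * a - ε)) 0 := by
      refine ContinuousAt.sub (ContinuousAt.log (by fun_prop) (by linarith))
        (ContinuousAt.log (by fun_prop) (by linarith))
    have h2 := ((Complex.continuous_ofReal.continuousAt.comp h1).tendsto.const_mul
      (a * Complex.exp (-κ * a))).mono_left (nhdsWithin_le_nhds (s := Ioi 0))
    simpa using h2
  have ht : Tendsto (pvTruncated (laplaceIntegrand κ a) a) (𝓝[>] 0) (𝓝 (∫ x in Ioi 0, K x)) := by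
    have h1 := (tendsto_pvTruncated_of_integrableOn iK a).add hlim
    rw [add_zero] at h1
    refine h1.congr' ?_
    filter_upwards [Ioo_mem_nhdsGT ha] with ε hε
    exact (hint ε hε.1 hε.2).2.symm
  refine ⟨⟨fun ε hε => ?_, _, ht⟩, ?_⟩
  -- The explicit formula needs ε < a; a larger ε only shrinks the domain.
  · refine (hint (min ε (a / 2)) (by positivity) ?_).1.mono_set (pvDomain_anti a (min_le_left _ _))
    exact (min_le_right _ _).trans_lt (by linarith)
  · rw [pvIntegral_eq ht, hKint]
    field_simp

/-- The principal value as an oscillatory integral, together with half a residue when the pole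
lies on the ray of integration. -/
lemma pv_laplace {σ : ℝ} (hσ : σ ^ 2 = 1) {z : ℂ} (hz : 0 < z.re) {a : ℝ} (ha : a ≠ 0) :
    PVExists (laplaceIntegrand (2 * Real.pi / z) a) a ∧
      1 / (a : ℂ) * pvIntegral (laplaceIntegrand (2 * Real.pi / z) a) a
        = oscSide σ (a / z) - if 0 < a then
            σ * Real.pi * Complex.I * Complex.exp (-(2 * Real.pi * (a / z))) else 0 := by
  have hinv : 0 < (1 / z).re := by
    rw [one_div, Complex.inv_re]
    exact div_pos hz (Complex.normSq_pos.2 (by rintro rfl; simp at hz))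
  have hκ : 0 < (2 * Real.pi / z : ℂ).re := by
    rw [show (2 * Real.pi / z : ℂ) = ((2 * Real.pi : ℝ) : ℂ) * (1 / z) by push_cast; ring,
      Complex.re_ofReal_mul]
    exact mul_pos Real.two_pi_pos hinv
  have hdiv : (a / z : ℂ).re = a * (1 / z).re := by
    rw [show (a / z : ℂ) = (a : ℂ) * (1 / z) by ring, Complex.re_ofReal_mul]
  rcases lt_or_gt_of_ne ha with h | h
  · obtain ⟨h1, h2⟩ := pv_laplace_of_neg hκ h
    refine ⟨h1, ?_⟩
    rw [h2, if_neg (by linarith), sub_zero]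
    have := oscSide_neg hσ (w := -(a / z)) (by rw [Complex.neg_re, hdiv]; nlinarith)
    rw [neg_neg] at this
    rw [this, show (2 * Real.pi * -(a / z) : ℂ) = -(2 * Real.pi / z * a) by ring]
  · obtain ⟨h1, h2⟩ := pv_laplace_of_pos hκ h
    refine ⟨h1, ?_⟩
    rw [h2, if_pos h, oscSide_pos hσ (by rw [hdiv]; positivity),
      show (2 * Real.pi * (a / z) : ℂ) = 2 * Real.pi / z * a by ring]
    ring

/-! ### Sums of inverse powers along a line -/

/-- The inequality is invariant under positive scaling, so only the two rays through ξ and -ξ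
matter. -/
lemma exists_uniform_le_norm_add {ξ : ℂ} (hξ : ξ.im ≠ 0) :
    ∃ κ : ℝ, 0 < κ ∧ ∀ y : ℝ, y ≠ 0 → ∀ s : ℝ, 0 ≤ s →
      κ * (s + ‖(y : ℂ) * ξ‖) ≤ ‖(s : ℂ) + y * ξ‖ := by
  obtain ⟨κ₁, h₁, -, H₁⟩ := exists_le_norm_add (X := ξ) (Or.inr hξ)
  obtain ⟨κ₂, h₂, -, H₂⟩ := exists_le_norm_add (X := -ξ) (Or.inr (by simpa using hξ))
  refine ⟨min κ₁ κ₂, lt_min h₁ h₂, fun y hy s hs => ?_⟩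
  have key : ∀ κ : ℝ, ∀ η : ℂ, 0 < κ → (∀ s : ℝ, 0 ≤ s → κ * (s + ‖η‖) ≤ ‖(s : ℂ) + η‖) →
      ∀ b : ℝ, 0 < b → min κ₁ κ₂ ≤ κ → min κ₁ κ₂ * (s + ‖(b : ℂ) * η‖) ≤ ‖(s : ℂ) + b * η‖ := by
    intro κ η hκ H b hb hle
    have h3 := H (s / b) (by positivity)
    have h4 : (s : ℂ) + b * η = b * (((s / b : ℝ) : ℂ) + η) := by
      have : (b : ℂ) ≠ 0 := by exact_mod_cast hb.ne'
      push_cast; field_simp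
    rw [h4, norm_mul, norm_mul, Complex.norm_of_nonneg hb.le]
    calc min κ₁ κ₂ * (s + b * ‖η‖) ≤ κ * (s + b * ‖η‖) := by gcongr
      _ = b * (κ * (s / b + ‖η‖)) := by field_simp
      _ ≤ _ := by gcongr
  rcases lt_or_gt_of_ne hy with h | h
  · have := key κ₂ (-ξ) h₂ H₂ (-y) (by linarith) (min_le_right _ _)
    simpa using this
  · exact key κ₁ ξ h₁ H₁ y h (min_le_left _ _)

lemma mul_mem_slitPlane_of_im_ne_zero {ξ : ℂ} (hξ : ξ.im ≠ 0) {y : ℝ} (hy : y ≠ 0) :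
    (y : ℂ) * ξ ∈ Complex.slitPlane :=
  Or.inr (by simpa using ⟨hy, hξ⟩)

lemma integrable_tsum_of_summable_integral_norm {α ι : Type*} [MeasurableSpace α] {μ : Measure α}
    [Countable ι] {F : ι → α → ℂ} (hF : ∀ i, Integrable (F i) μ)
    (hs : Summable fun i => ∫ a, ‖F i a‖ ∂μ)
    (hm : AEStronglyMeasurable (fun a => ∑' i, F i a) μ) :
    Integrable (fun a => ∑' i, F i a) μ := by
  refine ⟨hm, ?_⟩
  have h1 : ∀ i, ∫⁻ a, ‖F i a‖ₑ ∂μ = ENNReal.ofReal (∫ a, ‖F i a‖ ∂μ) := fun i =>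
    (ofReal_integral_norm_eq_lintegral_enorm (hF i)).symm
  calc ∫⁻ a, ‖∑' i, F i a‖ₑ ∂μ ≤ ∫⁻ a, ∑' i, ‖F i a‖ₑ ∂μ :=
        lintegral_mono fun a => enorm_tsum_le_tsum_enorm
    _ = ∑' i, ∫⁻ a, ‖F i a‖ₑ ∂μ := lintegral_tsum fun i => (hF i).1.enorm
    _ = ∑' i, ENNReal.ofReal (∫ a, ‖F i a‖ ∂μ) := by simp_rw [h1]
    _ < ⊤ := hs.tsum_ofReal_lt_top

section Family

variable {ι : Type*} {y : ι → ℝ} {ξ : ℂ}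

lemma norm_one_div_pow_le {κ : ℝ} (hκ : 0 < κ) (hξ : ξ.im ≠ 0)
    (H : ∀ y : ℝ, y ≠ 0 → ∀ s : ℝ, 0 ≤ s → κ * (s + ‖(y : ℂ) * ξ‖) ≤ ‖(s : ℂ) + y * ξ‖)
    {b : ℝ} (hb : b ≠ 0) {s : ℝ} (hs : 0 ≤ s) (n : ℕ) :
    ‖1 / ((s : ℂ) + b * ξ) ^ n‖ ≤ 1 / (κ * ‖ξ‖) ^ n * (1 / |b| ^ n) := by
  have hξ0 : 0 < ‖ξ‖ := norm_pos_iff.2 (by rintro rfl; simp at hξ)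
  have h1 := H b hb s hs
  have hb0 : 0 < |b| := abs_pos.2 hb
  rw [norm_mul, Complex.norm_real, Real.norm_eq_abs] at h1
  rw [norm_div, norm_one, norm_pow, one_div_mul_one_div, ← mul_pow]
  gcongr
  nlinarith [mul_nonneg hκ.le hs]

lemma summable_one_div_pow_three (hsum : Summable fun i => 1 / (y i) ^ 2) (hy : ∀ i, y i ≠ 0) :
    Summable fun i => 1 / |y i| ^ 3 := by
  have h1 : Tendsto (fun i => 1 / (y i) ^ 2) cofinite (𝓝 0) := hsum.tendsto_cofinite_zero
  refine Summable.of_norm_bounded_eventually hsum ?_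
  filter_upwards [h1.eventually (gt_mem_nhds (show (0 : ℝ) < 1 from one_pos))] with i hi
  have h0 : 0 < |y i| := abs_pos.2 (hy i)
  rw [← sq_abs, div_lt_one (by positivity)] at hi
  have : 1 ≤ |y i| := by nlinarith
  rw [Real.norm_of_nonneg (by positivity), ← sq_abs (y i)]
  gcongr
  norm_num

/-- The sum `∑ (v + y_i ξ)⁻²`. -/
def invSqSum (y : ι → ℝ) (ξ : ℂ) (v : ℝ) : ℂ := ∑' i, 1 / ((v : ℂ) + y i * ξ) ^ 2

lemma summable_invSq (hξ : ξ.im ≠ 0) (hy : ∀ i, y i ≠ 0) (hsum : Summable fun i => 1 / (y i) ^ 2)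
    {v : ℝ} (hv : 0 ≤ v) : Summable fun i => 1 / ((v : ℂ) + y i * ξ) ^ 2 := by
  obtain ⟨κ, hκ, H⟩ := exists_uniform_le_norm_add hξ
  refine Summable.of_norm_bounded (hsum.mul_left (1 / (κ * ‖ξ‖) ^ 2)) fun i => ?_
  rw [← sq_abs (y i)]
  exact norm_one_div_pow_le hκ hξ H (hy i) hv 2

lemma exists_norm_invSqSum_le (hξ : ξ.im ≠ 0) (hy : ∀ i, y i ≠ 0)
    (hsum : Summable fun i => 1 / (y i) ^ 2) :
    ∃ C : ℝ, ∀ v : ℝ, 0 ≤ v → ‖invSqSum y ξ v‖ ≤ C := by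
  obtain ⟨κ, hκ, H⟩ := exists_uniform_le_norm_add hξ
  refine ⟨∑' i, 1 / (κ * ‖ξ‖) ^ 2 * (1 / (y i) ^ 2), fun v hv => ?_⟩
  refine tsum_of_norm_bounded (hsum.mul_left _).hasSum fun i => ?_
  rw [← sq_abs (y i)]
  exact norm_one_div_pow_le hκ hξ H (hy i) hv 2

lemma continuousOn_invSqSum (hξ : ξ.im ≠ 0) (hy : ∀ i, y i ≠ 0)
    (hsum : Summable fun i => 1 / (y i) ^ 2) : ContinuousOn (invSqSum y ξ) (Ici 0) := by
  obtain ⟨κ, hκ, H⟩ := exists_uniform_le_norm_add hξ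
  refine continuousOn_tsum (u := fun i => 1 / (κ * ‖ξ‖) ^ 2 * (1 / (y i) ^ 2)) (fun i => ?_)
    (hsum.mul_left _) fun i v hv => ?_
  · refine continuousOn_const.div (by fun_prop) fun s hs => ?_
    exact pow_ne_zero _ (slit_add_ne_zero (mul_mem_slitPlane_of_im_ne_zero hξ (hy i)) hs)
  · rw [← sq_abs (y i)]
    exact norm_one_div_pow_le hκ hξ H (hy i) hv 2

lemma hasDerivAt_invSqSum (hξ : ξ.im ≠ 0) (hy : ∀ i, y i ≠ 0)
    (hsum : Summable fun i => 1 / (y i) ^ 2) {v : ℝ} (hv : 0 < v) :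
    HasDerivAt (invSqSum y ξ) (∑' i, -2 * (1 / ((v : ℂ) + y i * ξ) ^ 3)) v := by
  obtain ⟨κ, hκ, H⟩ := exists_uniform_le_norm_add hξ
  refine hasDerivAt_tsum_of_isPreconnected (t := Ioi 0) (y₀ := v)
    (g := fun i (v : ℝ) => 1 / ((v : ℂ) + y i * ξ) ^ 2)
    (g' := fun i (v : ℝ) => -2 * (1 / ((v : ℂ) + y i * ξ) ^ 3))
    (u := fun i => 2 * (1 / (κ * ‖ξ‖) ^ 3 * (1 / |y i| ^ 3)))
    (((summable_one_div_pow_three hsum hy).mul_left _).mul_left _) isOpen_Ioi isPreconnected_Ioi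
    (fun i s hs => ?_) (fun i s hs => ?_) hv (summable_invSq hξ hy hsum hv.le) hv
  · have hs' : (0 : ℝ) < s := hs
    have hne := slit_add_ne_zero (mul_mem_slitPlane_of_im_ne_zero hξ (hy i)) hs'.le
    have h1 : HasDerivAt (fun s : ℝ => ((s : ℂ) + y i * ξ) ^ 2)
        ((2 : ℕ) * ((s : ℂ) + y i * ξ) ^ 1 * 1) s :=
      ((hasDerivAt_id s).ofReal_comp.add_const _).pow 2
    refine ((hasDerivAt_const s (1 : ℂ)).div h1 (pow_ne_zero _ hne)).congr_deriv ?_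
    push_cast
    field_simp
    ring
  · rw [norm_mul, norm_neg, Complex.norm_ofNat]
    exact mul_le_mul_of_nonneg_left (norm_one_div_pow_le hκ hξ H (hy i) (le_of_lt hs) 3) zero_le_two

/-- The integrals of the norms are O(1/y_i²), so sum and integral may be exchanged. For the squares
the corresponding bound is only O(1/|y_i|), which need not be summable; hence the detour through
cubes. -/
lemma hasSum_integral_osc_div_cube [Countable ι] (hξ : ξ.im ≠ 0) (hy : ∀ i, y i ≠ 0)
    (hsum : Summable fun i => 1 / (y i) ^ 2) (N : ℝ) :
    HasSum (fun i => ∫ s in Ioi (0 : ℝ), osc N s / ((s : ℂ) + y i * ξ) ^ 3)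
      (∫ s in Ioi (0 : ℝ), ∑' i, osc N s / ((s : ℂ) + y i * ξ) ^ 3) ∧
    IntegrableOn (fun s : ℝ => ∑' i, osc N s / ((s : ℂ) + y i * ξ) ^ 3) (Ioi 0) := by
  obtain ⟨κ, hκ, H⟩ := exists_uniform_le_norm_add hξ
  have hξ0 : 0 < ‖ξ‖ := norm_pos_iff.2 (by rintro rfl; simp at hξ)
  have hm := fun i => mul_mem_slitPlane_of_im_ne_zero hξ (hy i)
  have hint := fun i => integrableOn_osc_div (hm i) N (show 2 ≤ 3 by norm_num)
  suffices hs : Summable fun i => ∫ s in Ioi (0 : ℝ), ‖osc N s / ((s : ℂ) + y i * ξ) ^ 3‖ by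
    refine ⟨hasSum_integral_of_summable_integral_norm hint hs,
      integrable_tsum_of_summable_integral_norm hint hs ?_⟩
    refine (ContinuousOn.mono ?_ Ioi_subset_Ici_self).aestronglyMeasurable measurableSet_Ioi
    refine continuousOn_tsum (u := fun i => 1 / (κ * ‖ξ‖) ^ 3 * (1 / |y i| ^ 3))
      (fun i => continuousOn_osc_div (hm i) N 3)
      ((summable_one_div_pow_three hsum hy).mul_left _) fun i v hv => ?_
    rw [div_eq_mul_one_div, norm_mul, norm_osc, one_mul]
    exact norm_one_div_pow_le hκ hξ H (hy i) hv 3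
  refine Summable.of_nonneg_of_le (fun i => integral_nonneg fun s => norm_nonneg _) (fun i => ?_)
    (hsum.mul_left (1 / (2 * κ ^ 3 * ‖ξ‖ ^ 2)))
  have h0 : 0 < ‖(y i : ℂ) * ξ‖ := norm_pos_iff.2 (Complex.slitPlane_ne_zero (hm i))
  refine (setIntegral_mono_on (hint i).norm ((integrableOn_one_div_add_pow h0
    (show 2 ≤ 3 by norm_num)).const_mul (1 / κ ^ 3)) measurableSet_Ioi fun s hs =>
      norm_osc_div_le hκ h0 (H (y i) (hy i)) N 3 (le_of_lt hs)).trans (le_of_eq ?_)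
  rw [integral_const_mul, integral_one_div_add_pow_three h0, norm_mul, Complex.norm_real,
    Real.norm_eq_abs, mul_pow, sq_abs]
  have := hy i
  field_simp

/-- Fourier integrals of `invSqSum` may be computed termwise. -/
lemma hasSum_oscInt [Countable ι] (hξ : ξ.im ≠ 0) (hy : ∀ i, y i ≠ 0)
    (hsum : Summable fun i => 1 / (y i) ^ 2) {N : ℝ} (hN : N ≠ 0)
    (hint : IntegrableOn (invSqSum y ξ) (Ioi 0)) (hlim : Tendsto (invSqSum y ξ) atTop (𝓝 0)) :
    HasSum (fun i => oscInt N (y i * ξ)) (∫ s in Ioi (0 : ℝ), osc N s * invSqSum y ξ s) := by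
  have hm := fun i => mul_mem_slitPlane_of_im_ne_zero hξ (hy i)
  have hsum3 := hasSum_integral_osc_div_cube hξ hy hsum N
  set V : ℝ → ℂ := fun s => ∑' i, osc N s / ((s : ℂ) + y i * ξ) ^ 3 with hV
  have hN' : (2 * Real.pi * Complex.I * N : ℂ) ≠ 0 := by
    simp [hN, Real.pi_ne_zero]
  have h0 : HasSum (fun i => 1 / ((y i : ℂ) * ξ) ^ 2) (invSqSum y ξ 0) := by
    have := (summable_invSq hξ hy hsum le_rfl).hasSum
    simpa [invSqSum] using this
  have h1 : HasSum (fun i => 2 * Real.pi * Complex.I * N * oscInt N (y i * ξ))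
      (2 * (∫ s in Ioi (0 : ℝ), V s) - invSqSum y ξ 0) := by
    refine ((hsum3.1.mul_left 2).sub h0).congr_fun fun i => ?_
    rw [integral_osc_div_cube (hm i)]
    ring
  have iU : IntegrableOn (fun s => osc N s * invSqSum y ξ s) (Ioi 0) :=
    hint.bdd_mul (c := 1) (continuous_osc N).aestronglyMeasurable
      (Eventually.of_forall fun s => (norm_osc _ _).le)
  have iV : IntegrableOn V (Ioi 0) := hsum3.2
  have hd : ∀ s ∈ Ioi (0 : ℝ), HasDerivAt (fun s => osc N s * invSqSum y ξ s)
      (2 * Real.pi * Complex.I * N * (osc N s * invSqSum y ξ s) - 2 * V s) s := by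
    intro s hs
    refine ((hasDerivAt_osc N s).mul (hasDerivAt_invSqSum hξ hy hsum hs)).congr_deriv ?_
    rw [tsum_mul_left]
    simp only [hV, div_eq_mul_one_div (osc N s), tsum_mul_left]
    ring
  have hc : ContinuousWithinAt (fun s => osc N s * invSqSum y ξ s) (Ici 0) 0 :=
    (continuous_osc N).continuousWithinAt.mul (continuousOn_invSqSum hξ hy hsum 0 self_mem_Ici)
  have hl : Tendsto (fun s => osc N s * invSqSum y ξ s) atTop (𝓝 0) := by
    rw [tendsto_zero_iff_norm_tendsto_zero] at hlim ⊢
    refine hlim.congr fun s => ?_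
    rw [norm_mul, norm_osc, one_mul]
  -- The integration by parts used for each term, now applied to the whole sum, identifies the total
  -- of the cubic integrals with the Fourier integral of `invSqSum`.
  have key := integral_Ioi_of_hasDerivAt_of_tendsto hc hd
    ((iU.const_mul (2 * Real.pi * Complex.I * N)).sub (iV.const_mul 2)) hl
  rw [integral_sub (iU.const_mul _) (iV.const_mul 2), integral_const_mul, integral_const_mul] at key
  have h2 : osc N 0 = 1 := by simp [osc]
  rw [h2] at key
  rw [show 2 * (∫ s in Ioi (0 : ℝ), V s) - invSqSum y ξ 0 = 2 * Real.pi * Complex.I * N *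
    ∫ s in Ioi (0 : ℝ), osc N s * invSqSum y ξ s by linear_combination -key] at h1
  exact (hasSum_mul_left_iff hN').1 h1

end Family

/-! ### Fourier expansion of periodized functions -/

lemma summable_div_one_add_sq (C : ℝ) : Summable fun j : ℕ => C / (1 + (j : ℝ)) ^ 2 := by
  have h := (summable_nat_add_iff 1).2 (Real.summable_one_div_nat_pow.2 (one_lt_two))
  refine (h.mul_left C).congr fun j => ?_
  push_cast
  rw [add_comm, mul_one_div]

lemma norm_shift_le {w : ℝ → ℂ} {C : ℝ} (hb : ∀ v, 0 ≤ v → ‖w v‖ ≤ C / (1 + v) ^ 2) (j : ℕ)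
    {a : ℝ} (ha : 0 ≤ a) : ‖w (a + j)‖ ≤ C / (1 + (j : ℝ)) ^ 2 := by
  have hC : 0 ≤ C := by have := (norm_nonneg _).trans (hb 0 le_rfl); simpa using this
  refine (hb _ (by positivity)).trans ?_
  gcongr
  linarith

lemma integrableOn_of_norm_le {w : ℝ → ℂ} {C : ℝ} (hc : ContinuousOn w (Ici 0))
    (hb : ∀ v, 0 ≤ v → ‖w v‖ ≤ C / (1 + v) ^ 2) : IntegrableOn w (Ioi 0) := by
  refine Integrable.mono' ((integrableOn_one_div_add_pow one_pos le_rfl).const_mul C)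
    ((hc.mono Ioi_subset_Ici_self).aestronglyMeasurable measurableSet_Ioi) ?_
  refine (ae_restrict_iff' measurableSet_Ioi).2 (Eventually.of_forall fun v hv => ?_)
  refine (hb v (le_of_lt hv)).trans (le_of_eq ?_)
  rw [mul_one_div, add_comm]

lemma continuousOn_tsum_shift {w : ℝ → ℂ} {C : ℝ} (hc : ContinuousOn w (Ici 0))
    (hb : ∀ v, 0 ≤ v → ‖w v‖ ≤ C / (1 + v) ^ 2) :
    ContinuousOn (fun a : ℝ => ∑' j : ℕ, w (a + j)) (Icc 0 1) := by
  refine continuousOn_tsum (u := fun j : ℕ => C / (1 + (j : ℝ)) ^ 2) (fun j => ?_)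
    (summable_div_one_add_sq C) fun j a ha => norm_shift_le hb j ha.1
  refine hc.comp (by fun_prop) fun a ha => ?_
  have : 0 ≤ a := ha.1
  exact mem_Ici.2 (by positivity)

/-- Unfolding: a periodization integrates over the unit interval to the integral over `(0, ∞)`. -/
lemma integral_tsum_shift {w : ℝ → ℂ} {C : ℝ} (hc : ContinuousOn w (Ici 0))
    (hb : ∀ v, 0 ≤ v → ‖w v‖ ≤ C / (1 + v) ^ 2) :
    ∫ a in (0 : ℝ)..1, ∑' j : ℕ, w (a + j) = ∫ v in Ioi (0 : ℝ), w v := by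
  have hcj : ∀ j : ℕ, ContinuousOn (fun a : ℝ => w (a + j)) (Icc 0 1) := fun j =>
    hc.comp (by fun_prop) fun a ha => mem_Ici.2 (by have : 0 ≤ a := ha.1; positivity)
  have hij : ∀ j : ℕ, IntegrableOn (fun a : ℝ => w (a + j)) (Ioc 0 1) := fun j =>
    (hcj j).integrableOn_Icc.mono_set Ioc_subset_Icc_self
  have hs : Summable fun j : ℕ => ∫ a in Ioc (0 : ℝ) 1, ‖w (a + j)‖ := by
    refine Summable.of_nonneg_of_le (fun j => integral_nonneg fun _ => norm_nonneg _) (fun j => ?_)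
      (summable_div_one_add_sq C)
    refine (setIntegral_mono_on (hij j).norm (integrable_const _) measurableSet_Ioc
      fun a ha => norm_shift_le hb j ha.1.le).trans (le_of_eq ?_)
    simp
  have h1 := hasSum_integral_of_summable_integral_norm hij hs
  rw [intervalIntegral.integral_of_le zero_le_one]
  refine tendsto_nhds_unique h1.tendsto_sum_nat ?_
  have h2 := intervalIntegral_tendsto_integral_Ioi 0 (integrableOn_of_norm_le hc hb)
    (tendsto_natCast_atTop_atTop (R := ℝ))
  refine h2.congr fun n => ?_
  have h3 : ∀ k < n, IntervalIntegrable w volume ((k : ℕ) : ℝ) ((k + 1 : ℕ) : ℝ) := by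
    intro k _
    refine ContinuousOn.intervalIntegrable (hc.mono fun x hx => ?_)
    rw [uIcc_of_le (by push_cast; linarith)] at hx
    exact mem_Ici.2 ((Nat.cast_nonneg k).trans hx.1)
  have h4 := intervalIntegral.sum_integral_adjacent_intervals h3
  rw [Nat.cast_zero] at h4
  rw [← h4]
  refine Finset.sum_congr rfl fun k _ => ?_
  rw [← intervalIntegral.integral_of_le zero_le_one,
    intervalIntegral.integral_comp_add_right w (k : ℝ)]
  push_cast
  rw [zero_add, add_comm]

lemma osc_add_nat (n : ℤ) (a : ℝ) (j : ℕ) : osc n (a + j) = osc n a := by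
  rw [osc, osc, Complex.exp_eq_exp_iff_exists_int]
  refine ⟨n * j, ?_⟩
  push_cast
  ring

lemma fourier_coe_eq_osc (n : ℤ) (a : ℝ) : fourier n (a : AddCircle (1 - 0 : ℝ)) = osc n a := by
  rw [fourier_coe_apply, osc]
  congr 1
  push_cast
  ring

lemma fourierCoeffOn_eq_osc (g : ℝ → ℂ) (n : ℤ) :
    fourierCoeffOn (zero_lt_one (α := ℝ)) g n = ∫ a in (0 : ℝ)..1, osc (-n) a * g a := by
  rw [fourierCoeffOn_eq_integral]
  simp only [fourier_coe_eq_osc, smul_eq_mul]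
  simp

lemma integral_osc_int {n : ℤ} (hn : n ≠ 0) : ∫ a in (0 : ℝ)..1, osc (-n) a = 0 := by
  have hc : (2 * Real.pi * Complex.I * ((-n : ℝ) : ℂ)) ≠ 0 := by
    have : (n : ℂ) ≠ 0 := by exact_mod_cast hn
    simp [this, Real.pi_ne_zero]
  have h := integral_exp_mul_complex (a := 0) (b := 1) hc
  have e : ∫ a in (0 : ℝ)..1, osc (-n) a = ∫ a in (0 : ℝ)..1,
      Complex.exp (2 * Real.pi * Complex.I * ((-n : ℝ) : ℂ) * a) := rfl
  have h1 := osc_add_nat (-n) 0 1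
  simp only [Int.cast_neg, osc, Nat.cast_one, zero_add] at h1
  rw [e, h, h1, sub_self, zero_div]

/-- Fourier expansion of a function on the unit interval whose derivative is a periodization. -/
lemma hasSum_fourier_of_hasDerivAt_tsum {G u : ℝ → ℂ} {C : ℝ} (hG : ContinuousOn G (Icc 0 1))
    (hu : ContinuousOn u (Ici 0)) (hb : ∀ v, 0 ≤ v → ‖u v‖ ≤ C / (1 + v) ^ 2)
    (hd : ∀ a ∈ Ioo (0 : ℝ) 1, HasDerivAt G (∑' j : ℕ, u (a + j)) a) {c : ℤ → ℂ}
    (h0 : c 0 = ∫ a in (0 : ℝ)..1, G a)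
    (hc : ∀ n : ℤ, n ≠ 0 →
      c n = 1 / (2 * Real.pi * Complex.I * n) * ∫ v in Ioi (0 : ℝ), osc (-n) v * u v)
    (hs : Summable c) {a : ℝ} (ha : a ∈ Icc (0 : ℝ) 1) :
    HasSum (fun n : ℤ => c n * osc n a) (G a - (G 1 - G 0) * (a - 1 / 2)) := by
  set D := G 1 - G 0 with hD
  -- This subtraction equalizes the end values, so `H` descends to a continuous function on the
  -- circle. The factor a - 1/2 has mean zero, and its constant derivative is orthogonal to every
  -- nonzero frequency.
  set H : ℝ → ℂ := fun a => G a - D * (a - 1 / 2) with hH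
  have hHc : ContinuousOn H (Icc 0 1) := hG.sub (by fun_prop)
  have hHd : ∀ a ∈ Ioo (0 : ℝ) 1, HasDerivAt H (∑' j : ℕ, u (a + j) - D) a := by
    intro a ha
    have h1 : HasDerivAt (fun a : ℝ => D * ((a : ℂ) - 1 / 2)) (D * 1) a :=
      ((hasDerivAt_id a).ofReal_comp.sub_const _).const_mul D
    refine ((hd a ha).sub h1).congr_deriv (by rw [mul_one])
  have hHp : H 0 = H (0 + 1) := by
    simp only [hH, hD]
    norm_num
    ring
  have : Fact (0 < (1 : ℝ)) := ⟨one_pos⟩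
  have hcj : ContinuousOn (fun a : ℝ => ∑' j : ℕ, u (a + j)) (Icc 0 1) := continuousOn_tsum_shift hu hb
  have hii : IntervalIntegrable (fun a : ℝ => ∑' j : ℕ, u (a + j)) volume 0 1 :=
    ContinuousOn.intervalIntegrable (by rwa [uIcc_of_le zero_le_one])
  have hHi : IntervalIntegrable (fun a : ℝ => ∑' j : ℕ, u (a + j) - D) volume 0 1 :=
    hii.sub intervalIntegrable_const
  have hcoef : ∀ n : ℤ, fourierCoeffOn (zero_lt_one (α := ℝ)) H n = c n := by
    intro n
    rcases eq_or_ne n 0 with rfl | hn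
    · rw [fourierCoeffOn_eq_osc, h0]
      have h1 : ∀ a : ℝ, osc (-(0 : ℤ)) a = 1 := by intro a; simp [osc]
      simp only [h1, one_mul, hH]
      rw [intervalIntegral.integral_sub
        (ContinuousOn.intervalIntegrable (by rwa [uIcc_of_le zero_le_one]))
        (Continuous.intervalIntegrable (by fun_prop) _ _), sub_eq_self,
        intervalIntegral.integral_const_mul, intervalIntegral.integral_sub
        (Continuous.intervalIntegrable (by fun_prop) _ _) intervalIntegrable_const,
        intervalIntegral.integral_ofReal, integral_id]
      simp
    · rw [fourierCoeffOn_of_hasDerivAt_Ioo zero_lt_one hn (by rwa [uIcc_of_le zero_le_one])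
        (by simpa using hHd) hHi, hc n hn, fourierCoeffOn_eq_osc]
      have h1 : H 1 - H 0 = 0 := by rw [hHp, zero_add, sub_self]
      -- The exponential has period 1, so it can be moved inside the sum over j and the integral
      -- unfolds to (0, ∞).
      have h2 : ∫ a in (0 : ℝ)..1, osc (-n) a * (∑' j : ℕ, u (a + j) - D)
          = ∫ v in Ioi (0 : ℝ), osc (-n) v * u v := by
        rw [← integral_tsum_shift (w := fun v => osc (-n) v * u v) (C := C)
          ((continuous_osc _).continuousOn.mul hu) (fun v hv => by
            rw [norm_mul, norm_osc, one_mul]; exact hb v hv)]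
        have h3 : ∀ a : ℝ, ∑' j : ℕ, osc (-n) (a + j) * u (a + j)
            = osc (-n) a * ∑' j : ℕ, u (a + j) := by
          intro a
          rw [← tsum_mul_left]
          refine tsum_congr fun j => ?_
          have := osc_add_nat (-n) a j
          push_cast at this
          rw [this]
        simp only [h3, mul_sub]
        rw [intervalIntegral.integral_sub, intervalIntegral.integral_mul_const,
          integral_osc_int hn, zero_mul, sub_zero]
        · exact hii.continuousOn_mul (continuous_osc _).continuousOn
        · exact ((continuous_osc _).mul continuous_const).intervalIntegrable _ _
      rw [h1, h2]
      have hn' : (n : ℂ) ≠ 0 := by exact_mod_cast hn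
      have hpi : (Real.pi : ℂ) ≠ 0 := by exact_mod_cast Real.pi_ne_zero
      have hI := Complex.I_ne_zero
      push_cast
      field_simp
      ring
  let Hc : C(AddCircle (1 : ℝ), ℂ) := ⟨AddCircle.liftIco 1 0 H,
    AddCircle.liftIco_continuous hHp (by simpa using hHc)⟩
  have hcoef' : ∀ n : ℤ, fourierCoeff Hc n = c n := by
    intro n
    have := fourierCoeff_liftIco_eq (T := (1 : ℝ)) (a := 0) H n
    rw [← hcoef n]
    refine this.trans ?_
    simp only [fourierCoeffOn_eq_integral]
    simp
  have hsum := has_pointwise_sum_fourier_series_of_summable (f := Hc)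
    (by rwa [funext hcoef']) (a : AddCircle (1 : ℝ))
  have hval : Hc (a : AddCircle (1 : ℝ)) = H a := by
    change AddCircle.liftIco 1 0 H (a : AddCircle (1 : ℝ)) = H a
    -- `AddCircle.liftIco` reads off values on [0, 1), so a = 1 goes through periodicity; this
    -- endpoint does occur later.
    rcases eq_or_lt_of_le ha.2 with rfl | h1
    · have e : ((1 : ℝ) : AddCircle (1 : ℝ)) = ((0 : ℝ) : AddCircle (1 : ℝ)) := by
        simp [AddCircle.coe_period]
      rw [e]
      refine (AddCircle.liftIco_coe_apply (f := H) (p := 1) (a := 0) (x := 0) (by simp)).trans ?_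
      rw [hHp, zero_add]
    · exact AddCircle.liftIco_coe_apply ⟨ha.1, by simpa using h1⟩
  rw [hval] at hsum
  refine hsum.congr_fun fun n => ?_
  rw [hcoef', smul_eq_mul, fourier_coe_apply, osc]
  congr 2
  push_cast
  ring

/-- Scaling reduces an integral frequency to ±1, the case in which the estimates and evaluations of
`oscInt` and `oscSide` are stated. -/
lemma oscInt_int {N : ℤ} (hN : N ≠ 0) (X : ℂ) :
    oscInt N X = |(N : ℝ)| * oscInt (N.sign : ℝ) (|(N : ℝ)| * X) := by
  have hb : 0 < |(N : ℝ)| := abs_pos.2 (by exact_mod_cast hN)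
  have h := integral_comp_mul_left_Ioi
    (fun s : ℝ => osc (N.sign : ℝ) s / ((s : ℂ) + |(N : ℝ)| * X) ^ 2) 0 hb
  rw [mul_zero] at h
  change _ = |(N : ℝ)|⁻¹ • oscInt _ _ at h
  have hbc : ((|(N : ℝ)| : ℝ) : ℂ) ≠ 0 := by exact_mod_cast hb.ne'
  have h1 : oscInt N X = |(N : ℝ)| ^ 2 * ∫ v in Ioi (0 : ℝ),
      osc (N.sign : ℝ) (|(N : ℝ)| * v) / (((|(N : ℝ)| * v : ℝ) : ℂ) + |(N : ℝ)| * X) ^ 2 := by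
    rw [oscInt, ← integral_const_mul]
    refine integral_congr_ae (Eventually.of_forall fun v => ?_)
    have h2 : osc (N.sign : ℝ) (|(N : ℝ)| * v) = osc N v := by
      have h3 : (N.sign : ℝ) * |(N : ℝ)| = N := by
        exact_mod_cast Int.sign_mul_abs N
      have h4 : ((N.sign : ℝ) : ℂ) * (|(N : ℝ)| : ℝ) = (N : ℝ) := by exact_mod_cast h3
      rw [osc, osc]
      congr 1
      rw [Complex.ofReal_mul]
      linear_combination (2 * Real.pi * Complex.I * v) * h4
    beta_reduce
    rw [h2, show ((|(N : ℝ)| * v : ℝ) : ℂ) + |(N : ℝ)| * X = |(N : ℝ)| * (v + X) by push_cast; ring,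
      mul_pow, ← mul_div_assoc, mul_div_mul_left _ _ (pow_ne_zero 2 hbc)]
  rw [h1, h, Complex.real_smul]
  push_cast
  field_simp

/-! ### The digamma function on the positive real axis -/

/-- Monotone solutions of `f (x + 1) = f x + 1 / x` differ by a constant on unit intervals. -/
lemma sub_eq_sub_of_monotoneOn {f g : ℝ → ℝ} (hf : MonotoneOn f (Ioi 0)) (hg : MonotoneOn g (Ioi 0))
    (hf1 : ∀ x, 0 < x → f (x + 1) = f x + 1 / x) (hg1 : ∀ x, 0 < x → g (x + 1) = g x + 1 / x)
    {x y : ℝ} (hx : 0 < x) (hxy : x ≤ y) (hyx : y ≤ x + 1) : f y - g y = f x - g x := by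
  have hp : ∀ x, 0 < x → ∀ n : ℕ, f (x + n) - g (x + n) = f x - g x := by
    intro x hx n
    induction n with
    | zero => simp
    | succ n ih =>
      have h0 : 0 < x + n := by positivity
      push_cast
      rw [← add_assoc, hf1 _ h0, hg1 _ h0, ← ih]
      ring
  -- Since y + n lies between x + n and x + n + 1, monotonicity confines both increments to [0, 1/(x
  -- + n)]; by periodicity of f - g the shift n is free.
  have hbd : ∀ n : ℕ, |(f y - g y) - (f x - g x)| ≤ 1 / (x + n) := by
    intro n
    have h0 : 0 < x + n := by positivity
    have h1 : 0 < y + n := by linarith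
    have hb : ∀ {f : ℝ → ℝ}, MonotoneOn f (Ioi 0) → (∀ x, 0 < x → f (x + 1) = f x + 1 / x) →
        0 ≤ f (y + n) - f (x + n) ∧ f (y + n) - f (x + n) ≤ 1 / (x + n) := by
      intro f hf hf1
      have h2 := hf (a := x + n) (b := y + n) h0 h1 (by linarith)
      have h3 := hf (a := y + n) (b := x + n + 1) h1 (by positivity : 0 < x + n + 1) (by linarith)
      rw [hf1 _ h0] at h3
      constructor <;> linarith
    rw [← hp y (by linarith) n, ← hp x hx n, abs_le]
    have h4 := hb hf hf1
    have h5 := hb hg hg1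
    constructor <;> linarith
  have hl : Tendsto (fun n : ℕ => 1 / (x + (n : ℝ))) atTop (𝓝 0) :=
    tendsto_const_nhds.div_atTop (tendsto_atTop_add_const_left _ _ tendsto_natCast_atTop_atTop)
  have := ge_of_tendsto' hl hbd
  exact sub_eq_zero.1 (abs_nonpos_iff.1 this)

lemma summable_one_div_add_nat_sq {x : ℝ} (hx : 0 < x) :
    Summable fun j : ℕ => 1 / (x + j) ^ 2 := by
  have h := (Real.summable_one_div_nat_add_rpow x 2).2 one_lt_two
  refine h.congr fun j => ?_
  rw [abs_of_pos (by positivity), Real.rpow_two, add_comm]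

lemma hasDerivAt_tsum_one_div {x : ℝ} (hx : 0 < x) :
    HasDerivAt (fun x : ℝ => ∑' j : ℕ, (1 / ((j : ℝ) + 1) - 1 / (x + j)))
      (∑' j : ℕ, 1 / (x + j) ^ 2) x ∧ Summable fun j : ℕ => (1 / ((j : ℝ) + 1) - 1 / (x + j)) := by
  have hd : ∀ (j : ℕ), ∀ y ∈ Ioi (min x 1 / 2),
      HasDerivAt (fun y : ℝ => 1 / ((j : ℝ) + 1) - 1 / (y + j)) (1 / (y + j) ^ 2) y := by
    intro j y hy
    have : min x 1 / 2 < y := hy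
    have hy0 : 0 < y := lt_trans (by positivity) this
    have h1 : HasDerivAt (fun y : ℝ => y + j) 1 y := (hasDerivAt_id y).add_const _
    refine ((hasDerivAt_const y (1 / ((j : ℝ) + 1))).sub
      ((hasDerivAt_const y (1 : ℝ)).div h1 (by positivity))).congr_deriv ?_
    field_simp
    ring
  have hb : ∀ (j : ℕ), ∀ y ∈ Ioi (min x 1 / 2), ‖1 / (y + j) ^ 2‖ ≤ 1 / (min x 1 / 2 + j) ^ 2 := by
    intro j y hy
    have : min x 1 / 2 < y := hy
    have h0 : 0 < min x 1 / 2 := by positivity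
    have hy0 : 0 < y := lt_trans h0 this
    rw [Real.norm_of_nonneg (by positivity)]
    gcongr
  have h1 : (1 : ℝ) ∈ Ioi (min x 1 / 2) := by
    have := min_le_right x 1
    exact mem_Ioi.2 (by linarith)
  have hxm : x ∈ Ioi (min x 1 / 2) := by
    have := min_le_left x 1
    exact mem_Ioi.2 (by linarith)
  -- At the base point 1 every term vanishes. Convergence there and a summable bound for the
  -- derivatives give convergence throughout.
  have hs1 : Summable fun j : ℕ => (1 / ((j : ℝ) + 1) - 1 / ((1 : ℝ) + j)) := by
    refine summable_zero.congr fun j => ?_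
    rw [add_comm, sub_self]
  have hu := summable_one_div_add_nat_sq (x := min x 1 / 2) (by positivity)
  have k1 := hasDerivAt_tsum_of_isPreconnected
    (g := fun (j : ℕ) (y : ℝ) => 1 / ((j : ℝ) + 1) - 1 / (y + j))
    (g' := fun (j : ℕ) (y : ℝ) => 1 / (y + j) ^ 2) hu isOpen_Ioi isPreconnected_Ioi hd hb h1 hs1 hxm
  have k2 := summable_of_summable_hasDerivAt_of_isPreconnected
    (g := fun (j : ℕ) (y : ℝ) => 1 / ((j : ℝ) + 1) - 1 / (y + j))
    (g' := fun (j : ℕ) (y : ℝ) => 1 / (y + j) ^ 2) hu isOpen_Ioi isPreconnected_Ioi hd hb h1 hs1 hxm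
  exact ⟨k1, k2⟩

lemma differentiableAt_log_Gamma {x : ℝ} (hx : 0 < x) :
    DifferentiableAt ℝ (Real.log ∘ Real.Gamma) x :=
  (Real.differentiableAt_log (Real.Gamma_pos_of_pos hx).ne').comp x
    (Real.differentiableAt_Gamma fun m => by
      have : (0 : ℝ) ≤ m := Nat.cast_nonneg m
      linarith)

lemma digamma_ofReal {x : ℝ} (hx : 0 < x) :
    Complex.digamma x = ((deriv (Real.log ∘ Real.Gamma) x : ℝ) : ℂ) := by
  have hne : ∀ m : ℕ, x ≠ -m := fun m => by
    have : (0 : ℝ) ≤ m := Nat.cast_nonneg m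
    linarith
  have h1 := (Real.differentiableAt_Gamma hne).hasDerivAt
  have h2 : HasDerivAt Complex.Gamma (deriv Complex.Gamma x) x :=
    (Complex.differentiableAt_Gamma _ fun m => by exact_mod_cast hne m).hasDerivAt
  have h3 := h2.comp_ofReal
  simp only [Complex.Gamma_ofReal] at h3
  have h4 := h3.unique h1.ofReal_comp
  have h5 : deriv (Real.log ∘ Real.Gamma) x = deriv Real.Gamma x / Real.Gamma x :=
    (h1.log (Real.Gamma_pos_of_pos hx).ne').deriv
  rw [Complex.digamma_def, logDeriv_apply, h4, Complex.Gamma_ofReal, h5, Complex.ofReal_div]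

lemma deriv_log_Gamma_add_one {x : ℝ} (hx : 0 < x) :
    deriv (Real.log ∘ Real.Gamma) (x + 1) = deriv (Real.log ∘ Real.Gamma) x + 1 / x := by
  have h := Complex.digamma_apply_add_one (x : ℂ) fun m h => by
    have h1 : x = -m := by exact_mod_cast h
    have : (0 : ℝ) ≤ m := Nat.cast_nonneg m
    linarith
  have h2 := digamma_ofReal (x := x + 1) (by linarith)
  push_cast at h2
  rw [h2, digamma_ofReal hx] at h
  rw [one_div]
  exact_mod_cast h

lemma tsum_one_div_add_one {x : ℝ} (hx : 0 < x) :
    ∑' j : ℕ, (1 / ((j : ℝ) + 1) - 1 / (x + 1 + j))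
      = ∑' j : ℕ, (1 / ((j : ℝ) + 1) - 1 / (x + j)) + 1 / x := by
  have h1 := (hasDerivAt_tsum_one_div hx).2.hasSum.tendsto_sum_nat
  have h2 := (hasDerivAt_tsum_one_div (x := x + 1) (by linarith)).2.hasSum.tendsto_sum_nat
  refine tendsto_nhds_unique h2 ?_
  have hl : Tendsto (fun n : ℕ => 1 / (x + (n : ℝ))) atTop (𝓝 0) :=
    tendsto_const_nhds.div_atTop (tendsto_atTop_add_const_left _ _ tendsto_natCast_atTop_atTop)
  have h3 := (h1.add_const (1 / x)).sub hl
  rw [sub_zero] at h3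
  refine h3.congr fun n => ?_
  induction n with
  | zero => simp
  | succ n ih =>
    rw [Finset.sum_range_succ, Finset.sum_range_succ, ← ih]
    push_cast
    rw [add_assoc x 1, add_comm (1 : ℝ)]
    ring

/-- The derivative of the digamma function. -/
lemma hasDerivAt_digamma {x : ℝ} (hx : 0 < x) :
    HasDerivAt (fun x : ℝ => Complex.digamma x) (∑' j : ℕ, 1 / ((x : ℂ) + j) ^ 2) x := by
  set S : ℝ → ℝ := fun x => ∑' j : ℕ, (1 / ((j : ℝ) + 1) - 1 / (x + j)) with hS
  set f : ℝ → ℝ := deriv (Real.log ∘ Real.Gamma) with hf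
  -- Convexity of log Γ, as in the Bohr–Mollerup theorem.
  have hfm : MonotoneOn f (Ioi 0) :=
    Real.convexOn_log_Gamma.monotoneOn_deriv fun x hx => differentiableAt_log_Gamma hx
  have hSm : MonotoneOn S (Ioi 0) := by
    intro a ha b hb hab
    have ha' : (0 : ℝ) < a := ha
    refine (hasDerivAt_tsum_one_div ha).2.tsum_le_tsum (fun j => ?_) (hasDerivAt_tsum_one_div hb).2
    gcongr
  -- The unit interval starting at this positive point contains x in its interior, and there the
  -- digamma function and its series differ by a constant.
  set x₀ := x - min x 1 / 2 with hx₀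
  have hm1 := min_le_left x 1
  have hm2 := min_le_right x 1
  have hm3 : 0 < min x 1 := by positivity
  have heq : ∀ y ∈ Icc x₀ (x₀ + 1), f y = S y + (f x₀ - S x₀) := by
    intro y hy
    have := sub_eq_sub_of_monotoneOn hfm hSm (fun x hx => deriv_log_Gamma_add_one hx)
      (fun x hx => tsum_one_div_add_one hx) (x := x₀) (y := y) (by linarith) hy.1 hy.2
    linarith
  have hnb : Icc x₀ (x₀ + 1) ∩ Ioi 0 ∈ 𝓝 x :=
    inter_mem (Icc_mem_nhds (by linarith) (by linarith)) (Ioi_mem_nhds hx)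
  have h1 := ((hasDerivAt_tsum_one_div hx).1.add_const (f x₀ - S x₀)).ofReal_comp
  have h2 : ((∑' j : ℕ, 1 / (x + j) ^ 2 : ℝ) : ℂ) = ∑' j : ℕ, 1 / ((x : ℂ) + j) ^ 2 := by
    rw [Complex.ofReal_tsum]
    exact tsum_congr fun j => by push_cast; rfl
  rw [h2] at h1
  refine h1.congr_of_eventuallyEq ?_
  filter_upwards [hnb] with y hy
  rw [digamma_ofReal hy.2, ← heq y hy.1]

/-- The primitive log Γ(a + 1) vanishes at both ends, so the digamma correction does not affect the
mean value in `lambertSum_eq`. -/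
lemma integral_digamma : ∫ a in (0 : ℝ)..1, Complex.digamma ((a : ℂ) + 1) = 0 := by
  have hd : ∀ a ∈ uIcc (0 : ℝ) 1, HasDerivAt
      (fun a : ℝ => (((Real.log ∘ Real.Gamma) (a + 1) : ℝ) : ℂ)) (Complex.digamma ((a : ℂ) + 1)) a := by
    intro a ha
    rw [uIcc_of_le zero_le_one] at ha
    have h0 : 0 < a + 1 := by linarith [ha.1]
    have h1 := (differentiableAt_log_Gamma h0).hasDerivAt
    have h2 := (h1.comp_add_const a 1).ofReal_comp
    rw [← digamma_ofReal h0] at h2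
    push_cast at h2
    exact h2
  have hc : ContinuousOn (fun a : ℝ => Complex.digamma ((a : ℂ) + 1)) (uIcc 0 1) := by
    intro a ha
    rw [uIcc_of_le zero_le_one] at ha
    have h := (hasDerivAt_digamma (x := a + 1) (by linarith [ha.1])).comp_add_const a 1
    have h1 := h.continuousAt.continuousWithinAt (s := uIcc 0 1)
    simpa using h1
  rw [intervalIntegral.integral_eq_sub_of_hasDerivAt hd hc.intervalIntegrable]
  have h2 : Real.Gamma (1 + 1) = 1 := by
    rw [Real.Gamma_add_one one_ne_zero, Real.Gamma_one, mul_one]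
  simp only [Function.comp_apply, h2, zero_add, Real.Gamma_one, Real.log_one, sub_self]

/-! ### The Lambert kernel -/

/-- The exponential `e^{2πiθ - vt}`. -/
def kernelExp (θ : ℝ) (t : ℂ) (v : ℝ) : ℂ := Complex.exp (2 * Real.pi * Complex.I * θ - v * t)

/-- The Lambert kernel `e^{2πiθ - vt} / (1 - e^{2πiθ - vt})`. -/
def lambert (θ : ℝ) (t : ℂ) (v : ℝ) : ℂ := kernelExp θ t v / (1 - kernelExp θ t v)

lemma norm_kernelExp (θ : ℝ) (t : ℂ) (v : ℝ) : ‖kernelExp θ t v‖ = Real.exp (-(v * t.re)) := by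
  rw [kernelExp, Complex.norm_exp]
  simp

lemma norm_kernelExp_lt_one (θ : ℝ) {t : ℂ} (ht : 0 < t.re) {v : ℝ} (hv : 0 < v) :
    ‖kernelExp θ t v‖ < 1 := by
  rw [norm_kernelExp]
  exact Real.exp_lt_one_iff.2 (by have := mul_pos hv ht; linarith)

lemma one_sub_kernelExp_ne_zero (θ : ℝ) {t : ℂ} (ht : 0 < t.re) {v : ℝ} (hv : 0 < v) :
    1 - kernelExp θ t v ≠ 0 := by
  intro h
  have h1 := norm_kernelExp_lt_one θ ht hv
  rw [← sub_eq_zero.1 h, norm_one] at h1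
  exact lt_irrefl _ h1

lemma hasDerivAt_kernelExp (θ : ℝ) (t : ℂ) (v : ℝ) :
    HasDerivAt (kernelExp θ t) (-t * kernelExp θ t v) v := by
  have h : HasDerivAt (fun v : ℝ => 2 * Real.pi * Complex.I * θ - v * t) (-(1 * t)) v :=
    ((hasDerivAt_id v).ofReal_comp.mul_const t).const_sub _
  refine h.cexp.congr_deriv ?_
  rw [kernelExp]
  ring

lemma hasDerivAt_lambert (θ : ℝ) {t : ℂ} (ht : 0 < t.re) {v : ℝ} (hv : 0 < v) :
    HasDerivAt (lambert θ t) (-t * (kernelExp θ t v / (1 - kernelExp θ t v) ^ 2)) v := by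
  have hne := one_sub_kernelExp_ne_zero θ ht hv
  have h := hasDerivAt_kernelExp θ t v
  refine (h.div (h.const_sub 1) hne).congr_deriv ?_
  field_simp
  ring

lemma hasDerivAt_log_one_sub_kernelExp (θ : ℝ) {t : ℂ} (ht : 0 < t.re) {v : ℝ} (hv : 0 < v) :
    HasDerivAt (fun v => Complex.log (1 - kernelExp θ t v) / t) (lambert θ t v) v := by
  have ht0 : t ≠ 0 := by rintro rfl; simp at ht
  have h := (hasDerivAt_kernelExp θ t v).const_sub 1
  have hm : 1 - kernelExp θ t v ∈ Complex.slitPlane :=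
    Complex.mem_slitPlane_of_norm_lt_one (z := -kernelExp θ t v)
      (by rw [norm_neg]; exact norm_kernelExp_lt_one θ ht hv)
  refine ((h.clog_real hm).div_const t).congr_deriv ?_
  rw [lambert]
  field_simp

lemma norm_one_sub_kernelExp_ge (θ : ℝ) {t : ℂ} (ht : 0 < t.re) {v b : ℝ} (hv : b ≤ v) :
    1 - Real.exp (-(b * t.re)) ≤ ‖1 - kernelExp θ t v‖ := by
  have h1 := norm_sub_norm_le 1 (kernelExp θ t v)
  rw [norm_one, norm_kernelExp] at h1
  have h2 : Real.exp (-(v * t.re)) ≤ Real.exp (-(b * t.re)) := by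
    apply Real.exp_le_exp.2
    nlinarith
  linarith

lemma norm_kernelExp_div_le (θ : ℝ) {t : ℂ} (ht : 0 < t.re) {v b : ℝ} (hb : 0 < b) (hv : b ≤ v)
    (n : ℕ) : ‖kernelExp θ t v / (1 - kernelExp θ t v) ^ n‖
      ≤ Real.exp (-(v * t.re)) / (1 - Real.exp (-(b * t.re))) ^ n := by
  have h0 : 0 < 1 - Real.exp (-(b * t.re)) := by
    have : Real.exp (-(b * t.re)) < 1 := Real.exp_lt_one_iff.2 (by have := mul_pos hb ht; linarith)
    linarith
  have h1 := norm_one_sub_kernelExp_ge θ ht hv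
  rw [norm_div, norm_pow, norm_kernelExp]
  gcongr

lemma summable_exp_shift {ρ : ℝ} (hρ : 0 < ρ) (b : ℝ) :
    Summable fun j : ℕ => Real.exp (-((b + j) * ρ)) := by
  have h : Summable fun j : ℕ => Real.exp (-(b * ρ)) * Real.exp (-ρ) ^ j :=
    (summable_geometric_of_lt_one (Real.exp_pos _).le (Real.exp_lt_one_iff.2 (by linarith))).mul_left _
  refine h.congr fun j => ?_
  rw [← Real.exp_nat_mul, ← Real.exp_add]
  congr 1
  ring

lemma summable_lambert (θ : ℝ) {t : ℂ} (ht : 0 < t.re) {b : ℝ} (hb : 0 < b) :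
    Summable fun j : ℕ => lambert θ t (b + j) := by
  refine Summable.of_norm_bounded
    ((summable_exp_shift ht b).div_const ((1 - Real.exp (-(b * t.re))) ^ 1)) fun j => ?_
  have := norm_kernelExp_div_le θ ht (v := b + j) hb
    (by have : (0 : ℝ) ≤ j := Nat.cast_nonneg j; linarith) 1
  rwa [pow_one] at this

/-- The series `∑_{j ≥ 0}` of the Lambert kernel along `b + j`. -/
def lambertSum (θ : ℝ) (t : ℂ) (b : ℝ) : ℂ := ∑' j : ℕ, lambert θ t (b + j)

lemma lambertSum_eq_add (θ : ℝ) {t : ℂ} (ht : 0 < t.re) {b : ℝ} (hb : 0 < b) :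
    lambertSum θ t b = lambert θ t b + lambertSum θ t (b + 1) := by
  rw [lambertSum, (summable_lambert θ ht hb).tsum_eq_zero_add, lambertSum]
  congr 1
  · simp
  · refine tsum_congr fun j => ?_
    push_cast
    congr 1
    ring

lemma summable_deriv_lambert (θ : ℝ) {t : ℂ} (ht : 0 < t.re) {b : ℝ} (hb : 0 < b) :
    Summable fun j : ℕ => -t * (kernelExp θ t (b + j) / (1 - kernelExp θ t (b + j)) ^ 2) := by
  refine Summable.mul_left _ (Summable.of_norm_bounded
    ((summable_exp_shift ht b).div_const ((1 - Real.exp (-(b * t.re))) ^ 2)) fun j => ?_)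
  exact norm_kernelExp_div_le θ ht (v := b + j) hb
    (by have : (0 : ℝ) ≤ j := Nat.cast_nonneg j; linarith) 2

lemma hasDerivAt_lambertSum (θ : ℝ) {t : ℂ} (ht : 0 < t.re) {b : ℝ} (hb : 0 < b) :
    HasDerivAt (lambertSum θ t)
      (∑' j : ℕ, -t * (kernelExp θ t (b + j) / (1 - kernelExp θ t (b + j)) ^ 2)) b := by
  refine hasDerivAt_tsum_of_isPreconnected (t := Ioi (b / 2)) (y₀ := b)
    (g := fun (j : ℕ) (v : ℝ) => lambert θ t (v + j))
    (g' := fun (j : ℕ) (v : ℝ) => -t * (kernelExp θ t (v + j) / (1 - kernelExp θ t (v + j)) ^ 2))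
    (u := fun j : ℕ =>
      ‖t‖ * (Real.exp (-((b / 2 + j) * t.re)) / (1 - Real.exp (-(b / 2 * t.re))) ^ 2))
    (((summable_exp_shift ht (b / 2)).div_const _).mul_left _) isOpen_Ioi isPreconnected_Ioi
    (fun j v hv => ?_) (fun j v hv => ?_) (mem_Ioi.2 (by linarith)) (summable_lambert θ ht hb)
    (mem_Ioi.2 (by linarith))
  · have hv' : b / 2 < v := hv
    exact (hasDerivAt_lambert θ ht (v := v + j) (by positivity [show 0 < v by linarith])).comp_add_const v j
  · have hv' : b / 2 < v := hv
    have hj : (0 : ℝ) ≤ j := Nat.cast_nonneg j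
    rw [norm_mul, norm_neg]
    refine mul_le_mul_of_nonneg_left ((norm_kernelExp_div_le θ ht (v := v + j) (b := b / 2)
      (by linarith) (by linarith) 2).trans ?_) (norm_nonneg _)
    have : Real.exp (-((v + j) * t.re)) ≤ Real.exp (-((b / 2 + j) * t.re)) := by
      apply Real.exp_le_exp.2
      nlinarith
    gcongr

lemma exp_neg_le_div_sq {x : ℝ} (hx : 0 < x) : Real.exp (-x) ≤ 2 / x ^ 2 := by
  have h := Real.quadratic_le_exp_of_nonneg hx.le
  rw [Real.exp_neg, ← one_div, div_le_div_iff₀ (Real.exp_pos _) (by positivity)]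
  linarith

/-- Unfolding gives the integral of the kernel over (1, ∞), and log(1 - E)/t is a primitive that
vanishes at infinity. -/
lemma integral_lambertSum (θ : ℝ) {t : ℂ} (ht : 0 < t.re) :
    ∫ a in (0 : ℝ)..1, lambertSum θ t (a + 1) = -(Complex.log (1 - kernelExp θ t 1) / t) := by
  have hcont : ContinuousOn (fun v => lambert θ t (v + 1)) (Ici 0) := fun v hv => by
    have hv' : (0 : ℝ) ≤ v := hv
    exact ((hasDerivAt_lambert θ ht (v := v + 1) (by linarith)).comp_add_const
      v 1).continuousAt.continuousWithinAt
  have hbd : ∀ v, 0 ≤ v → ‖lambert θ t (v + 1)‖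
      ≤ (2 / t.re ^ 2 / (1 - Real.exp (-(1 * t.re))) ^ 1) / (1 + v) ^ 2 := by
    intro v hv
    have h := norm_kernelExp_div_le θ ht (v := v + 1) one_pos (by linarith) 1
    rw [pow_one] at h
    refine h.trans ?_
    have h2 := exp_neg_le_div_sq (x := (v + 1) * t.re) (by positivity)
    have h0 : 0 < 1 - Real.exp (-(1 * t.re)) := by
      have : Real.exp (-(1 * t.re)) < 1 := Real.exp_lt_one_iff.2 (by linarith)
      linarith
    refine (div_le_div_of_nonneg_right h2 (pow_pos h0 1).le).trans (le_of_eq ?_)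
    rw [mul_pow, add_comm v 1]
    field_simp
  have h1 := integral_tsum_shift hcont hbd
  have h2 : ∀ a : ℝ, lambertSum θ t (a + 1) = ∑' j : ℕ, lambert θ t (a + j + 1) := fun a =>
    tsum_congr fun j => by congr 1; ring
  simp only [h2, h1]
  have hd : ∀ v ∈ Ici (0 : ℝ), HasDerivAt (fun v => Complex.log (1 - kernelExp θ t (v + 1)) / t)
      (lambert θ t (v + 1)) v := fun v hv => by
    have hv' : (0 : ℝ) ≤ v := hv
    exact (hasDerivAt_log_one_sub_kernelExp θ ht (v := v + 1) (by linarith)).comp_add_const v 1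
  have hE : Tendsto (fun v : ℝ => kernelExp θ t (v + 1)) atTop (𝓝 0) := by
    rw [tendsto_zero_iff_norm_tendsto_zero]
    simp only [norm_kernelExp]
    refine Real.tendsto_exp_neg_atTop_nhds_zero.comp ?_
    exact (tendsto_atTop_add_const_right _ _ tendsto_id).atTop_mul_const ht
  have hlim : Tendsto (fun v : ℝ => Complex.log (1 - kernelExp θ t (v + 1)) / t) atTop (𝓝 0) := by
    have h3 := ((tendsto_const_nhds (x := (1 : ℂ))).sub hE).clog (by simp)
    have h4 := h3.div_const t
    simpa using h4
  rw [integral_Ioi_of_hasDerivAt_of_tendsto' hd (integrableOn_of_norm_le hcont hbd) hlim]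
  simp

/-! ### Poles of the Lambert kernel and the partial fractions of its derivative. -/

/-- The integers `n` with `θ + n ≠ 0`. -/
abbrev nzShift (θ : ℝ) : Type := {n : ℤ // θ + n ≠ 0}

lemma summable_nzShift (θ : ℝ) : Summable fun i : nzShift θ => 1 / (θ + (i : ℤ)) ^ 2 := by
  have h := (Real.summable_one_div_int_add_rpow θ 2).2 one_lt_two
  refine (h.subtype {n : ℤ | θ + n ≠ 0}).congr fun i => ?_
  simp only [Function.comp_apply, Real.rpow_two, sq_abs, add_comm]

/-- `1` if `θ` is an integer and `0` otherwise. -/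
def intInd (θ : ℝ) : ℂ := open Classical in if ∃ n : ℤ, θ + n = 0 then 1 else 0

lemma norm_intInd_le (θ : ℝ) : ‖intInd θ‖ ≤ 1 := by
  rw [intInd]
  split_ifs <;> simp

/-- The Lipschitz formula: the sum of (τ + n)⁻² is -4π² times the sum of n qⁿ, taken at τ = θ +
ivt/(2π), where q is the exponential in the kernel. -/
lemma tsum_int_lipschitz (θ : ℝ) {t : ℂ} (ht : 0 < t.re) {v : ℝ} (hv : 0 < v) :
    ∑' n : ℤ, 1 / ((v : ℂ) + ((θ + n : ℝ) : ℂ) * (-(2 * Real.pi * Complex.I) / t)) ^ 2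
      = t ^ 2 * (kernelExp θ t v / (1 - kernelExp θ t v) ^ 2) := by
  have ht0 : t ≠ 0 := by rintro rfl; simp at ht
  have hpi : (Real.pi : ℂ) ≠ 0 := by exact_mod_cast Real.pi_ne_zero
  have hI := Complex.I_ne_zero
  set τ : ℂ := θ + Complex.I * v * t / (2 * Real.pi) with hτ
  have him : 0 < τ.im := by
    rw [hτ, show Complex.I * v * t / (2 * Real.pi) = ((v / (2 * Real.pi) : ℝ) : ℂ) * (Complex.I * t) by
      push_cast; field_simp, Complex.add_im, Complex.ofReal_im, Complex.im_ofReal_mul]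
    have : 0 < v / (2 * Real.pi) * t.re := by have := Real.pi_pos; positivity
    simpa using this
  have h := EisensteinSeries.qExpansion_identity (k := 1) le_rfl ⟨τ, him⟩
  have hE : Complex.exp (2 * Real.pi * Complex.I * τ) = kernelExp θ t v := by
    rw [kernelExp, hτ]
    congr 1
    field_simp
    linear_combination (v * t : ℂ) * Complex.I_sq
  have hg : ∑' n : ℕ, (n : ℂ) ^ 1 * Complex.exp (2 * Real.pi * Complex.I * τ) ^ n
      = kernelExp θ t v / (1 - kernelExp θ t v) ^ 2 := by
    rw [hE]
    simp only [pow_one]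
    exact tsum_coe_mul_geometric_of_norm_lt_one (norm_kernelExp_lt_one θ ht hv)
  have h' : ∑' n : ℤ, 1 / (τ + n) ^ 2
      = -4 * Real.pi ^ 2 * (kernelExp θ t v / (1 - kernelExp θ t v) ^ 2) := by
    rw [← hg]
    refine h.trans ?_
    have : (-2 * (Real.pi : ℂ) * Complex.I) ^ (1 + 1) / ((Nat.factorial 1 : ℕ) : ℂ) = -4 * Real.pi ^ 2 := by
      norm_num
      linear_combination (4 * (Real.pi : ℂ) ^ 2) * Complex.I_sq
    rw [this]
  have hterm : ∀ n : ℤ, 1 / ((v : ℂ) + ((θ + n : ℝ) : ℂ) * (-(2 * Real.pi * Complex.I) / t)) ^ 2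
      = -(t ^ 2) / (4 * Real.pi ^ 2) * (1 / (τ + n) ^ 2) := by
    intro n
    have : (v : ℂ) + ((θ + n : ℝ) : ℂ) * (-(2 * Real.pi * Complex.I) / t)
        = 2 * Real.pi / (Complex.I * t) * (τ + n) := by
      rw [hτ]
      push_cast
      field_simp
      linear_combination (-(2 * Real.pi * (θ + n)) : ℂ) * Complex.I_sq
    rw [this, mul_pow, div_pow, mul_pow, mul_pow, Complex.I_sq]
    field_simp
    norm_num
  simp only [hterm, tsum_mul_left]
  rw [h']
  field_simp

/-- The direction `-2πi / t` of the poles of the Lambert kernel. -/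
def poleDir (t : ℂ) : ℂ := -(2 * Real.pi * Complex.I) / t

lemma poleDir_im_ne_zero {t : ℂ} (ht : 0 < t.re) : (poleDir t).im ≠ 0 := by
  have ht0 : t ≠ 0 := by rintro rfl; simp at ht
  have h1 : 0 < (1 / t).re := by
    rw [one_div, Complex.inv_re]
    exact div_pos ht (Complex.normSq_pos.2 ht0)
  have h2 : (poleDir t).im = -(2 * Real.pi * (1 / t).re) := by
    rw [poleDir, show -(2 * Real.pi * Complex.I) / t
      = ((-(2 * Real.pi) : ℝ) : ℂ) * (Complex.I * (1 / t)) by push_cast; ring,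
      Complex.im_ofReal_mul, Complex.I_mul_im]
    ring
  rw [h2]
  have := Real.pi_pos
  exact (neg_neg_of_pos (by positivity)).ne

/-- The poles of the Lambert kernel away from the origin, scaled. -/
def poleSum (θ : ℝ) (t : ℂ) (v : ℝ) : ℂ :=
  invSqSum (fun i : nzShift θ => θ + (i : ℤ)) (poleDir t) v

/-- For integral θ the index with θ + n = 0 is left out of `nzShift`; its term would be 1/v², the
one that is singular at the origin. -/
lemma poleSum_eq (θ : ℝ) {t : ℂ} (ht : 0 < t.re) {v : ℝ} (hv : 0 < v) :
    poleSum θ t v = t ^ 2 * (kernelExp θ t v / (1 - kernelExp θ t v) ^ 2) - intInd θ / v ^ 2 := by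
  classical
  set g : ℤ → ℂ := fun n => 1 / ((v : ℂ) + ((θ + n : ℝ) : ℂ) * poleDir t) ^ 2 with hg
  have hs : Summable (g ∘ ((↑) : {n : ℤ | θ + n ≠ 0} → ℤ)) :=
    summable_invSq (poleDir_im_ne_zero ht) (y := fun i : nzShift θ => θ + (i : ℤ)) (fun i => i.2)
      (summable_nzShift θ) hv.le
  have h1 : poleSum θ t v = ∑' n : ℤ, {n : ℤ | θ + n ≠ 0}.indicator g n :=
    tsum_subtype {n : ℤ | θ + n ≠ 0} g
  have h2 : ∑' n : ℤ, g n = _ := tsum_int_lipschitz θ ht hv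
  rw [h1, ← h2, intInd]
  split_ifs with h
  · obtain ⟨n₀, hn₀⟩ := h
    have e : g = {n : ℤ | θ + n ≠ 0}.indicator g
        + (Pi.single n₀ (1 / (v : ℂ) ^ 2) : ℤ → ℂ) := by
      ext n
      by_cases hn : n = n₀
      · subst hn
        have hn₀' : (θ : ℂ) + n = 0 := by exact_mod_cast hn₀
        simp [hg, hn₀', hn₀, indicator]
      · have : θ + n ≠ 0 := by
          intro h
          apply hn
          have : (n : ℝ) = n₀ := by linarith
          exact_mod_cast this
        simp [indicator, this, hn]
    have h3 : ∑' n, g n = ∑' n : ℤ, {n : ℤ | θ + n ≠ 0}.indicator g n + 1 / (v : ℂ) ^ 2 := by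
      conv_lhs => rw [e]
      refine ((summable_subtype_iff_indicator.1 hs).hasSum.add
        (hasSum_pi_single n₀ (1 / (v : ℂ) ^ 2))).tsum_eq
    rw [h3]
    ring
  · push Not at h
    have e : {n : ℤ | θ + n ≠ 0}.indicator g = g := by
      ext n
      simp [indicator, h n]
    rw [e]
    simp

/-- On [0, 1] the series is uniformly bounded. For v ≥ 1 the closed form is an exponentially
decaying term and at most 1/v². -/
lemma exists_norm_poleSum_le (θ : ℝ) {t : ℂ} (ht : 0 < t.re) :
    ∃ C : ℝ, ∀ v : ℝ, 0 ≤ v → ‖poleSum θ t v‖ ≤ C / (1 + v) ^ 2 := by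
  obtain ⟨C₀, hC₀⟩ := exists_norm_invSqSum_le (poleDir_im_ne_zero ht)
    (y := fun i : nzShift θ => θ + (i : ℤ)) (fun i => i.2) (summable_nzShift θ)
  have hC₀0 : 0 ≤ C₀ := (norm_nonneg _).trans (hC₀ 0 le_rfl)
  have h0 : 0 < 1 - Real.exp (-(1 * t.re)) := by
    have : Real.exp (-(1 * t.re)) < 1 := Real.exp_lt_one_iff.2 (by linarith)
    linarith
  set K := ‖t‖ ^ 2 * (2 / t.re ^ 2 / (1 - Real.exp (-(1 * t.re))) ^ 2) + 1 with hK
  have hK0 : 0 ≤ K := by positivity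
  refine ⟨4 * C₀ + 4 * K, fun v hv => ?_⟩
  rw [le_div_iff₀ (by positivity)]
  rcases le_total v 1 with h | h
  · have h1 : ‖poleSum θ t v‖ ≤ C₀ := hC₀ v hv
    have h2 : (1 + v) ^ 2 ≤ 4 := by nlinarith
    have h3 : ‖poleSum θ t v‖ * (1 + v) ^ 2 ≤ C₀ * 4 := by gcongr
    linarith
  · have hv0 : 0 < v := by linarith
    have h1 : ‖poleSum θ t v‖ ≤ K / v ^ 2 := by
      rw [poleSum_eq θ ht hv0]
      refine (norm_sub_le _ _).trans ?_
      rw [hK, add_div]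
      refine add_le_add ?_ ?_
      · rw [norm_mul, norm_pow, mul_div_assoc]
        refine mul_le_mul_of_nonneg_left ?_ (by positivity)
        refine (norm_kernelExp_div_le θ ht one_pos h 2).trans ?_
        have h2 := exp_neg_le_div_sq (x := v * t.re) (by positivity)
        refine (div_le_div_of_nonneg_right h2 (pow_pos h0 2).le).trans (le_of_eq ?_)
        rw [mul_pow]
        field_simp
      · rw [norm_div, norm_pow, Complex.norm_of_nonneg hv]
        have := norm_intInd_le θ
        gcongr
    have h2 : (1 + v) ^ 2 ≤ 4 * v ^ 2 := by nlinarith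
    calc ‖poleSum θ t v‖ * (1 + v) ^ 2 ≤ K / v ^ 2 * (4 * v ^ 2) := by gcongr
      _ = 4 * K := by field_simp
      _ ≤ _ := by linarith

lemma continuousOn_poleSum (θ : ℝ) {t : ℂ} (ht : 0 < t.re) : ContinuousOn (poleSum θ t) (Ici 0) :=
  continuousOn_invSqSum (poleDir_im_ne_zero ht) (fun i => i.2) (summable_nzShift θ)

lemma hasSum_oscInt_poleSum (θ : ℝ) {t : ℂ} (ht : 0 < t.re) {N : ℝ} (hN : N ≠ 0) :
    HasSum (fun i : nzShift θ => oscInt N ((θ + (i : ℤ) : ℝ) * poleDir t))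
      (∫ s in Ioi (0 : ℝ), osc N s * poleSum θ t s) := by
  obtain ⟨C, hC⟩ := exists_norm_poleSum_le θ ht
  refine hasSum_oscInt (poleDir_im_ne_zero ht) (y := fun i : nzShift θ => θ + (i : ℤ))
    (fun i => i.2) (summable_nzShift θ) hN (integrableOn_of_norm_le (continuousOn_poleSum θ ht) hC) ?_
  rw [tendsto_zero_iff_norm_tendsto_zero]
  have hl : Tendsto (fun v : ℝ => C / (1 + v) ^ 2) atTop (𝓝 0) :=
    tendsto_const_nhds.div_atTop
      ((tendsto_pow_atTop two_ne_zero).comp (tendsto_atTop_add_const_left _ _ tendsto_id))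
  refine squeeze_zero' (Eventually.of_forall fun v => norm_nonneg _) ?_ hl
  filter_upwards [eventually_ge_atTop 0] with v hv
  exact hC v hv

/-! ### Fourier coefficients contributed by single poles, and their decay. -/

/-- The Fourier coefficient attached to a frequency `N` and a pole `2πiy`. -/
def poleCoeff (t : ℂ) (N : ℤ) (y : ℝ) : ℂ := oscSide (N.sign : ℝ) (2 * Real.pi * N * y / t)

lemma poleCoeff_zero (t : ℂ) (y : ℝ) : poleCoeff t 0 y = 0 := by
  simp [poleCoeff, oscSide]

lemma neg_I_sign_mul (t : ℂ) (N : ℤ) (y : ℝ) :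
    -Complex.I * ((N.sign : ℝ) : ℂ) * (2 * Real.pi * N * y / t) = |(N : ℝ)| * (y * poleDir t) := by
  have h : ((N.sign : ℝ) : ℂ) * N = (|(N : ℝ)| : ℝ) := by
    have h2 : (N.sign : ℝ) * N = |(N : ℝ)| := by exact_mod_cast Int.sign_mul_self_eq_abs N
    exact_mod_cast h2
  rw [← h, poleDir]
  ring

/-- After rescaling to frequency ±1, the contribution of a pole depends on N and y only through Ny
and the sign of N. This is how the form n₁n₂ enters. -/
lemma poleCoeff_eq {t : ℂ} {N : ℤ} (hN : N ≠ 0) (y : ℝ) :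
    poleCoeff t N y = 1 / (2 * Real.pi * Complex.I * N) * oscInt N (y * poleDir t) := by
  have hN' : (N : ℂ) ≠ 0 := by exact_mod_cast hN
  have hI := Complex.I_ne_zero
  have hpi : (Real.pi : ℂ) ≠ 0 := by exact_mod_cast Real.pi_ne_zero
  have h : (((N.sign : ℝ) : ℂ)) * N = (|(N : ℝ)| : ℝ) := by
    have h2 : (N.sign : ℝ) * N = |(N : ℝ)| := by exact_mod_cast Int.sign_mul_self_eq_abs N
    exact_mod_cast h2
  rw [poleCoeff, oscSide, neg_I_sign_mul, oscInt_int hN, ← h]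
  field_simp

lemma sign_sq_eq_one {N : ℤ} (hN : N ≠ 0) : (N.sign : ℝ) ^ 2 = 1 := by
  rcases lt_or_gt_of_ne hN with h | h
  · simp [Int.sign_eq_neg_one_of_neg h]
  · simp [Int.sign_eq_one_of_pos h]

lemma exists_norm_poleCoeff_le {t : ℂ} (ht : 0 < t.re) :
    ∃ C : ℝ, ∀ (N : ℤ) (y : ℝ), y ≠ 0 → ‖poleCoeff t N y‖ ≤ C * (1 / (N : ℝ) ^ 2 * (1 / y ^ 2)) := by
  obtain ⟨κ, hκ, H⟩ := exists_uniform_le_norm_add (poleDir_im_ne_zero ht)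
  refine ⟨1 / (2 * Real.pi) * ((1 / (2 * Real.pi)) * (1 + 1 / κ ^ 3) / ‖poleDir t‖ ^ 2),
    fun N y hy => ?_⟩
  rcases eq_or_ne N 0 with rfl | hN
  · simp [poleCoeff_zero]
  have hNr : (N : ℝ) ≠ 0 := by exact_mod_cast hN
  have hσ := sign_sq_eq_one hN
  have hσ1 : ‖((N.sign : ℝ) : ℂ)‖ = 1 := by
    rw [Complex.norm_real, Real.norm_eq_abs]
    rw [← sq_abs] at hσ
    exact (pow_eq_one_iff_of_nonneg (abs_nonneg _) two_ne_zero).1 hσ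
  have hy' : |(N : ℝ)| * y ≠ 0 := mul_ne_zero (abs_ne_zero.2 hNr) hy
  have h1 := norm_oscInt_le (mul_mem_slitPlane_of_im_ne_zero (poleDir_im_ne_zero ht) hy') hκ
    (H _ hy') hσ
  rw [poleCoeff, oscSide, neg_I_sign_mul, norm_mul, norm_div, hσ1,
    show (|(N : ℝ)| : ℝ) * ((y : ℂ) * poleDir t) = ((|(N : ℝ)| * y : ℝ) : ℂ) * poleDir t by
      push_cast; ring]
  rw [norm_mul ((|(N : ℝ)| * y : ℝ) : ℂ), Complex.norm_real, Real.norm_eq_abs, mul_pow, sq_abs, mul_pow,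
    sq_abs] at h1
  have h2 : ‖(2 * Real.pi * Complex.I : ℂ)‖ = 2 * Real.pi := by simp [abs_of_pos Real.pi_pos]
  rw [h2]
  refine (mul_le_mul_of_nonneg_left h1 (by positivity)).trans (le_of_eq ?_)
  have := Real.pi_pos
  have hp : ‖poleDir t‖ ≠ 0 := norm_ne_zero_iff.2 fun h => poleDir_im_ne_zero ht (by rw [h]; simp)
  field_simp

lemma summable_poleCoeff (θ : ℝ) {t : ℂ} (ht : 0 < t.re) :
    Summable fun p : ℤ × nzShift θ => ‖poleCoeff t p.1 (θ + (p.2 : ℤ))‖ := by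
  obtain ⟨C, hC⟩ := exists_norm_poleCoeff_le ht
  have h1 : Summable fun N : ℤ => 1 / (N : ℝ) ^ 2 := Real.summable_one_div_int_pow.2 one_lt_two
  have h2 := (h1.mul_of_nonneg (summable_nzShift θ) (fun N => by positivity)
    (fun i => by positivity)).mul_left C
  exact Summable.of_nonneg_of_le (fun p => norm_nonneg _) (fun p => hC p.1 _ p.2.2) h2

/-! ### Fourier expansion of the Lambert sums. -/

section Residue

variable {θ : ℝ} {t χ₀ Λ₀ : ℂ}

/-- The expansion of a sum of Lambert kernels along an arithmetic progression. Here `χ₀` and `Λ₀` are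
the limits at the origin of the kernel and of its logarithmic primitive, with the pole removed. -/
theorem lambertSum_eq (ht : 0 < t.re)
    (hχ : Tendsto (fun v : ℝ => lambert θ t v - intInd θ / (v * t)) (𝓝[>] 0) (𝓝 χ₀))
    (hΛ : Tendsto (fun v : ℝ => Complex.log (1 - kernelExp θ t v) / t
      - intInd θ * (Real.log v : ℝ) / t) (𝓝[>] 0) (𝓝 Λ₀))
    {a : ℝ} (ha0 : 0 < a) (ha1 : a ≤ 1) :
    lambertSum θ t a = -(intInd θ * Complex.digamma a / t) - Λ₀ - χ₀ * (a - 1 / 2)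
      + 1 / t * ∑' p : ℤ × nzShift θ, osc (-p.1) a * poleCoeff t p.1 (θ + (p.2 : ℤ)) := by
  have ht0 : t ≠ 0 := by rintro rfl; simp at ht
  set d := intInd θ with hd
  set g : ℝ → ℂ := fun v => lambert θ t v - d / (v * t) with hg
  set u : ℝ → ℂ := fun v => -(1 / t) * poleSum θ t v with hu
  set χ : ℝ → ℂ := Function.update g 0 χ₀ with hχd
  have hgd : ∀ v : ℝ, 0 < v → HasDerivAt g (u v) v := by
    intro v hv
    have hvc : (v : ℂ) ≠ 0 := by exact_mod_cast hv.ne'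
    have h1 : HasDerivAt (fun v : ℝ => (v : ℂ) * t) (1 * t) v :=
      (hasDerivAt_id v).ofReal_comp.mul_const t
    refine ((hasDerivAt_lambert θ ht hv).sub
      ((hasDerivAt_const v d).div h1 (mul_ne_zero hvc ht0))).congr_deriv ?_
    simp only [hu, poleSum_eq θ ht hv]
    field_simp
    ring
  have hχv : ∀ v : ℝ, v ≠ 0 → χ v = g v := fun v hv => Function.update_of_ne hv _ _
  have hχd' : ∀ v : ℝ, 0 < v → HasDerivAt χ (u v) v := by
    intro v hv
    refine (hgd v hv).congr_of_eventuallyEq ?_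
    filter_upwards [lt_mem_nhds hv] with w hw
    exact hχv w hw.ne'
  have hχc : ContinuousOn χ (Icc 0 1) := by
    rw [hχd, continuousOn_update_iff]
    refine ⟨fun v hv => ?_, fun _ => hχ.mono_left (nhdsWithin_mono _ ?_)⟩
    · have hv0 : 0 < v := lt_of_le_of_ne hv.1.1 (Ne.symm hv.2)
      exact (hgd v hv0).continuousAt.continuousWithinAt
    · intro v hv
      exact lt_of_le_of_ne hv.1.1 (Ne.symm hv.2)
  obtain ⟨C, hC⟩ := exists_norm_poleSum_le θ ht
  have huc : ContinuousOn u (Ici 0) := continuousOn_const.mul (continuousOn_poleSum θ ht)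
  have hub : ∀ v, 0 ≤ v → ‖u v‖ ≤ (‖1 / t‖ * C) / (1 + v) ^ 2 := by
    intro v hv
    rw [hu, norm_mul, norm_neg, mul_div_assoc]
    exact mul_le_mul_of_nonneg_left (hC v hv) (norm_nonneg _)
  -- The removed poles d/((a + j)t) sum formally to a constant minus dψ(a)/t, so adding dψ/t leaves
  -- the periodization of `u` as derivative. Only the j = 0 terms are singular at a = 0; they are
  -- combined into χ, which extends continuously by χ₀.
  set G : ℝ → ℂ := fun a => χ a + lambertSum θ t (a + 1) + d * Complex.digamma ((a : ℂ) + 1) / t with hG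
  have hLd : ∀ a : ℝ, 0 ≤ a → HasDerivAt (fun a => lambertSum θ t (a + 1))
      (∑' j : ℕ, -t * (kernelExp θ t (a + 1 + j) / (1 - kernelExp θ t (a + 1 + j)) ^ 2)) a :=
    fun a ha => (hasDerivAt_lambertSum θ ht (b := a + 1) (by linarith)).comp_add_const a 1
  have hψd : ∀ a : ℝ, 0 ≤ a → HasDerivAt (fun a : ℝ => d * Complex.digamma ((a : ℂ) + 1) / t)
      (d * (∑' j : ℕ, 1 / (((a + 1 : ℝ) : ℂ) + j) ^ 2) / t) a := by
    intro a ha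
    have h := ((hasDerivAt_digamma (x := a + 1) (by linarith)).comp_add_const a 1).const_mul d
    have h2 := h.div_const t
    simpa using h2
  have hGc : ContinuousOn G (Icc 0 1) :=
    (hχc.add fun a ha => (hLd a ha.1).continuousAt.continuousWithinAt).add
      fun a ha => (hψd a ha.1).continuousAt.continuousWithinAt
  have hGd : ∀ a ∈ Ioo (0 : ℝ) 1, HasDerivAt G (∑' j : ℕ, u (a + j)) a := by
    intro a ha
    refine (((hχd' a ha.1).add (hLd a ha.1.le)).add (hψd a ha.1.le)).congr_deriv ?_
    have hsu : Summable fun j : ℕ => u (a + j) :=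
      Summable.of_norm_bounded (summable_div_one_add_sq _) fun j => norm_shift_le hub j ha.1.le
    have hsψ : Summable fun j : ℕ => 1 / (((a + 1 : ℝ) : ℂ) + j) ^ 2 := by
      have := Complex.ofRealCLM.summable (summable_one_div_add_nat_sq (x := a + 1) (by linarith [ha.1]))
      refine this.congr fun j => ?_
      rw [Complex.ofRealCLM_apply]
      push_cast
      rfl
    rw [hsu.tsum_eq_zero_add, mul_div_right_comm, ← tsum_mul_left, add_assoc,
      ← (summable_deriv_lambert θ ht (b := a + 1) (by linarith [ha.1])).tsum_add (hsψ.mul_left _)]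
    congr 1
    · simp
    · refine tsum_congr fun j => ?_
      have h0 : 0 < a + 1 + j := by have := ha.1; positivity
      have h0c : ((a : ℂ) + 1 + j) ≠ 0 := by exact_mod_cast h0.ne'
      have e : a + ((j + 1 : ℕ) : ℝ) = a + 1 + j := by push_cast; ring
      simp only [hu]
      rw [e, poleSum_eq θ ht h0]
      push_cast
      field_simp
      ring
  have hGa : ∀ a : ℝ, 0 < a → G a = lambertSum θ t a + d * Complex.digamma a / t := by
    intro a ha
    have hac : (a : ℂ) ≠ 0 := by exact_mod_cast ha.ne'
    simp only [hG]
    rw [hχv a ha.ne', lambertSum_eq_add θ ht ha, Complex.digamma_apply_add_one (a : ℂ) fun m h => by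
      have h1 : a = -m := by exact_mod_cast h
      have : (0 : ℝ) ≤ m := Nat.cast_nonneg m
      linarith]
    simp only [hg]
    field_simp
    ring
  have hG10 : G 1 - G 0 = -χ₀ := by
    rw [hGa 1 one_pos]
    simp only [hG, hχd, Function.update_self, zero_add]
    push_cast
    rw [zero_add]
    ring
  -- The primitive of χ contributes its value at 1 minus Λ₀; the value at 1 cancels against
  -- `integral_lambertSum`, and the digamma term has mean zero.
  have hmean : ∫ a in (0 : ℝ)..1, G a = -Λ₀ := by
    have hi1 : IntervalIntegrable χ volume 0 1 :=
      ContinuousOn.intervalIntegrable (by rwa [uIcc_of_le zero_le_one])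
    have hi2 : IntervalIntegrable (fun a => lambertSum θ t (a + 1)) volume 0 1 :=
      ContinuousOn.intervalIntegrable fun a ha => by
        rw [uIcc_of_le zero_le_one] at ha
        exact (hLd a ha.1).continuousAt.continuousWithinAt
    have hi3 : IntervalIntegrable (fun a : ℝ => d * Complex.digamma ((a : ℂ) + 1) / t) volume 0 1 :=
      ContinuousOn.intervalIntegrable fun a ha => by
        rw [uIcc_of_le zero_le_one] at ha
        exact (hψd a ha.1).continuousAt.continuousWithinAt
    have hprim : ∀ v : ℝ, 0 < v → HasDerivAt (fun v : ℝ => Complex.log (1 - kernelExp θ t v) / t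
        - d * (Real.log v : ℝ) / t) (g v) v := by
      intro v hv
      have hvc : (v : ℂ) ≠ 0 := by exact_mod_cast hv.ne'
      refine ((hasDerivAt_log_one_sub_kernelExp θ ht hv).sub
        (((Real.hasDerivAt_log hv.ne').ofReal_comp.const_mul d).div_const t)).congr_deriv ?_
      simp only [hg]
      push_cast
      field_simp
    have hχi := intervalIntegral.integral_eq_sub_of_hasDerivAt_of_tendsto (zero_lt_one (α := ℝ))
      (fun v hv => (hprim v hv.1).congr_deriv (hχv v hv.1.ne').symm) hi1 hΛ
      ((hprim 1 one_pos).continuousAt.tendsto.mono_left nhdsWithin_le_nhds)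
    simp only [hG]
    rw [intervalIntegral.integral_add (hi1.add hi2) hi3, intervalIntegral.integral_add hi1 hi2, hχi,
      integral_lambertSum θ ht, intervalIntegral.integral_div, intervalIntegral.integral_const_mul,
      integral_digamma]
    simp
    ring
  set T : ℤ × nzShift θ → ℂ := fun p => poleCoeff t p.1 (θ + (p.2 : ℤ)) with hT
  have hTs : Summable T := (summable_poleCoeff θ ht).of_norm
  have hTa : Summable fun p : ℤ × nzShift θ => osc (-p.1) a * T p := by
    refine Summable.of_norm ((summable_poleCoeff θ ht).congr fun p => ?_)
    rw [norm_mul, norm_osc, one_mul]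
  -- The coefficient at frequency n integrates against e^{-2πinv}, so it is attached to N = -n.
  set e : ℤ → ℂ := fun n => 1 / t * ∑' i, T (-n, i) with he
  set c : ℤ → ℂ := fun n => (Pi.single 0 (-Λ₀) : ℤ → ℂ) n + e n with hc
  have hes : Summable e := by
    have h1 : Summable fun N : ℤ => 1 / t * ∑' i, T (N, i) := hTs.prod.mul_left _
    exact (Equiv.neg ℤ).summable_iff.2 h1
  -- `Int.sign 0 = 0` makes `poleCoeff` vanish at N = 0, so the double series may run over all
  -- integers N.
  have he0 : e 0 = 0 := by simp [he, hT, poleCoeff_zero]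
  have hcs : Summable c := (hasSum_pi_single 0 (-Λ₀)).summable.add hes
  have hsum := hasSum_fourier_of_hasDerivAt_tsum hGc huc hub hGd (c := c)
    (by rw [hmean]; simp [hc, he0]) (fun n hn => by
      have hn' : -n ≠ 0 := neg_ne_zero.2 hn
      have h1 := (hasSum_oscInt_poleSum θ ht (N := ((-n : ℤ) : ℝ)) (by exact_mod_cast hn')).tsum_eq
      have h2 : ∫ v in Ioi (0 : ℝ), osc (-n) v * u v
          = -(1 / t) * ∫ v in Ioi (0 : ℝ), osc ((-n : ℤ) : ℝ) v * poleSum θ t v := by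
        rw [← integral_const_mul]
        refine integral_congr_ae (Eventually.of_forall fun v => ?_)
        simp only [hu]
        push_cast
        ring
      rw [h2, ← h1]
      simp only [hc, he, hT, Pi.single_eq_of_ne hn, zero_add, poleCoeff_eq hn', tsum_mul_left]
      have hnc : (n : ℂ) ≠ 0 := by exact_mod_cast hn
      have hpi : (Real.pi : ℂ) ≠ 0 := by exact_mod_cast Real.pi_ne_zero
      have hI := Complex.I_ne_zero
      generalize ∑' i : nzShift θ,
        oscInt ((-n : ℤ) : ℝ) (((θ + (i : ℤ) : ℝ) : ℂ) * poleDir t) = Z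
      push_cast
      field_simp) hcs (a := a) ⟨ha0.le, ha1⟩
  have hsum2 : HasSum (fun n : ℤ => c n * osc n a)
      (-Λ₀ + 1 / t * ∑' p : ℤ × nzShift θ, osc (-p.1) a * T p) := by
    have h1 : HasSum (fun n : ℤ => (Pi.single 0 (-Λ₀) : ℤ → ℂ) n * osc n a) (-Λ₀) := by
      have := hasSum_single (f := fun n : ℤ => (Pi.single 0 (-Λ₀) : ℤ → ℂ) n * osc n a) 0
        (fun n hn => by simp [Pi.single_eq_of_ne hn])
      simpa [osc] using this
    have h2 : HasSum (fun N : ℤ => 1 / t * ∑' i, osc (-N) a * T (N, i))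
        (1 / t * ∑' p : ℤ × nzShift θ, osc (-p.1) a * T p) := by
      rw [hTa.tsum_prod]
      exact hTa.prod.hasSum.mul_left _
    have h3 := (Equiv.neg ℤ).hasSum_iff.2 h2
    refine (h1.add h3).congr_fun fun n => ?_
    simp only [hc, he, Function.comp_apply, Equiv.neg_apply, tsum_mul_left, Int.cast_neg, neg_neg]
    ring
  have hfin := hsum.unique hsum2
  rw [hG10, hGa a ha0] at hfin
  linear_combination hfin

end Residue

/-! ### The Lambert kernel at the origin -/

lemma kernelExp_zero (θ : ℝ) (t : ℂ) :
    kernelExp θ t 0 = Complex.exp (2 * Real.pi * Complex.I * θ) := by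
  simp [kernelExp]

lemma continuous_kernelExp (θ : ℝ) (t : ℂ) : Continuous (kernelExp θ t) := by
  unfold kernelExp
  fun_prop

lemma fract_ne_zero_of_forall {θ : ℝ} (hθ : ∀ n : ℤ, θ + n ≠ 0) : Int.fract θ ≠ 0 := by
  intro h
  refine hθ (-⌊θ⌋) ?_
  rw [Int.fract] at h
  push_cast
  linarith

lemma sin_pi_mul_fract_pos {θ : ℝ} (hθ : ∀ n : ℤ, θ + n ≠ 0) :
    0 < Real.sin (Real.pi * Int.fract θ) := by
  have h0 : 0 < Int.fract θ := (Int.fract_nonneg θ).lt_of_ne (fract_ne_zero_of_forall hθ).symm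
  have h1 := Int.fract_lt_one θ
  have hpi := Real.pi_pos
  exact Real.sin_pos_of_pos_of_lt_pi (by positivity) (by nlinarith)

lemma sin_pi_mul_sq_fract (θ : ℝ) :
    Real.sin (Real.pi * θ) ^ 2 = Real.sin (Real.pi * Int.fract θ) ^ 2 := by
  have h : Real.pi * Int.fract θ = Real.pi * θ - ⌊θ⌋ * Real.pi := by rw [Int.fract]; ring
  rw [h, Real.sin_sub_int_mul_pi, mul_pow]
  rcases Int.even_or_odd ⌊θ⌋ with h | h <;> simp [h.neg_one_zpow]

lemma exp_two_pi_fract (θ : ℝ) :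
    Complex.exp (2 * Real.pi * Complex.I * Int.fract θ)
      = Complex.exp (2 * Real.pi * Complex.I * θ) := by
  rw [Int.fract]
  refine Complex.exp_eq_exp_iff_exists_int.2 ⟨-⌊θ⌋, ?_⟩
  push_cast
  ring

/-- With x the fractional part, 1 - e^{2πix} = 2 sin(πx) · e^{πi(x - 1/2)} in polar form; the
sawtooth function is the argument divided by π. -/
lemma one_sub_exp_two_pi {θ : ℝ} (hθ : ∀ n : ℤ, θ + n ≠ 0) :
    1 - Complex.exp (2 * Real.pi * Complex.I * θ)
      = Complex.exp (((1 / 2 * Real.log (4 * Real.sin (Real.pi * θ) ^ 2) : ℝ) : ℂ)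
        + Real.pi * Complex.I * (sawtooth θ : ℂ)) := by
  have hs := sin_pi_mul_fract_pos hθ
  have hlog : 1 / 2 * Real.log (4 * Real.sin (Real.pi * θ) ^ 2)
      = Real.log (2 * Real.sin (Real.pi * Int.fract θ)) := by
    rw [sin_pi_mul_sq_fract, show 4 * Real.sin (Real.pi * Int.fract θ) ^ 2
      = (2 * Real.sin (Real.pi * Int.fract θ)) ^ 2 by ring, Real.log_pow]
    push_cast
    ring
  have hsaw : sawtooth θ = Int.fract θ - 1 / 2 := by
    rw [sawtooth, if_neg (fract_ne_zero_of_forall hθ), Int.fract]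
  rw [hlog, Complex.exp_add, ← Complex.ofReal_exp, Real.exp_log (by positivity), hsaw,
    ← exp_two_pi_fract]
  set x := Int.fract θ
  have h1 : Complex.exp (Real.pi * Complex.I * ((x - 1 / 2 : ℝ) : ℂ))
      = Complex.exp (Real.pi * x * Complex.I) * -Complex.I := by
    rw [show Real.pi * Complex.I * ((x - 1 / 2 : ℝ) : ℂ)
      = Real.pi * x * Complex.I + -Real.pi / 2 * Complex.I by push_cast; ring, Complex.exp_add,
      Complex.exp_neg_pi_div_two_mul_I]
  have h2 : Complex.exp (2 * Real.pi * Complex.I * x) = Complex.exp (Real.pi * x * Complex.I) ^ 2 := by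
    rw [← Complex.exp_nat_mul]
    congr 1
    push_cast
    ring
  have h3 : Complex.exp (-(Real.pi * x) * Complex.I) * Complex.exp (Real.pi * x * Complex.I) = 1 := by
    rw [← Complex.exp_add]
    simp
  rw [h1, h2]
  push_cast
  rw [Complex.sin]
  linear_combination Complex.I ^ 2 * h3 + (1 - Complex.exp (Real.pi * x * Complex.I) ^ 2) * Complex.I_sq

lemma abs_sawtooth_lt (θ : ℝ) : |sawtooth θ| ≤ 1 / 2 := by
  rw [sawtooth]
  have h0 := Int.fract_nonneg θ
  have h1 := Int.fract_lt_one θ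
  split_ifs
  · norm_num
  · rw [abs_le]
    rw [Int.fract] at h0 h1
    constructor <;> linarith

lemma log_one_sub_exp_two_pi {θ : ℝ} (hθ : ∀ n : ℤ, θ + n ≠ 0) :
    Complex.log (1 - Complex.exp (2 * Real.pi * Complex.I * θ))
      = ((1 / 2 * Real.log (4 * Real.sin (Real.pi * θ) ^ 2) : ℝ) : ℂ)
        + Real.pi * Complex.I * (sawtooth θ : ℂ) := by
  have h := abs_le.1 (abs_sawtooth_lt θ)
  have hpi := Real.pi_pos
  have him : (((1 / 2 * Real.log (4 * Real.sin (Real.pi * θ) ^ 2) : ℝ) : ℂ)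
        + Real.pi * Complex.I * (sawtooth θ : ℂ)).im = Real.pi * sawtooth θ := by
    simp [-one_div, -Complex.ofReal_mul]
  rw [one_sub_exp_two_pi hθ, Complex.log_exp]
  · rw [him]; nlinarith
  · rw [him]; nlinarith

lemma one_sub_exp_two_pi_ne_zero {θ : ℝ} (hθ : ∀ n : ℤ, θ + n ≠ 0) :
    1 - Complex.exp (2 * Real.pi * Complex.I * θ) ≠ 0 := by
  rw [one_sub_exp_two_pi hθ]
  exact Complex.exp_ne_zero _

lemma one_sub_exp_two_pi_mem_slitPlane {θ : ℝ} (hθ : ∀ n : ℤ, θ + n ≠ 0) :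
    1 - Complex.exp (2 * Real.pi * Complex.I * θ) ∈ Complex.slitPlane := by
  rw [Complex.mem_slitPlane_iff_arg]
  refine ⟨?_, one_sub_exp_two_pi_ne_zero hθ⟩
  have h := abs_le.1 (abs_sawtooth_lt θ)
  have hpi := Real.pi_pos
  rw [← Complex.log_im, log_one_sub_exp_two_pi hθ]
  have him : (((1 / 2 * Real.log (4 * Real.sin (Real.pi * θ) ^ 2) : ℝ) : ℂ)
        + Real.pi * Complex.I * (sawtooth θ : ℂ)).im = Real.pi * sawtooth θ := by
    simp [-one_div, -Complex.ofReal_mul]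
  rw [him]
  nlinarith

lemma exp_two_pi_div_one_sub {θ : ℝ} (hθ : ∀ n : ℤ, θ + n ≠ 0) :
    Complex.exp (2 * Real.pi * Complex.I * θ) / (1 - Complex.exp (2 * Real.pi * Complex.I * θ))
      = -(1 / 2 * (1 - Complex.I * (Real.cot (Real.pi * θ) : ℂ))) := by
  have hne := one_sub_exp_two_pi_ne_zero hθ
  rw [Complex.ofReal_cot, Complex.cot_eq_exp_ratio]
  have h : Complex.exp (2 * Complex.I * ((Real.pi * θ : ℝ) : ℂ))
      = Complex.exp (2 * Real.pi * Complex.I * θ) := by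
    congr 1
    push_cast
    ring
  rw [h]
  set E := Complex.exp (2 * Real.pi * Complex.I * θ)
  have hI := Complex.I_ne_zero
  field_simp
  ring

lemma intInd_of_not_int {θ : ℝ} (hθ : ∀ n : ℤ, θ + n ≠ 0) : intInd θ = 0 := by
  rw [intInd, if_neg]
  push Not
  exact hθ

lemma intInd_of_int {θ : ℝ} {n : ℤ} (hθ : θ + n = 0) : intInd θ = 1 := by
  rw [intInd, if_pos ⟨n, hθ⟩]

/-- The double series in the expansion of `lambertSum`. -/
def poleSeries (θ : ℝ) (t : ℂ) (a : ℝ) : ℂ :=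
  ∑' p : ℤ × nzShift θ, osc (-p.1) a * poleCoeff t p.1 (θ + (p.2 : ℤ))

/-- There is no pole at the origin, so χ₀ and Λ₀ come simply from the values of the kernel and of
its logarithmic primitive at v = 0. -/
theorem lambertSum_eq_of_not_int {θ : ℝ} (hθ : ∀ n : ℤ, θ + n ≠ 0) {t : ℂ} (ht : 0 < t.re) {a : ℝ}
    (ha0 : 0 < a) (ha1 : a ≤ 1) :
    lambertSum θ t a = -((Real.pi * Complex.I * (sawtooth θ : ℂ)
        + ((1 / 2 * Real.log (4 * Real.sin (Real.pi * θ) ^ 2) : ℝ) : ℂ)) / t)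
      + 1 / 2 * ((a - 1 / 2) * (1 - Complex.I * (Real.cot (Real.pi * θ) : ℂ)))
      + 1 / t * poleSeries θ t a := by
  have hne := one_sub_exp_two_pi_ne_zero hθ
  have hc := (continuous_kernelExp θ t).tendsto 0
  rw [kernelExp_zero] at hc
  have hχ := hc.div (tendsto_const_nhds.sub hc) hne
  have hΛ := ((tendsto_const_nhds (x := (1 : ℂ))).sub hc).clog
    (one_sub_exp_two_pi_mem_slitPlane hθ)
  rw [exp_two_pi_div_one_sub hθ] at hχ
  rw [log_one_sub_exp_two_pi hθ] at hΛ
  have h0 := intInd_of_not_int hθ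
  rw [lambertSum_eq ht (θ := θ)
    ((hχ.mono_left nhdsWithin_le_nhds).congr fun v => by rw [h0]; simp [lambert])
    (((hΛ.div_const t).mono_left nhdsWithin_le_nhds).congr fun v => by rw [h0]; simp) ha0 ha1, h0,
    poleSeries]
  ring

/-- The constant term of 1/(e^w - 1), obtained from the identity 1/(e^w - 1) - 1/w = -((e^w - 1 -
w)/w²)/((e^w - 1)/w). -/
lemma tendsto_exp_quotient_sub :
    Tendsto (fun w : ℂ => Complex.exp (-w) / (1 - Complex.exp (-w)) - 1 / w) (𝓝[≠] 0)
      (𝓝 (-(1 / 2))) := by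
  have h1 : Tendsto (fun w : ℂ => (Complex.exp w - 1) / w) (𝓝[≠] 0) (𝓝 1) := by
    have := (Complex.hasDerivAt_exp 0).tendsto_slope_zero
    simpa [div_eq_inv_mul] using this
  have h2 : Tendsto (fun w : ℂ => (Complex.exp w - 1 - w) / w ^ 2) (𝓝[≠] 0) (𝓝 (1 / 2)) := by
    rw [tendsto_iff_norm_sub_tendsto_zero]
    have hz : Tendsto (fun w : ℂ => ‖w‖) (𝓝[≠] 0) (𝓝 0) :=
      (tendsto_norm_zero (E := ℂ)).mono_left nhdsWithin_le_nhds
    refine squeeze_zero' (Eventually.of_forall fun _ => norm_nonneg _) ?_ hz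
    filter_upwards [self_mem_nhdsWithin, hz.eventually (gt_mem_nhds (zero_lt_one' ℝ))] with w hw hw1
    have hw0 : w ≠ 0 := hw
    have hb := Complex.exp_bound hw1.le (n := 3) (by norm_num)
    simp only [Finset.sum_range_succ, Finset.sum_range_zero] at hb
    norm_num [Nat.factorial] at hb
    have he : (Complex.exp w - 1 - w) / w ^ 2 - 1 / 2
        = (Complex.exp w - (1 + w + w ^ 2 / 2)) / w ^ 2 := by
      field_simp
      ring
    have hp : 0 < ‖w‖ := norm_pos_iff.2 hw0
    rw [he, norm_div, norm_pow, div_le_iff₀ (by positivity)]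
    refine hb.trans ?_
    have := pow_pos hp 3
    nlinarith
  have h3 := (h2.div h1 one_ne_zero).neg
  rw [div_one] at h3
  refine h3.congr' ?_
  have hne : ∀ᶠ w : ℂ in 𝓝[≠] 0, (Complex.exp w - 1) / w ≠ 0 := h1.eventually_ne one_ne_zero
  filter_upwards [self_mem_nhdsWithin, hne] with w hw hw2
  have hw0 : w ≠ 0 := hw
  have hE : Complex.exp w - 1 ≠ 0 := fun h => hw2 (by rw [h, zero_div])
  have hE' : Complex.exp w ≠ 0 := Complex.exp_ne_zero w
  simp only [Pi.div_apply]
  have hm : 1 - (Complex.exp w)⁻¹ ≠ 0 := by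
    rw [sub_ne_zero]
    intro h
    apply hE
    rw [← inv_inv (Complex.exp w), ← h]
    simp
  have hq : (Complex.exp w)⁻¹ / (1 - (Complex.exp w)⁻¹) = 1 / (Complex.exp w - 1) := by
    rw [div_eq_div_iff hm hE]
    field_simp
  rw [Complex.exp_neg, hq]
  field_simp
  ring

/-- Here the kernel is e^{-vt}/(1 - e^{-vt}). Its constant term is -1/2, and 1 - e^{-vt} ~ vt gives
Λ₀ = (log t)/t; this is the source of Log z. -/
theorem lambertSum_eq_of_int {θ : ℝ} {n : ℤ} (hθ : θ + n = 0) {t : ℂ} (ht : 0 < t.re) {a : ℝ}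
    (ha0 : 0 < a) (ha1 : a ≤ 1) :
    lambertSum θ t a = -((Complex.log t + Complex.digamma a) / t) + 1 / 2 * (a - 1 / 2)
      + 1 / t * poleSeries θ t a := by
  have ht0 : t ≠ 0 := by rintro rfl; simp at ht
  have h1 := intInd_of_int hθ
  have hk : ∀ v, kernelExp θ t v = Complex.exp (-(v * t)) := by
    intro v
    rw [kernelExp]
    refine Complex.exp_eq_exp_iff_exists_int.2 ⟨-n, ?_⟩
    have : (θ : ℂ) = -n := by
      have : θ = -n := by linarith
      rw [this]; push_cast; ring
    rw [this]
    push_cast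
    ring
  have hmul : Tendsto (fun v : ℝ => (v : ℂ) * t) (𝓝[>] 0) (𝓝[≠] 0) := by
    refine tendsto_nhdsWithin_iff.2 ⟨?_, ?_⟩
    · have : Tendsto (fun v : ℝ => (v : ℂ) * t) (𝓝 0) (𝓝 ((0 : ℝ) * t)) :=
        (by fun_prop : Continuous fun v : ℝ => (v : ℂ) * t).tendsto 0
      rw [Complex.ofReal_zero, zero_mul] at this
      exact this.mono_left nhdsWithin_le_nhds
    · filter_upwards [self_mem_nhdsWithin] with v hv
      have hv0 : (v : ℂ) ≠ 0 := by exact_mod_cast (ne_of_gt (mem_Ioi.1 hv))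
      exact mul_ne_zero hv0 ht0
  have hχ : Tendsto (fun v : ℝ => lambert θ t v - intInd θ / (v * t)) (𝓝[>] 0) (𝓝 (-(1 / 2))) := by
    refine (tendsto_exp_quotient_sub.comp hmul).congr fun v => ?_
    simp only [Function.comp_apply, lambert, hk, h1]
  have hq : Tendsto (fun v : ℝ => (1 - kernelExp θ t v) / v) (𝓝[>] 0) (𝓝 t) := by
    have hd := ((hasDerivAt_kernelExp θ t 0).const_sub 1).tendsto_slope_zero_right
    simp only [zero_add, hk] at hd
    simp only [hk]
    simpa [div_eq_inv_mul] using hd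
  have hΛ : Tendsto (fun v : ℝ => Complex.log (1 - kernelExp θ t v) / t
      - intInd θ * (Real.log v : ℝ) / t) (𝓝[>] 0) (𝓝 (Complex.log t / t)) := by
    refine ((hq.clog (Or.inl ht)).div_const t).congr' ?_
    filter_upwards [self_mem_nhdsWithin] with v hv
    have hv0 : 0 < v := hv
    have hne := one_sub_kernelExp_ne_zero θ ht hv0
    have hcast : (1 - kernelExp θ t v) / v = ((v⁻¹ : ℝ) : ℂ) * (1 - kernelExp θ t v) := by
      push_cast
      field_simp
    rw [h1, hcast, Complex.log_ofReal_mul (inv_pos.2 hv0) hne, Real.log_inv]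
    push_cast
    ring
  rw [lambertSum_eq ht hχ hΛ ha0 ha1, h1, poleSeries]
  ring

/-! ### Decomposition of the Eisenstein series into residue classes -/

lemma norm_nome_lt_one {τ : ℂ} (hτ : 0 < τ.im) : ‖Complex.exp (2 * Real.pi * Complex.I * τ)‖ < 1 := by
  rw [Complex.norm_exp, Real.exp_lt_one_iff]
  have := mul_pos Real.pi_pos hτ
  simp
  nlinarith

lemma summable_FTerm (R r : ℕ) {τ : ℂ} (hτ : 0 < τ.im) :
    Summable fun m : progression R r => FTerm τ m := by
  set q := Complex.exp (2 * Real.pi * Complex.I * τ) with hq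
  have hq1 : ‖q‖ < 1 := norm_nome_lt_one hτ
  have hg : Summable fun m : ℕ => ‖q‖ ^ m / (1 - ‖q‖) :=
    (summable_geometric_of_lt_one (norm_nonneg _) hq1).div_const _
  refine Summable.of_norm_bounded (hg.subtype (progression R r)) fun m => ?_
  have hm : 1 ≤ (m : ℕ) := m.2.1
  have h1 : ‖q‖ ^ (m : ℕ) ≤ ‖q‖ := by
    simpa using pow_le_pow_of_le_one (norm_nonneg q) hq1.le hm
  have h2 := norm_sub_norm_le 1 (q ^ (m : ℕ))
  rw [norm_one, norm_pow] at h2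
  rw [FTerm, ← hq, norm_div, norm_pow]
  simp only [Function.comp_apply]
  have : 0 < 1 - ‖q‖ := by linarith
  gcongr
  linarith

/-- The elements of the progression `r + Rℕ`, for `1 ≤ r ≤ R`, listed in order. -/
def progressionEquiv {R r : ℕ} (hr1 : 1 ≤ r) (hrR : r ≤ R) : ℕ ≃ progression R r where
  toFun n := ⟨R * n + r, by
    refine ⟨by omega, ?_⟩
    rw [Nat.ModEq, Nat.mul_add_mod]⟩
  invFun m := (m - r) / R
  left_inv n := by
    have : 0 < R := by omega
    simp [this]
  right_inv := by
    rintro ⟨m, hm1, hm⟩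
    have hRpos : 0 < R := by omega
    have hle : r ≤ m := by
      by_contra hlt
      push Not at hlt
      have h1 := (Nat.modEq_iff_dvd' hlt.le).1 hm
      have := Nat.le_of_dvd (by omega) h1
      omega
    have hd := (Nat.modEq_iff_dvd' hle).1 hm.symm
    apply Subtype.ext
    simp only
    rw [Nat.mul_div_cancel' hd]
    omega

/-- The two exponents differ by 2πi · hRj, so the phase depends only on the residue class l. -/
lemma FTerm_eq_lambert {R r h k : ℕ} (hR : R ≠ 0) (hk : k ≠ 0) (z : ℂ) (l j : ℕ) :
    FTerm ((h : ℂ) / k + Complex.I * z / (k : ℂ) ^ 2) (R * (l + k * j) + r)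
      = lambert ((h : ℝ) * ((R : ℝ) * l + r) / k) (2 * Real.pi * z * R / k)
          (((R : ℝ) * l + r) / ((R : ℝ) * k) + j) := by
  have h1 : Complex.exp (2 * Real.pi * Complex.I * ((h : ℂ) / k + Complex.I * z / (k : ℂ) ^ 2))
      ^ (R * (l + k * j) + r)
      = kernelExp ((h : ℝ) * ((R : ℝ) * l + r) / k) (2 * Real.pi * z * R / k)
          (((R : ℝ) * l + r) / ((R : ℝ) * k) + j) := by
    rw [kernelExp, ← Complex.exp_nat_mul]
    refine Complex.exp_eq_exp_iff_exists_int.2 ⟨h * R * j, ?_⟩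
    have hR' : (R : ℂ) ≠ 0 := by exact_mod_cast hR
    have hk' : (k : ℂ) ≠ 0 := by exact_mod_cast hk
    push_cast
    field_simp
    linear_combination (z * (R * (l + k * j) + r)) * Complex.I_sq
  rw [FTerm, lambert, h1]

lemma im_cusp_pos {h k : ℕ} (hk : k ≠ 0) {z : ℂ} (hz : 0 < z.re) :
    0 < ((h : ℂ) / k + Complex.I * z / (k : ℂ) ^ 2).im := by
  have h1 : (h : ℂ) / k = ((h / k : ℝ) : ℂ) := by push_cast; rfl
  have h2 : Complex.I * z / (k : ℂ) ^ 2 = ((1 / k ^ 2 : ℝ) : ℂ) * (Complex.I * z) := by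
    push_cast
    ring
  rw [h1, h2, Complex.add_im, Complex.ofReal_im, Complex.im_ofReal_mul]
  have : (0 : ℝ) < k := by exact_mod_cast Nat.pos_of_ne_zero hk
  simp
  positivity

lemma F_eq_sum_lambertSum {R r h k : ℕ} (hr1 : 1 ≤ r) (hrR : r ≤ R) (hk : k ≠ 0) {z : ℂ}
    (hz : 0 < z.re) :
    F R r ((h : ℂ) / k + Complex.I * z / (k : ℂ) ^ 2)
      = ∑ l ∈ Finset.range k, lambertSum ((h : ℝ) * ((R : ℝ) * l + r) / k)
          (2 * Real.pi * z * R / k) (((R : ℝ) * l + r) / ((R : ℝ) * k)) := by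
  set τ : ℂ := (h : ℂ) / k + Complex.I * z / (k : ℂ) ^ 2
  have hs := summable_FTerm R r (im_cusp_pos (h := h) hk hz)
  have hs' : Summable fun n : ℕ => FTerm τ (R * n + r) :=
    (progressionEquiv hr1 hrR).summable_iff.2 hs
  have : NeZero k := ⟨hk⟩
  rw [F, ← (progressionEquiv hr1 hrR).tsum_eq]
  change ∑' n : ℕ, FTerm τ (R * n + r) = _
  rw [← (Nat.divModEquiv k).symm.tsum_eq, ← (Equiv.prodComm _ _).tsum_eq, Summable.tsum_prod,
    tsum_fintype, Finset.sum_range]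
  · refine Finset.sum_congr rfl fun l _ => ?_
    rw [lambertSum]
    refine tsum_congr fun j => ?_
    rw [← FTerm_eq_lambert (by omega) hk]
    refine congrArg (FTerm τ) ?_
    have he : (Nat.divModEquiv k).symm ((Equiv.prodComm (Fin k) ℕ) (l, j)) = l + k * j := by
      simp [Nat.divModEquiv]
      ring
    rw [he]
  · exact (Equiv.prodComm _ _).summable_iff.2 ((Nat.divModEquiv k).symm.summable_iff.2 hs')

/-! ### The elementary part -/

/-- Solutions l of Rl ≡ -r mod k exist only if g = gcd(R, k) divides r. They then form one class
modulo k/g, hence g classes modulo k. The count is the weight of Log z, that is the constant C. -/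
lemma sum_ite_dvd_linear (R r : ℕ) {k : ℕ} (hk : k ≠ 0) :
    ∑ l ∈ Finset.range k, (if k ∣ R * l + r then (1 : ℂ) else 0)
      = if Nat.gcd R k ∣ r then (Nat.gcd R k : ℂ) else 0 := by
  set g := Nat.gcd R k with hg
  have hg0 : 0 < g := Nat.gcd_pos_of_pos_right _ (Nat.pos_of_ne_zero hk)
  split_ifs with hr
  · obtain ⟨r', rfl⟩ := hr
    obtain ⟨R', hR'⟩ : g ∣ R := Nat.gcd_dvd_left R k
    obtain ⟨k', hk'⟩ : g ∣ k := Nat.gcd_dvd_right R k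
    have hk'0 : 0 < k' := Nat.pos_of_ne_zero (by rintro rfl; simp at hk'; exact hk hk')
    have hcop : Nat.Coprime R' k' := by
      have : g * Nat.gcd R' k' = g * 1 := by rw [← Nat.gcd_mul_left, ← hR', ← hk', mul_one]
      exact Nat.eq_of_mul_eq_mul_left hg0 this
    obtain ⟨c, hc⟩ : ∃ c : ℕ, k' ∣ R' * c + r' := by
      obtain ⟨x, hx⟩ := Nat.exists_mul_mod_eq_of_coprime ((k' - 1) * r') hcop hk'0.ne'
      refine ⟨x, ?_⟩
      have h1 : R' * x + r' ≡ (k' - 1) * r' + r' [MOD k'] := Nat.ModEq.add_right r' hx.2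
      have h2 : (k' - 1) * r' + r' = k' * r' := by
        obtain ⟨n, rfl⟩ : ∃ n, k' = n + 1 := ⟨k' - 1, by omega⟩
        simp
        ring
      exact (Nat.modEq_zero_iff_dvd.1 (h1.trans (by rw [h2]; exact Nat.modEq_zero_iff_dvd.2 ⟨r', rfl⟩)))
    have hiff : ∀ l, k ∣ R * l + g * r' ↔ l ≡ c [MOD k'] := by
      intro l
      have e : R * l + g * r' = g * (R' * l + r') := by rw [hR']; ring
      rw [e]
      nth_rewrite 1 [hk']
      rw [Nat.mul_dvd_mul_iff_left hg0]
      constructor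
      · intro h
        have h3 : R' * l + r' ≡ R' * c + r' [MOD k'] :=
          (Nat.modEq_zero_iff_dvd.2 h).trans (Nat.modEq_zero_iff_dvd.2 hc).symm
        exact Nat.ModEq.cancel_left_of_coprime (by rw [Nat.gcd_comm]; exact hcop)
          (Nat.ModEq.add_right_cancel' r' h3)
      · intro h
        exact Nat.modEq_zero_iff_dvd.1
          (((h.mul_left R').add_right r').trans (Nat.modEq_zero_iff_dvd.2 hc))
    simp only [hiff]
    rw [Finset.sum_boole, ← Nat.count_eq_card_filter_range, hk',
      Nat.count_modEq_card _ hk'0]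
    simp [hk'0]
  · refine Finset.sum_eq_zero fun l _ => if_neg fun h => hr ?_
    have h1 : g ∣ R * l + r := (Nat.gcd_dvd_right R k).trans h
    exact (Nat.dvd_add_right ((Nat.gcd_dvd_left R k).mul_right l)).1 h1

lemma exists_int_iff_dvd {h k : ℕ} (hk : k ≠ 0) (hcop : Nat.gcd h k = 1) (M : ℕ) :
    (∃ n : ℤ, (h : ℝ) * M / k + n = 0) ↔ k ∣ M := by
  have hk' : (k : ℝ) ≠ 0 := by exact_mod_cast hk
  constructor
  · rintro ⟨n, hn⟩
    have h1 : (h : ℝ) * M = k * (-n) := by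
      field_simp at hn
      linarith
    have h2 : (h : ℤ) * M = k * (-n) := by exact_mod_cast h1
    have h3 : (k : ℤ) ∣ ((h * M : ℕ) : ℤ) := ⟨-n, by push_cast; exact h2⟩
    exact (Nat.Coprime.dvd_of_dvd_mul_left (by rw [Nat.coprime_comm]; exact hcop)
      (Int.natCast_dvd_natCast.1 h3))
  · rintro ⟨n, rfl⟩
    refine ⟨-(h * n), ?_⟩
    push_cast
    field_simp
    ring

lemma sawtooth_of_int {x : ℝ} {n : ℤ} (hx : x + n = 0) : sawtooth x = 0 := by
  rw [sawtooth, if_pos]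
  rw [show x = ((-n : ℤ) : ℝ) by push_cast; linarith, Int.fract_intCast]

lemma re_period_pos {R k : ℕ} (hR : R ≠ 0) (hk : k ≠ 0) {z : ℂ} (hz : 0 < z.re) :
    0 < (2 * Real.pi * z * R / k).re := by
  have : (2 * Real.pi * z * R / k) = ((2 * Real.pi * R / k : ℝ) : ℂ) * z := by
    push_cast
    ring
  rw [this, Complex.re_ofReal_mul]
  have h1 : (0 : ℝ) < k := by exact_mod_cast Nat.pos_of_ne_zero hk
  have h2 : (0 : ℝ) < R := by exact_mod_cast Nat.pos_of_ne_zero hR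
  have := Real.pi_pos
  positivity

lemma log_period {R k : ℕ} (hR : R ≠ 0) (hk : k ≠ 0) {z : ℂ} (hz : z ≠ 0) :
    Complex.log (2 * Real.pi * z * R / k)
      = ((Real.log (2 * Real.pi * R / k) : ℝ) : ℂ) + Complex.log z := by
  have h1 : (0 : ℝ) < k := by exact_mod_cast Nat.pos_of_ne_zero hk
  have h2 : (0 : ℝ) < R := by exact_mod_cast Nat.pos_of_ne_zero hR
  have h3 := Real.pi_pos
  rw [← Complex.log_ofReal_mul (by positivity) hz]
  congr 1
  push_cast
  ring

theorem F_eq_elementary_add {R r h k : ℕ} (hr1 : 1 ≤ r) (hrR : r ≤ R) (hk : k ≠ 0)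
    (hcop : Nat.gcd h k = 1) {z : ℂ} (hz : 0 < z.re) :
    F R r ((h : ℂ) / k + Complex.I * z / (k : ℂ) ^ 2)
      = -constC R r k * (Complex.log z / z) + constA R r h k / z + constB R r h k
        + k / (2 * Real.pi * z * R) * ∑ l ∈ Finset.range k,
          poleSeries ((h : ℝ) * ((R : ℝ) * l + r) / k) (2 * Real.pi * z * R / k)
            (((R : ℝ) * l + r) / ((R : ℝ) * k)) := by
  have hR : R ≠ 0 := by omega
  have hz0 : z ≠ 0 := by rintro rfl; simp at hz
  have hRr : (0 : ℝ) < R := by exact_mod_cast Nat.pos_of_ne_zero hR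
  have hkr : (0 : ℝ) < k := by exact_mod_cast Nat.pos_of_ne_zero hk
  have hRc : (R : ℂ) ≠ 0 := by exact_mod_cast hR
  have hkc : (k : ℂ) ≠ 0 := by exact_mod_cast hk
  have hpi : (Real.pi : ℂ) ≠ 0 := by exact_mod_cast Real.pi_ne_zero
  have hC : constC R r k
      = k / (2 * Real.pi * R) * ∑ l ∈ Finset.range k, (if k ∣ R * l + r then (1 : ℂ) else 0) := by
    rw [sum_ite_dvd_linear R r hk, constC]
    have hgl : (Nat.gcd R k : ℂ) * (Nat.lcm R k : ℂ) = R * k := by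
      exact_mod_cast Nat.gcd_mul_lcm R k
    have hl : (Nat.lcm R k : ℂ) ≠ 0 := by
      exact_mod_cast Nat.lcm_ne_zero hR hk
    split_ifs
    · field_simp
      linear_combination (-1 : ℂ) * hgl
    · simp
  rw [F_eq_sum_lambertSum hr1 hrR hk hz, hC, constA, constB]
  simp only [Finset.mul_sum, Finset.sum_mul, ← Finset.sum_neg_distrib, Finset.sum_div,
    ← Finset.sum_add_distrib]
  refine Finset.sum_congr rfl fun l hl => ?_
  have hlk : l + 1 ≤ k := Finset.mem_range.1 hl
  have ha0 : 0 < ((R : ℝ) * l + r) / ((R : ℝ) * k) := by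
    have : (0 : ℝ) < r := by exact_mod_cast hr1
    positivity
  -- Equality occurs for r = R and l = k - 1, so the expansion is needed on (0, 1] including the
  -- right end.
  have ha1 : ((R : ℝ) * l + r) / ((R : ℝ) * k) ≤ 1 := by
    rw [div_le_one (by positivity)]
    have h1 : (r : ℝ) ≤ R := by exact_mod_cast hrR
    have h2 : (l : ℝ) + 1 ≤ k := by exact_mod_cast hlk
    nlinarith
  have ht := re_period_pos hR hk hz
  have hiff := exists_int_iff_dvd hk hcop (R * l + r)
  have hcast : ((R * l + r : ℕ) : ℝ) = (R : ℝ) * l + r := by push_cast; rfl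
  rw [hcast] at hiff
  have harg : Real.pi * h * ((R : ℝ) * l + r) / k = Real.pi * ((h : ℝ) * ((R : ℝ) * l + r) / k) := by
    ring
  have hac : ((((R : ℝ) * l + r) / ((R : ℝ) * k) : ℝ) : ℂ) = ((R : ℂ) * l + r) / ((R : ℂ) * k) := by
    push_cast
    rfl
  rw [harg]
  set S := poleSeries ((h : ℝ) * ((R : ℝ) * l + r) / k) (2 * Real.pi * z * R / k)
    (((R : ℝ) * l + r) / ((R : ℝ) * k)) with hS
  by_cases hd : k ∣ R * l + r
  · obtain ⟨n, hn⟩ := hiff.2 hd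
    rw [lambertSum_eq_of_int hn ht ha0 ha1, ← hS, log_period hR hk hz0, sawtooth_of_int hn, hac]
    simp only [if_pos hd, Complex.ofReal_zero]
    set D := Complex.digamma (((R : ℂ) * l + r) / ((R : ℂ) * k))
    set a := ((R : ℂ) * l + r) / ((R : ℂ) * k)
    field_simp
    ring
  · have hn : ∀ n : ℤ, (h : ℝ) * ((R : ℝ) * l + r) / k + n ≠ 0 := fun n hn => hd (hiff.1 ⟨n, hn⟩)
    rw [lambertSum_eq_of_not_int hn ht ha0 ha1, ← hS, hac]
    simp only [if_neg hd]
    set a := ((R : ℂ) * l + r) / ((R : ℂ) * k)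
    field_simp
    ring

/-! ### The Weil multiplier -/

lemma sum_range_shift {G : ℤ → ℂ} {k : ℕ} (hG : ∀ l, G (l + k) = G l) (s : ℤ) :
    ∑ l ∈ Finset.range k, G (l + s) = ∑ l ∈ Finset.range k, G l := by
  have hstep : ∀ s : ℤ, ∑ l ∈ Finset.range k, G (l + (s + 1)) = ∑ l ∈ Finset.range k, G (l + s) := by
    intro s
    have h1 := Finset.sum_range_succ (fun l : ℕ => G (l + s)) k
    have h2 := Finset.sum_range_succ' (fun l : ℕ => G (l + s)) k
    have h3 : G ((k : ℕ) + s) = G ((0 : ℕ) + s) := by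
      rw [add_comm, hG]
      simp
    have h4 : ∀ l : ℕ, ((l + 1 : ℕ) : ℤ) + s = l + (s + 1) := fun l => by push_cast; ring
    simp only [h4] at h2
    rw [h1, h3] at h2
    exact (add_right_cancel h2).symm
  induction s using Int.induction_on with
  | zero => simp
  | succ n ih => rw [hstep, ih]
  | pred n ih => rw [← ih, ← hstep (-n - 1), sub_add_cancel]

lemma sum_exp_mul_div {k : ℕ} (hk : k ≠ 0) (c : ℤ) :
    ∑ n ∈ Finset.range k, Complex.exp (2 * Real.pi * Complex.I * c / k * n)
      = if (k : ℤ) ∣ c then (k : ℂ) else 0 := by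
  have hkc : (k : ℂ) ≠ 0 := by exact_mod_cast hk
  have hterm : ∀ n : ℕ, Complex.exp (2 * Real.pi * Complex.I * c / k * n)
      = Complex.exp (2 * Real.pi * Complex.I * c / k) ^ n := fun n => by
    rw [← Complex.exp_nat_mul, mul_comm]
  have hone : Complex.exp (2 * Real.pi * Complex.I * c / k) = 1 ↔ (k : ℤ) ∣ c := by
    rw [Complex.exp_eq_one_iff]
    have hpi : (2 * Real.pi * Complex.I : ℂ) ≠ 0 := Complex.two_pi_I_ne_zero
    constructor
    · rintro ⟨n, hn⟩
      refine ⟨n, ?_⟩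
      have h1 : (2 * Real.pi * Complex.I : ℂ) * c = (2 * Real.pi * Complex.I) * (k * n) := by
        field_simp at hn
        linear_combination (2 * Real.pi * Complex.I : ℂ) * hn
      exact_mod_cast mul_left_cancel₀ hpi h1
    · rintro ⟨n, rfl⟩
      refine ⟨n, ?_⟩
      push_cast
      field_simp
  simp only [hterm]
  split_ifs with hd
  · rw [hone.2 hd]
    simp
  · have hne : Complex.exp (2 * Real.pi * Complex.I * c / k) ≠ 1 := fun h => hd (hone.1 h)
    rw [geom_sum_eq hne, ← Complex.exp_nat_mul]
    have : Complex.exp (k * (2 * Real.pi * Complex.I * c / k)) = 1 := by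
      rw [Complex.exp_eq_one_iff]
      exact ⟨c, by field_simp⟩
    rw [this, sub_self, zero_div]

/-- The coefficient of the `N`-th lattice term in the sum over residue classes. -/
def residueSum (R r h k : ℕ) (N : ℤ × ℤ) : ℂ :=
  ∑ l ∈ Finset.range k, if (k : ℤ) ∣ h * (R * l + r) - N.2 then
    osc (-N.1) (((R : ℝ) * l + r) / ((R : ℝ) * k)) else 0

/-- The lattice point `R m + α`. -/
def latticePoint (R : ℕ) (α m : ℤ × ℤ) : ℤ × ℤ := (R * m.1 + α.1, R * m.2 + α.2)

/-- The sum over ν₁ is a complete character sum modulo k; it selects the ν₂ with h(Rν₂ + r) ≡ α₂ and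
contributes a factor k. -/
lemma weilMultiplier_eq {R r h k : ℕ} (hR : R ≠ 0) (hk : k ≠ 0) (h' : ℤ) (α : ℤ × ℤ) :
    weilMultiplier R r h k h' α
      = Complex.exp (-(2 * Real.pi * Complex.I * h' * α.1 * α.2 / (R * k))) / R *
        residueSum R r h k α := by
  have hRc : (R : ℂ) ≠ 0 := by exact_mod_cast hR
  have hkc : (k : ℂ) ≠ 0 := by exact_mod_cast hk
  have hterm : ∀ ν₁ ν₂ : ℕ, Complex.exp (2 * Real.pi * Complex.I / (k : ℂ) *
        ((R : ℂ) * h * ν₁ * ((ν₂ : ℂ) + (r : ℂ) / R) - (α.2 : ℂ) * ν₁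
          - (α.1 : ℂ) * ((ν₂ : ℂ) + (r : ℂ) / R)))
      = osc (-α.1) (((R : ℝ) * ν₂ + r) / ((R : ℝ) * k)) *
        Complex.exp (2 * Real.pi * Complex.I * ((h * (R * ν₂ + r) - α.2 : ℤ) : ℂ) / k * ν₁) := by
    intro ν₁ ν₂
    rw [osc, ← Complex.exp_add]
    congr 1
    push_cast
    field_simp
    ring
  have hin : ∑ ν₁ ∈ Finset.range k, ∑ ν₂ ∈ Finset.range k,
      Complex.exp (2 * Real.pi * Complex.I / (k : ℂ) *
        ((R : ℂ) * h * ν₁ * ((ν₂ : ℂ) + (r : ℂ) / R) - (α.2 : ℂ) * ν₁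
          - (α.1 : ℂ) * ((ν₂ : ℂ) + (r : ℂ) / R))) = k * residueSum R r h k α := by
    rw [Finset.sum_comm, residueSum, Finset.mul_sum]
    refine Finset.sum_congr rfl fun ν₂ _ => ?_
    simp only [hterm, ← Finset.mul_sum, sum_exp_mul_div hk]
    split_ifs <;> ring
  have hexp : 2 * Real.pi * Complex.I / ((R : ℂ) * k) * (-(h' : ℂ) * α.1 * α.2)
      = -(2 * Real.pi * Complex.I * h' * α.1 * α.2 / (R * k)) := by ring
  rw [weilMultiplier, hin, hexp]
  field_simp

/-- Passing from α to Rm + α raises the residue condition by Rm₂, which the shift l ↦ l - h'm₂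
absorbs because hh' ≡ -1. The phases then combine into the exponential of 2πi(h'/k)Rn₁n₂. So one
multiplier serves a whole coset of Rℤ². -/
lemma weilMultiplier_mul_exp {R r h k : ℕ} (hR : R ≠ 0) (hk : k ≠ 0) {h' : ℤ}
    (hh' : (h : ℤ) * h' ≡ -1 [ZMOD (k : ℤ)]) (α m : ℤ × ℤ) :
    weilMultiplier R r h k h' α *
        Complex.exp (2 * Real.pi * Complex.I * (h' / k) * (quadForm R α m : ℂ))
      = 1 / R * residueSum R r h k (latticePoint R α m) := by
  have hRc : (R : ℂ) ≠ 0 := by exact_mod_cast hR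
  have hkc : (k : ℂ) ≠ 0 := by exact_mod_cast hk
  obtain ⟨e, he⟩ := hh'.dvd
  have he' : (h : ℤ) * h' = -1 - k * e := by linarith
  set G : ℤ → ℂ := fun l => if (k : ℤ) ∣ h * (R * l + r) - (latticePoint R α m).2 then
    osc (-(latticePoint R α m).1) (((R : ℝ) * l + r) / ((R : ℝ) * k)) else 0 with hGdef
  have hG : ∀ l, G (l + k) = G l := by
    intro l
    have h1 : (k : ℤ) ∣ h * (R * (l + k) + r) - (latticePoint R α m).2
        ↔ (k : ℤ) ∣ h * (R * l + r) - (latticePoint R α m).2 := by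
      rw [show (h : ℤ) * (R * (l + k) + r) - (latticePoint R α m).2
        = (h * (R * l + r) - (latticePoint R α m).2) + k * (h * R) by ring]
      exact Int.dvd_add_left (dvd_mul_right _ _)
    have h2 : osc (-(latticePoint R α m).1) (((R : ℝ) * ((l + k : ℤ) : ℝ) + r) / ((R : ℝ) * k))
        = osc (-(latticePoint R α m).1) (((R : ℝ) * l + r) / ((R : ℝ) * k)) := by
      rw [osc, osc, Complex.exp_eq_exp_iff_exists_int]
      refine ⟨-(latticePoint R α m).1, ?_⟩
      push_cast
      field_simp
      ring
    simp only [hGdef, h1, h2]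
  have hsum : residueSum R r h k (latticePoint R α m) = ∑ l ∈ Finset.range k, G l := by
    rw [residueSum]
    refine Finset.sum_congr rfl fun l _ => ?_
    simp [hGdef]
  rw [hsum, ← sum_range_shift hG (-(h' * m.2)), weilMultiplier_eq hR hk, residueSum, div_mul_eq_mul_div,
    div_mul_eq_mul_div, one_div_mul_eq_div]
  congr 1
  rw [Finset.mul_sum, Finset.sum_mul]
  refine Finset.sum_congr rfl fun l _ => ?_
  have h1 : (k : ℤ) ∣ h * (R * (l + -(h' * m.2)) + r) - (latticePoint R α m).2
      ↔ (k : ℤ) ∣ h * (R * l + r) - α.2 := by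
    rw [show (h : ℤ) * (R * (l + -(h' * m.2)) + r) - (latticePoint R α m).2
      = (h * (R * l + r) - α.2) + k * (e * R * m.2) by
        simp only [latticePoint]
        linear_combination (-R * m.2 : ℤ) * he']
    exact Int.dvd_add_left (dvd_mul_right _ _)
  simp only [hGdef, h1]
  split_ifs with hd
  · obtain ⟨b, hb⟩ := hd
    rw [osc, osc, ← Complex.exp_add, ← Complex.exp_add, Complex.exp_eq_exp_iff_exists_int]
    -- The two phases differ by 2πi times this integer, in which b and e are the quotients from the
    -- residue condition and from hh' ≡ -1.
    refine ⟨-(m.1 * (h' * b + e * (R * l + r))), ?_⟩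
    have hα : (α.2 : ℂ) = h * (R * l + r) - k * b := by
      have : α.2 = h * (R * l + r) - k * b := by linarith
      rw [this]
      push_cast
      ring
    have hec : (h : ℂ) * h' = -1 - k * e := by exact_mod_cast congrArg (Int.cast : ℤ → ℂ) he'
    simp only [quadForm, coset, latticePoint]
    push_cast
    rw [hα]
    field_simp
    linear_combination (R : ℂ) * m.1 * (R * l + r) * hec
  · ring

/-! ### Lattice sums -/

lemma latticePoint_injective {R : ℕ} (hR : R ≠ 0) (α : ℤ × ℤ) :
    Function.Injective (latticePoint R α) := by
  have hR' : (R : ℤ) ≠ 0 := by exact_mod_cast hR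
  rintro ⟨a, b⟩ ⟨c, d⟩ h
  simp only [latticePoint, Prod.mk.injEq, add_left_inj] at h
  exact Prod.ext (mul_left_cancel₀ hR' h.1) (mul_left_cancel₀ hR' h.2)

lemma coset_eq {R : ℕ} (hR : R ≠ 0) (a j : ℤ) : coset R a j = ((R * j + a : ℤ) : ℝ) / R := by
  have hR' : (R : ℝ) ≠ 0 := by exact_mod_cast hR
  rw [coset]
  push_cast
  field_simp

lemma coset_ne_zero_iff {R : ℕ} (hR : R ≠ 0) (a j : ℤ) : coset R a j ≠ 0 ↔ (R * j + a : ℤ) ≠ 0 := by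
  have hR' : (R : ℝ) ≠ 0 := by exact_mod_cast hR
  rw [coset_eq hR, div_ne_zero_iff, Int.cast_ne_zero]
  exact and_iff_left hR'

lemma mem_latticeIndex_iff {R : ℕ} (hR : R ≠ 0) (α m : ℤ × ℤ) :
    m ∈ latticeIndex R α ↔ (latticePoint R α m).1 ≠ 0 ∧ (latticePoint R α m).2 ≠ 0 :=
  and_congr (coset_ne_zero_iff hR _ _) (coset_ne_zero_iff hR _ _)

lemma quadForm_eq {R : ℕ} (hR : R ≠ 0) (α m : ℤ × ℤ) :
    quadForm R α m = (latticePoint R α m).1 * (latticePoint R α m).2 / R := by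
  have hR' : (R : ℝ) ≠ 0 := by exact_mod_cast hR
  rw [quadForm, coset_eq hR, coset_eq hR, latticePoint]
  field_simp

/-- A lattice sum splits into the cosets of `R ℤ²`. -/
lemma tsum_eq_sum_latticePoint {R : ℕ} (hR : R ≠ 0) {H : ℤ × ℤ → ℂ} (hH : Summable H) :
    ∑' N, H N = ∑ α ∈ Finset.Ico (0 : ℤ) R ×ˢ Finset.Ico (0 : ℤ) R,
      ∑' m, H (latticePoint R α m) := by
  have hR' : (0 : ℤ) < R := by exact_mod_cast Nat.pos_of_ne_zero hR
  set K : ℤ × ℤ → ℤ × ℤ → ℂ := fun α N => if (N.1 % R, N.2 % R) = α then H N else 0 with hK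
  have hKs : ∀ α, Summable (K α) := fun α => by
    refine Summable.of_norm_bounded hH.norm fun N => ?_
    simp only [hK]
    split_ifs <;> simp
  have h1 : ∀ N, H N = ∑ α ∈ Finset.Ico (0 : ℤ) R ×ˢ Finset.Ico (0 : ℤ) R, K α N := by
    intro N
    simp only [hK]
    rw [Finset.sum_ite_eq, if_pos]
    simp only [Finset.mem_product, Finset.mem_Ico]
    exact ⟨⟨Int.emod_nonneg _ hR'.ne', Int.emod_lt_of_pos _ hR'⟩,
      ⟨Int.emod_nonneg _ hR'.ne', Int.emod_lt_of_pos _ hR'⟩⟩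
  rw [tsum_congr h1, Summable.tsum_finsetSum fun α _ => hKs α]
  refine Finset.sum_congr rfl fun α hα => ?_
  obtain ⟨a, b⟩ := α
  simp only [Finset.mem_product, Finset.mem_Ico] at hα
  rw [← (latticePoint_injective hR (a, b)).tsum_eq]
  · refine tsum_congr fun m => ?_
    simp only [hK, latticePoint]
    rw [if_pos]
    rw [Int.mul_add_emod_self_left, Int.mul_add_emod_self_left, Int.emod_eq_of_lt hα.1.1 hα.1.2,
      Int.emod_eq_of_lt hα.2.1 hα.2.2]
  · intro N hN
    have hN' : (N.1 % R, N.2 % R) = (a, b) := by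
      by_contra hne
      exact hN (by simp only [hK, if_neg hne])
    rw [Prod.mk.injEq] at hN'
    refine ⟨(N.1 / R, N.2 / R), ?_⟩
    rw [latticePoint]
    refine Prod.ext ?_ ?_
    · simp only
      rw [← hN'.1, Int.mul_ediv_add_emod]
    · simp only
      rw [← hN'.2, Int.mul_ediv_add_emod]

lemma tsum_latticePoint_eq {R : ℕ} (hR : R ≠ 0) (α : ℤ × ℤ) {H : ℤ × ℤ → ℂ}
    (hH : ∀ N : ℤ × ℤ, N.1 = 0 ∨ N.2 = 0 → H N = 0) :
    ∑' m, H (latticePoint R α m) = ∑' m : latticeIndex R α, H (latticePoint R α m) := by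
  refine (tsum_subtype_eq_of_support_subset (f := fun m => H (latticePoint R α m)) fun m hm => ?_).symm
  rw [mem_latticeIndex_iff hR]
  by_contra hc
  rw [not_and_or, not_ne_iff, not_ne_iff] at hc
  exact hm (hH _ hc)

lemma summable_one_div_sq_mul : Summable fun N : ℤ × ℤ => 1 / (N.1 : ℝ) ^ 2 * (1 / (N.2 : ℝ) ^ 2) := by
  have h : Summable fun n : ℤ => 1 / (n : ℝ) ^ 2 := Real.summable_one_div_int_pow.2 one_lt_two
  exact h.mul_of_nonneg h (fun n => by positivity) fun n => by positivity

lemma summable_latticeIndex_one_div {R : ℕ} (hR : R ≠ 0) (α : ℤ × ℤ) :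
    Summable fun m : latticeIndex R α => 1 / ((latticePoint R α m).1 : ℝ) ^ 2
      * (1 / ((latticePoint R α m).2 : ℝ) ^ 2) :=
  summable_one_div_sq_mul.comp_injective
    ((latticePoint_injective hR α).comp Subtype.val_injective)

/-- The coefficients `poleCoeff` on the lattice `ℤ × k⁻¹ℤ`, extended by zero to the second axis. -/
def latticeCoeff (k : ℕ) (t : ℂ) (N : ℤ × ℤ) : ℂ :=
  if N.2 = 0 then 0 else poleCoeff t N.1 ((N.2 : ℝ) / k)

lemma latticeCoeff_eq_zero {k : ℕ} {t : ℂ} {N : ℤ × ℤ} (hN : N.1 = 0 ∨ N.2 = 0) :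
    latticeCoeff k t N = 0 := by
  rw [latticeCoeff]
  split_ifs with h
  · rfl
  · rw [hN.resolve_right h, poleCoeff_zero]

lemma exists_norm_latticeCoeff_le {k : ℕ} (hk : k ≠ 0) {t : ℂ} (ht : 0 < t.re) :
    ∃ C : ℝ, ∀ N : ℤ × ℤ,
      ‖latticeCoeff k t N‖ ≤ C * (1 / (N.1 : ℝ) ^ 2 * (1 / (N.2 : ℝ) ^ 2)) := by
  obtain ⟨C, hC⟩ := exists_norm_poleCoeff_le ht
  have hk' : (k : ℝ) ≠ 0 := by exact_mod_cast hk
  refine ⟨C * k ^ 2, fun N => ?_⟩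
  rw [latticeCoeff]
  split_ifs with h
  · simp [h]
  · have h' : (N.2 : ℝ) ≠ 0 := by exact_mod_cast h
    refine (hC N.1 _ (div_ne_zero h' hk')).trans (le_of_eq ?_)
    field_simp

lemma summable_latticeCoeff {k : ℕ} (hk : k ≠ 0) {t : ℂ} (ht : 0 < t.re) :
    Summable fun N => ‖latticeCoeff k t N‖ := by
  obtain ⟨C, hC⟩ := exists_norm_latticeCoeff_le hk ht
  exact Summable.of_nonneg_of_le (fun _ => norm_nonneg _) hC (summable_one_div_sq_mul.mul_left C)

lemma summable_residue_latticeCoeff {k : ℕ} (hk : k ≠ 0) {t : ℂ} (ht : 0 < t.re) (M : ℤ) (a : ℝ) :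
    Summable fun N : ℤ × ℤ =>
      (if (k : ℤ) ∣ M - N.2 then osc (-N.1) a else 0) * latticeCoeff k t N := by
  refine Summable.of_norm_bounded (summable_latticeCoeff hk ht) fun N => ?_
  rw [norm_mul]
  refine mul_le_of_le_one_left (norm_nonneg _) ?_
  split_ifs
  · rw [norm_osc]
  · simp

/-- The poles M/k + n are the numbers N₂/k with N₂ ≡ M mod k. Hence the series for different
residues become sums over one lattice with congruence weights. -/
lemma poleSeries_eq_tsum {k : ℕ} (hk : k ≠ 0) (t : ℂ) (M : ℤ) (a : ℝ) :
    poleSeries ((M : ℝ) / k) t a = ∑' N : ℤ × ℤ,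
      (if (k : ℤ) ∣ M - N.2 then osc (-N.1) a else 0) * latticeCoeff k t N := by
  have hk' : (k : ℝ) ≠ 0 := by exact_mod_cast hk
  have hkz : (k : ℤ) ≠ 0 := by exact_mod_cast hk
  have hy : ∀ n : ℤ, (M : ℝ) / k + n = ((M + k * n : ℤ) : ℝ) / k := fun n => by
    push_cast
    field_simp
  set ι : ℤ × nzShift ((M : ℝ) / k) → ℤ × ℤ := fun p => (p.1, M + k * (p.2 : ℤ)) with hι
  have hinj : Function.Injective ι := by
    rintro ⟨a, b, hb⟩ ⟨c, d, hd⟩ h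
    simp only [hι, Prod.mk.injEq, add_right_inj] at h
    exact Prod.ext h.1 (Subtype.ext (mul_left_cancel₀ hkz h.2))
  rw [← hinj.tsum_eq, poleSeries]
  · refine tsum_congr fun p => ?_
    have hp := p.2.2
    rw [hy] at hp
    have hp' : M + k * (p.2 : ℤ) ≠ 0 := by
      intro h
      apply hp
      rw [h]
      simp
    simp only [hι, latticeCoeff]
    rw [if_pos ⟨-(p.2 : ℤ), by ring⟩, if_neg hp', hy]
  · intro N hN
    have h1 : (k : ℤ) ∣ M - N.2 := by
      by_contra hc
      exact hN (by simp only [if_neg hc, zero_mul])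
    have h2 : N.2 ≠ 0 := by
      intro hc
      exact hN (by simp only [latticeCoeff_eq_zero (Or.inr hc), mul_zero])
    obtain ⟨c, hc⟩ := h1
    have hc' : M + k * (-c) = N.2 := by linarith
    refine ⟨(N.1, ⟨-c, ?_⟩), ?_⟩
    · rw [hy, hc']
      exact div_ne_zero (by exact_mod_cast h2) hk'
    · simp only [hι]
      rw [hc']

lemma sum_poleSeries_eq {R r h k : ℕ} (hk : k ≠ 0) {t : ℂ} (ht : 0 < t.re) :
    ∑ l ∈ Finset.range k, poleSeries ((h : ℝ) * ((R : ℝ) * l + r) / k) t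
        (((R : ℝ) * l + r) / ((R : ℝ) * k))
      = ∑' N, residueSum R r h k N * latticeCoeff k t N := by
  simp only [residueSum, Finset.sum_mul]
  rw [Summable.tsum_finsetSum fun l _ => summable_residue_latticeCoeff hk ht _ _]
  refine Finset.sum_congr rfl fun l _ => ?_
  rw [← poleSeries_eq_tsum hk]
  push_cast
  rfl

lemma summable_residueSum_mul {R r h k : ℕ} (hk : k ≠ 0) {t : ℂ} (ht : 0 < t.re) :
    Summable fun N => residueSum R r h k N * latticeCoeff k t N := by
  simp only [residueSum, Finset.sum_mul]
  exact summable_sum fun l _ => summable_residue_latticeCoeff hk ht _ _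

/-! ### The theta and Mordell terms -/

/-- The choice ϱ = h'/k leaves τ - ϱ = i/z, hence the decay rate 2π/z. -/
lemma mordellIntegrand_eq {k : ℕ} (h' : ℤ) (z : ℂ) (a : ℝ) :
    mordellIntegrand ((h' : ℚ) / k) ((h' : ℂ) / k + Complex.I / z) a
      = laplaceIntegrand (2 * Real.pi / z) a := by
  funext x
  rw [mordellIntegrand, laplaceIntegrand]
  congr 3
  push_cast
  linear_combination (2 * Real.pi * x / z : ℂ) * Complex.I_sq

lemma quadForm_ne_zero {R : ℕ} (hR : R ≠ 0) {α m : ℤ × ℤ} (hm : m ∈ latticeIndex R α) :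
    quadForm R α m ≠ 0 := by
  have hR' : (R : ℝ) ≠ 0 := by exact_mod_cast hR
  exact mul_ne_zero (mul_ne_zero hR' hm.1) hm.2

lemma pvExists_mordellIntegrand {R k : ℕ} (hR : R ≠ 0) (h' : ℤ) {z : ℂ} (hz : 0 < z.re) {α m : ℤ × ℤ}
    (hm : m ∈ latticeIndex R α) :
    PVExists (mordellIntegrand ((h' : ℚ) / k) ((h' : ℂ) / k + Complex.I / z) (quadForm R α m))
      (quadForm R α m) := by
  rw [mordellIntegrand_eq]
  exact (pv_laplace (σ := 1) (by norm_num) hz (quadForm_ne_zero hR hm)).1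

lemma sign_add_sign_eq {R : ℕ} (hR : R ≠ 0) {α m : ℤ × ℤ} (hm : m ∈ latticeIndex R α) :
    Real.sign (coset R α.1 m.1) + Real.sign (coset R α.2 m.2)
      = if 0 < quadForm R α m then 2 * ((latticePoint R α m).1.sign : ℝ) else 0 := by
  have hR' : (0 : ℝ) < R := by exact_mod_cast Nat.pos_of_ne_zero hR
  have hs : ((latticePoint R α m).1.sign : ℝ) = Real.sign (coset R α.1 m.1) := by
    rw [coset_eq hR, latticePoint]
    simp only
    rcases lt_trichotomy (R * m.1 + α.1) 0 with h | h | h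
    · rw [Int.sign_eq_neg_one_of_neg h, Real.sign_of_neg (div_neg_of_neg_of_pos (by exact_mod_cast h) hR')]
      simp
    · simp [h]
    · rw [Int.sign_eq_one_of_pos h, Real.sign_of_pos (div_pos (by exact_mod_cast h) hR')]
      simp
  rw [hs, quadForm, mul_assoc]
  simp only [mul_pos_iff_of_pos_left hR']
  obtain ⟨h1, h2⟩ := hm
  rcases lt_or_gt_of_ne h1 with h1 | h1 <;> rcases lt_or_gt_of_ne h2 with h2 | h2
  · rw [if_pos (mul_pos_of_neg_of_neg h1 h2), Real.sign_of_neg h1, Real.sign_of_neg h2]; norm_num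
  · rw [if_neg (mul_neg_of_neg_of_pos h1 h2).not_gt, Real.sign_of_neg h1, Real.sign_of_pos h2]; norm_num
  · rw [if_neg (mul_neg_of_pos_of_neg h1 h2).not_gt, Real.sign_of_pos h1, Real.sign_of_neg h2]; norm_num
  · rw [if_pos (mul_pos h1 h2), Real.sign_of_pos h1, Real.sign_of_pos h2]; norm_num

lemma fTerm_eq {R k : ℕ} (hR : R ≠ 0) (h' : ℤ) (z : ℂ) {α m : ℤ × ℤ} (hm : m ∈ latticeIndex R α) :
    fTerm R α ((h' : ℂ) / k + Complex.I / z) m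
      = Complex.exp (2 * Real.pi * Complex.I * (h' / k) * (quadForm R α m : ℂ)) *
        if 0 < quadForm R α m then 2 * ((latticePoint R α m).1.sign : ℂ) *
          Complex.exp (-(2 * Real.pi * (quadForm R α m / z))) else 0 := by
  rw [fTerm, sign_add_sign_eq hR hm]
  have he : 2 * Real.pi * Complex.I * ((h' : ℂ) / k + Complex.I / z) * (quadForm R α m : ℂ)
      = 2 * Real.pi * Complex.I * (h' / k) * (quadForm R α m : ℂ)
        + -(2 * Real.pi * (quadForm R α m / z)) := by
    linear_combination (2 * Real.pi * quadForm R α m / z : ℂ) * Complex.I_sq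
  rw [he, Complex.exp_add]
  split_ifs
  · push_cast
    ring
  · simp

/-- When both coordinates have the same sign, 2πi · (1/4) · 2 sgn(N₁) = πi sgn(N₁), which is exactly
the half residue in `pv_laplace`; otherwise the theta term and the residue both vanish. -/
lemma fTerm_add_mordellTerm {R k : ℕ} (hR : R ≠ 0) (hk : k ≠ 0) (h' : ℤ) {z : ℂ} (hz : 0 < z.re)
    {α m : ℤ × ℤ} (hm : m ∈ latticeIndex R α) :
    2 * Real.pi * Complex.I * (1 / 4 * fTerm R α ((h' : ℂ) / k + Complex.I / z) m)
        + mordellTerm R α ((h' : ℚ) / k) ((h' : ℂ) / k + Complex.I / z) m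
      = Complex.exp (2 * Real.pi * Complex.I * (h' / k) * (quadForm R α m : ℂ)) *
        latticeCoeff k (2 * Real.pi * z * R / k) (latticePoint R α m) := by
  have hRc : (R : ℂ) ≠ 0 := by exact_mod_cast hR
  have hkc : (k : ℂ) ≠ 0 := by exact_mod_cast hk
  have hpi : (Real.pi : ℂ) ≠ 0 := by exact_mod_cast Real.pi_ne_zero
  have hz0 : z ≠ 0 := by rintro rfl; simp at hz
  have hN := (mem_latticeIndex_iff hR α m).1 hm
  -- The principal value does not involve σ, so the sign may be taken to be that of N₁, as in
  -- `poleCoeff`.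
  have hpv := (pv_laplace (sign_sq_eq_one hN.1) hz (quadForm_ne_zero hR hm)).2
  -- The argument is 2πN₁(N₂/k) divided by 2πzR/k, that is N₁N₂/(Rz).
  have hc : latticeCoeff k (2 * Real.pi * z * R / k) (latticePoint R α m)
      = oscSide ((latticePoint R α m).1.sign : ℝ) (quadForm R α m / z) := by
    rw [latticeCoeff, if_neg hN.2, poleCoeff, quadForm_eq hR]
    congr 1
    push_cast
    field_simp
  have hexp : mordellTerm R α ((h' : ℚ) / k) ((h' : ℂ) / k + Complex.I / z) m
      = Complex.exp (2 * Real.pi * Complex.I * (h' / k) * (quadForm R α m : ℂ)) *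
        (1 / (quadForm R α m : ℂ) *
          pvIntegral (laplaceIntegrand (2 * Real.pi / z) (quadForm R α m)) (quadForm R α m)) := by
    rw [mordellTerm, mordellIntegrand_eq]
    push_cast
    ring
  rw [hexp, hpv, fTerm_eq hR h' z hm, hc]
  split_ifs
  · push_cast
    ring
  · ring

/-- Only terms with n₁n₂ > 0 survive, and e^{-x} ≤ 2/x² bounds them by a product of inverse squares,
which is summable over the lattice. -/
lemma summable_fTerm {R k : ℕ} (hR : R ≠ 0) (h' : ℤ) {z : ℂ} (hz : 0 < z.re) (α : ℤ × ℤ) :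
    Summable fun m : latticeIndex R α => fTerm R α ((h' : ℂ) / k + Complex.I / z) m := by
  have hz0 : z ≠ 0 := by rintro rfl; simp at hz
  have hρ : 0 < (1 / z).re := by
    rw [one_div, Complex.inv_re]
    exact div_pos hz (Complex.normSq_pos.2 hz0)
  set ρ := (1 / z).re
  have hR' : (0 : ℝ) < R := by exact_mod_cast Nat.pos_of_ne_zero hR
  have hpi := Real.pi_pos
  refine Summable.of_norm_bounded
    ((summable_latticeIndex_one_div hR α).mul_left (2 * (2 * (R / (2 * Real.pi * ρ)) ^ 2))) fun m => ?_
  have hN := (mem_latticeIndex_iff hR α m).1 m.2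
  rw [fTerm_eq hR h' z m.2, norm_mul]
  have h1 : ‖Complex.exp (2 * Real.pi * Complex.I * (h' / k) * (quadForm R α m : ℂ))‖ = 1 := by
    rw [show 2 * Real.pi * Complex.I * ((h' : ℂ) / k) * (quadForm R α m : ℂ)
      = ((2 * Real.pi * (h' / k) * quadForm R α m : ℝ) : ℂ) * Complex.I by push_cast; ring]
    exact Complex.norm_exp_ofReal_mul_I _
  rw [h1, one_mul]
  split_ifs with hA
  · have hsg : ‖((latticePoint R α m).1.sign : ℂ)‖ = 1 := by
      rcases lt_or_gt_of_ne hN.1 with h | h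
      · simp [Int.sign_eq_neg_one_of_neg h]
      · simp [Int.sign_eq_one_of_pos h]
    have h2 : ‖Complex.exp (-(2 * Real.pi * (quadForm R α m / z)))‖
        = Real.exp (-(2 * Real.pi * ρ * quadForm R α m)) := by
      rw [show -(2 * Real.pi * ((quadForm R α m : ℂ) / z))
        = ((-(2 * Real.pi * quadForm R α m) : ℝ) : ℂ) * (1 / z) by push_cast; ring,
        Complex.norm_exp, Complex.re_ofReal_mul]
      congr 1
      ring
    rw [norm_mul, norm_mul, hsg, h2, mul_one, Complex.norm_ofNat]
    have h3 := exp_neg_le_div_sq (x := 2 * Real.pi * ρ * quadForm R α m) (by positivity)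
    have h4 : (2 : ℝ) / (2 * Real.pi * ρ * quadForm R α m) ^ 2
        = 2 * (R / (2 * Real.pi * ρ)) ^ 2 * (1 / ((latticePoint R α m).1 : ℝ) ^ 2
          * (1 / ((latticePoint R α m).2 : ℝ) ^ 2)) := by
      have hN1 : ((latticePoint R α m).1 : ℝ) ≠ 0 := by exact_mod_cast hN.1
      have hN2 : ((latticePoint R α m).2 : ℝ) ≠ 0 := by exact_mod_cast hN.2
      rw [quadForm_eq hR]
      field_simp
    rw [h4] at h3
    linarith
  · rw [norm_zero]
    positivity

lemma summable_theta_mordell {R k : ℕ} (hR : R ≠ 0) (hk : k ≠ 0) (h' : ℤ) {z : ℂ} (hz : 0 < z.re)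
    (α : ℤ × ℤ) : Summable fun m : latticeIndex R α =>
      2 * Real.pi * Complex.I * (1 / 4 * fTerm R α ((h' : ℂ) / k + Complex.I / z) m)
        + mordellTerm R α ((h' : ℚ) / k) ((h' : ℂ) / k + Complex.I / z) m := by
  refine Summable.of_norm_bounded ((summable_latticeCoeff hk (re_period_pos hR hk hz)).comp_injective
    ((latticePoint_injective hR α).comp Subtype.val_injective)) fun m => ?_
  rw [fTerm_add_mordellTerm hR hk h' hz m.2, norm_mul]
  have h1 : ‖Complex.exp (2 * Real.pi * Complex.I * (h' / k) * (quadForm R α m : ℂ))‖ = 1 := by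
    rw [show 2 * Real.pi * Complex.I * ((h' : ℂ) / k) * (quadForm R α m : ℂ)
      = ((2 * Real.pi * (h' / k) * quadForm R α m : ℝ) : ℂ) * Complex.I by push_cast; ring]
    exact Complex.norm_exp_ofReal_mul_I _
  rw [h1, one_mul]
  rfl

/-- No direct estimate of the principal values is made: the combined terms are controlled by
`latticeCoeff` and the theta terms are summable by themselves. -/
lemma summable_mordellTerm {R k : ℕ} (hR : R ≠ 0) (hk : k ≠ 0) (h' : ℤ) {z : ℂ} (hz : 0 < z.re)
    (α : ℤ × ℤ) : Summable fun m : latticeIndex R α =>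
      mordellTerm R α ((h' : ℚ) / k) ((h' : ℂ) / k + Complex.I / z) m := by
  refine ((summable_theta_mordell hR hk h' hz α).sub
    (((summable_fTerm (k := k) hR h' hz α).mul_left (1 / 4)).mul_left
      (2 * Real.pi * Complex.I))).congr fun m => ?_
  ring

theorem sum_poleSeries_eq_sum_weilMultiplier {R r h k : ℕ} (hR : R ≠ 0) (hk : k ≠ 0) {h' : ℤ}
    (hh' : (h : ℤ) * h' ≡ -1 [ZMOD (k : ℤ)]) {z : ℂ} (hz : 0 < z.re) :
    ∑ l ∈ Finset.range k, poleSeries ((h : ℝ) * ((R : ℝ) * l + r) / k) (2 * Real.pi * z * R / k)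
        (((R : ℝ) * l + r) / ((R : ℝ) * k))
      = 2 * Real.pi * Complex.I * R *
        ∑ α ∈ Finset.Ico (0 : ℤ) R ×ˢ Finset.Ico (0 : ℤ) R,
          weilMultiplier R r h k h' α * (f R α ((h' : ℂ) / k + Complex.I / z)
            + mordell R α ((h' : ℚ) / k) ((h' : ℂ) / k + Complex.I / z)) := by
  have hRc : (R : ℂ) ≠ 0 := by exact_mod_cast hR
  have hpi : (Real.pi : ℂ) ≠ 0 := by exact_mod_cast Real.pi_ne_zero
  have hI := Complex.I_ne_zero
  have ht := re_period_pos hR hk hz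
  rw [sum_poleSeries_eq hk ht, tsum_eq_sum_latticePoint hR (summable_residueSum_mul hk ht),
    Finset.mul_sum]
  refine Finset.sum_congr rfl fun α _ => ?_
  rw [tsum_latticePoint_eq hR α (H := fun N => residueSum R r h k N *
    latticeCoeff k (2 * Real.pi * z * R / k) N) fun N hN => by rw [latticeCoeff_eq_zero hN, mul_zero]]
  have hterm : ∀ m : latticeIndex R α, residueSum R r h k (latticePoint R α m) *
      latticeCoeff k (2 * Real.pi * z * R / k) (latticePoint R α m)
      = R * weilMultiplier R r h k h' α *
        (2 * Real.pi * Complex.I * (1 / 4 * fTerm R α ((h' : ℂ) / k + Complex.I / z) m)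
        + mordellTerm R α ((h' : ℚ) / k) ((h' : ℂ) / k + Complex.I / z) m) := by
    intro m
    have h1 := weilMultiplier_mul_exp (r := r) hR hk hh' α m
    rw [fTerm_add_mordellTerm hR hk h' hz m.2]
    have h2 : residueSum R r h k (latticePoint R α m) = R * (weilMultiplier R r h k h' α *
        Complex.exp (2 * Real.pi * Complex.I * (h' / k) * (quadForm R α m : ℂ))) := by
      rw [h1]
      field_simp
    rw [h2]
    ring
  have hf := summable_fTerm (k := k) hR h' hz α
  rw [tsum_congr hterm, tsum_mul_left, Summable.tsum_add ((hf.mul_left _).mul_left _)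
    (summable_mordellTerm hR hk h' hz α), tsum_mul_left, tsum_mul_left, f, mordell]
  field_simp

end Eisenstein

end


/-! ### The transformation formula. -/

theorem theorem1p1 (R r h k : ℕ) (h' : ℤ) (hR : 1 ≤ R) (hr1 : 1 ≤ r) (hrR : r ≤ R)
    (hhk : h < k) (hcop : Nat.gcd h k = 1)
    (hh'0 : 0 ≤ h') (hh'k : h' < (k : ℤ)) (hh' : (h : ℤ) * h' ≡ -1 [ZMOD (k : ℤ)])
    (z : ℂ) (hz : 0 < z.re) :
    Summable (fun m : Eisenstein.progression R r =>
        Eisenstein.FTerm ((h : ℂ) / k + Complex.I * z / (k : ℂ) ^ 2) m) ∧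
    (∀ α : ℤ × ℤ,
      Summable (fun m : Eisenstein.latticeIndex R α =>
        Eisenstein.fTerm R α ((h' : ℂ) / k + Complex.I / z) m) ∧
      (∀ m ∈ Eisenstein.latticeIndex R α,
        Eisenstein.PVExists
          (Eisenstein.mordellIntegrand ((h' : ℚ) / k) ((h' : ℂ) / k + Complex.I / z)
            (Eisenstein.quadForm R α m))
          (Eisenstein.quadForm R α m)) ∧
      Summable (fun m : Eisenstein.latticeIndex R α =>
        Eisenstein.mordellTerm R α ((h' : ℚ) / k) ((h' : ℂ) / k + Complex.I / z) m)) ∧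
    Eisenstein.F R r ((h : ℂ) / k + Complex.I * z / (k : ℂ) ^ 2) =
      -Eisenstein.constC R r k * (Complex.log z / z)
        + Eisenstein.constA R r h k / z + Eisenstein.constB R r h k
        + Complex.I * k / z *
          ∑ α ∈ Finset.Ico (0 : ℤ) R ×ˢ Finset.Ico (0 : ℤ) R,
            Eisenstein.weilMultiplier R r h k h' α *
              (Eisenstein.f R α ((h' : ℂ) / k + Complex.I / z)
                + Eisenstein.mordell R α ((h' : ℚ) / k) ((h' : ℂ) / k + Complex.I / z)) := by
  have hR0 : R ≠ 0 := by omega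
  have hk0 : k ≠ 0 := by omega
  refine ⟨Eisenstein.summable_FTerm R r (Eisenstein.im_cusp_pos hk0 hz),
    fun α => ⟨Eisenstein.summable_fTerm hR0 h' hz α,
      fun m hm => Eisenstein.pvExists_mordellIntegrand hR0 h' hz hm,
      Eisenstein.summable_mordellTerm hR0 hk0 h' hz α⟩, ?_⟩
  rw [Eisenstein.F_eq_elementary_add hr1 hrR hk0 hcop hz,
    Eisenstein.sum_poleSeries_eq_sum_weilMultiplier hR0 hk0 hh' hz]
  have hz0 : z ≠ 0 := by rintro rfl; simp at hz
  have hRc : (R : ℂ) ≠ 0 := by exact_mod_cast hR0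
  have hpi : (Real.pi : ℂ) ≠ 0 := by exact_mod_cast Real.pi_ne_zero
  congr 1
  -- What remains is k/(2πzR) · 2πiR = ik/z.
  rw [← mul_assoc]
  congr 1
  field_simp
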